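/- Let $M$ be a smooth $n$-manifold, $0\le\tau_1<\tau_2$, and let $g(\tau)$, $\tau\in[\tau_1,\tau_2]$, be a smooth family of Riemannian metrics on $M$ with $\partial_\tau g=2\,\mathrm{Ric}$ (a backward Ricci flow), complete for each $\tau$ and with uniformly bounded curvature. An $\mathcal L$-geodesic is a curve $\gamma$ in $M$, smooth as a function of $\sigma=\sqrt\tau$, with $$\nabla_XX-\tfrac12\nabla R+\tfrac1{2\tau}X+2\,\mathrm{Ric}(X)=0,\qquad X=\dot\gamma,$$ where at time $\tau$ all geometric quantities are those of $g(\tau)$. For $p\in M$ and $v\in T_pM$ let $\gamma_v$ be the $\mathcal L$-geodesic with $\gamma_v(\tau_1)=p$ and $\lim_{\tau\to\tau_1^+}\sqrt\tau\,\dot\gamma_v(\tau)=v$, and assume that it is defined on $[\tau_1,\tau_2]$. The point $\gamma_v(\tau)$, $\tau_1<\tau\le\tau_2$, is called $\mathcal L$-conjugate to $\gamma_v(\tau_1)$ along $\gamma_v$ if $v$ is a critical point of the map $w\mapsto\gamma_w(\tau)$. An $\mathcal L$-Jacobi field along $\gamma_v$ is the variation field $\partial_s|_{s=0}\gamma_s$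 of a smooth one-parameter family of $\mathcal L$-geodesics $\gamma_s$ on $[\tau_1,\tau_2]$ with $\gamma_0=\gamma_v$. For piecewise smooth vector fields $U,V$ along $\gamma_v$ (continuous, and piecewise smooth as functions of $\sqrt\tau$) put, with $X=\dot\gamma_v$, $$I(U,V)=\int_{\tau_1}^{\tau_2}\sqrt\tau\,\bigl[(\mathrm{Hess}\,R)(U,V)+2\langle\nabla_XU,\nabla_XV\rangle+2\langle R(U,X)V,X\rangle-2(\nabla_U\mathrm{Ric})(V,X)-2(\nabla_V\mathrm{Ric})(U,X)+2(\nabla_X\mathrm{Ric})(U,V)\bigr]\,d\tau,$$ where $R(A,B)C=\nabla_A\nabla_BC-\nabla_B\nabla_AC-\nabla_{[A,B]}C$. Suppose that no point $\gamma_v(\tau)$, $\tau_1<\tau\le\tau_2$, is $\mathcal L$-conjugate to $\gamma_v(\tau_1)$ along $\gamma_v$. Let $U,Y$ be piecewise smooth vector fields along $\gamma_v$ with $U(\tau_1)=Y(\tau_1)$ and $U(\tau_2)=Y(\tau_2)$, and let $U$ be an $\mathcal L$-Jacobi field. Then the integrals $I(U,U)$ and $I(Y,Y)$ converge absolutely,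 $I(U,U)\le I(Y,Y)$, and equality holds if and only if $Y=U$ on $[\tau_1,\tau_2]$. -/

import Mathlib

open Set Filter MeasureTheory Topology Manifold Bundle
open scoped ContDiff Manifold ENNReal

noncomputable section

namespace LGeometry

/-- The model space `ℝⁿ`. -/
abbrev Mod (n : ℕ) : Type := EuclideanSpace ℝ (Fin n)

/-! ### Riemannian geometry in coordinates

`G y` is the bilinear form of a Riemannian metric at the point `y` of an open subset of `ℝⁿ`.
Vectors are elements of `ℝⁿ`; the coordinate vector fields are the constant fields. -/

section Coordinates

variable {n : ℕ} (G : Mod n → (Mod n →L[ℝ] Mod n →L[ℝ] ℝ))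

/-- The Christoffel symbol `Γ(a, b) = ∇_a b` for constant vector fields `a`, `b`, given by
`G(Γ(a,b), c) = ½ (∂_a G(b,c) + ∂_b G(a,c) - ∂_c G(a,b))`. -/
def christoffel (y a b : Mod n) : Mod n :=
  (G y).inverse
    ((1 / 2 : ℝ) • (fderiv ℝ G y a b + fderiv ℝ G y b a - ((fderiv ℝ G y).flip a).flip b))

/-- The curvature tensor `R(a,b)c = ∇_a ∇_b c - ∇_b ∇_a c - ∇_[a,b] c`. -/
def curvature (y a b c : Mod n) : Mod n :=
  fderiv ℝ (fun z => christoffel G z b c) y a - fderiv ℝ (fun z => christoffel G z a c) y b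
    + christoffel G y a (christoffel G y b c) - christoffel G y b (christoffel G y a c)

/-- The Ricci tensor `Ric(b,c) = trace (a ↦ R(a,b)c)`. -/
def ricci (y b c : Mod n) : ℝ :=
  ∑ i, curvature G y (EuclideanSpace.single i 1) b c i

/-- The components `g^{ij}` of the inverse metric: `G⁻¹` maps the covector `dyⁱ` to the vector
with components `(g^{ij})_j`. -/
def inverseMetric (y : Mod n) (i j : Fin n) : ℝ :=
  (G y).inverse (EuclideanSpace.proj i : Mod n →L[ℝ] ℝ) j

/-- The scalar curvature `R = g^{ij} Ric_{ij}`. -/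
def scalarCurvature (y : Mod n) : ℝ :=
  ∑ i, ∑ j, inverseMetric G y i j *
    ricci G y (EuclideanSpace.single i 1) (EuclideanSpace.single j 1)

/-- The Hessian `(Hess R)(a,b)` of the scalar curvature. -/
def hessScalar (y a b : Mod n) : ℝ :=
  fderiv ℝ (fun z => fderiv ℝ (scalarCurvature G) z b) y a
    - fderiv ℝ (scalarCurvature G) y (christoffel G y a b)

/-- The covariant derivative `(∇_w Ric)(a,b)` of the Ricci tensor. -/
def covRicci (y w a b : Mod n) : ℝ :=
  fderiv ℝ (fun z => ricci G z a b) y w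
    - ricci G y (christoffel G y w a) b - ricci G y a (christoffel G y w b)

end Coordinates

/-! ### Riemannian metrics on a manifold -/

section Manifolds

variable {n : ℕ} {M : Type*} [TopologicalSpace M] [ChartedSpace (Mod n) M]
  [IsManifold (𝓡 n) ∞ M]

variable (n M) in
/-- Smooth Riemannian metrics on the `n`-manifold `M`. -/
abbrev Metric : Type _ :=
  ContMDiffRiemannianMetric (𝓡 n) ∞ (Mod n) (fun x : M => TangentSpace (𝓡 n) x)

/-- The scalar product on `T_q M`, which is the space `ℝⁿ` in Mathlib. -/
def metricForm (g : Metric n M) (q : M) : Mod n →L[ℝ] Mod n →L[ℝ] ℝ := g.inner q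

/-- The differential of the inverse of the chart at `x₀`. -/
def chartSymmDeriv (x₀ : M) (y : Mod n) : Mod n →L[ℝ] Mod n :=
  mfderiv (𝓡 n) (𝓡 n) (extChartAt (𝓡 n) x₀).symm y

/-- The metric `g` written in the chart at `x₀`, i.e. its pullback by the inverse of the chart. -/
def chartMetric (g : Metric n M) (x₀ : M) (y : Mod n) : Mod n →L[ℝ] Mod n →L[ℝ] ℝ :=
  (metricForm g ((extChartAt (𝓡 n) x₀).symm y)).bilinearComp
    (chartSymmDeriv x₀ y) (chartSymmDeriv x₀ y)

/-! The tensors of `g` at a point `x` are computed in the preferred chart at `x`. Mathlib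
identifies `T_x M` with `ℝⁿ` by means of this very chart. -/

/-- `R(a,b)c` at `x`. -/
def Rm (g : Metric n M) (x : M) (a b c : TangentSpace (𝓡 n) x) : TangentSpace (𝓡 n) x :=
  curvature (chartMetric g x) (extChartAt (𝓡 n) x x) a b c

/-- `Ric(a,b)` at `x`. -/
def Ric (g : Metric n M) (x : M) (a b : TangentSpace (𝓡 n) x) : ℝ :=
  ricci (chartMetric g x) (extChartAt (𝓡 n) x x) a b

/-- The differential of the scalar curvature, `dR(a) = ⟨∇R, a⟩`, at `x`. -/
def dScal (g : Metric n M) (x : M) (a : TangentSpace (𝓡 n) x) : ℝ :=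
  fderiv ℝ (scalarCurvature (chartMetric g x)) (extChartAt (𝓡 n) x x) a

/-- `(Hess R)(a,b)` at `x`. -/
def HessScal (g : Metric n M) (x : M) (a b : TangentSpace (𝓡 n) x) : ℝ :=
  hessScalar (chartMetric g x) (extChartAt (𝓡 n) x x) a b

/-- `(∇_w Ric)(a,b)` at `x`. -/
def nablaRic (g : Metric n M) (x : M) (w a b : TangentSpace (𝓡 n) x) : ℝ :=
  covRicci (chartMetric g x) (extChartAt (𝓡 n) x x) w a b

/-- Metric completeness: Cauchy sequences for the Riemannian distance of `g` converge. -/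
def IsCompleteMetric (g : Metric n M) : Prop :=
  letI : RiemannianBundle (fun x : M => TangentSpace (𝓡 n) x) := ⟨g.toRiemannianMetric⟩
  ∀ u : ℕ → M,
    (∀ ε : ℝ≥0∞, 0 < ε → ∃ N, ∀ i ≥ N, ∀ j ≥ N, riemannianEDist (𝓡 n) (u i) (u j) < ε) →
    ∃ x, Tendsto u atTop (𝓝 x)

/-- `g(τ)`, `τ ∈ [τ₁, τ₂]`, is a smooth family of Riemannian metrics with `∂g/∂τ = 2 Ric`, complete
for each `τ` and with uniformly bounded curvature. -/
structure IsBackwardRicciFlow (g : ℝ → Metric n M) (τ₁ τ₂ : ℝ) : Prop where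
  smooth : ∀ x₀ : M, ContDiffOn ℝ ∞ (fun q : ℝ × Mod n => chartMetric (g q.1) x₀ q.2)
    (Icc τ₁ τ₂ ×ˢ (extChartAt (𝓡 n) x₀).target)
  evolution : ∀ τ ∈ Icc τ₁ τ₂, ∀ (x : M) (a b : TangentSpace (𝓡 n) x),
    HasDerivWithinAt (fun t => (g t).inner x a b) (2 * Ric (g τ) x a b) (Icc τ₁ τ₂) τ
  complete : ∀ τ ∈ Icc τ₁ τ₂, IsCompleteMetric (g τ)
  bounded : ∃ K : ℝ, ∀ τ ∈ Icc τ₁ τ₂, ∀ (x : M) (a b c d : TangentSpace (𝓡 n) x),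
    ((g τ).inner x (Rm (g τ) x a b c) d) ^ 2 ≤
      K * ((g τ).inner x a a * (g τ).inner x b b * (g τ).inner x c c * (g τ).inner x d d)

/-! ### Curves and vector fields along them -/

/-- The velocity `X(τ)` of the curve `γ`. -/
def velocity (γ : ℝ → M) (τ : ℝ) : TangentSpace (𝓡 n) (γ τ) :=
  mfderiv 𝓘(ℝ, ℝ) (𝓡 n) γ τ (1 : ℝ)

/-- The components of the vector `w ∈ T_q M` in the chart at `x₀`. -/
def chartVector (x₀ q : M) (w : TangentSpace (𝓡 n) q) : Mod n :=
  mfderiv (𝓡 n) (𝓡 n) (extChartAt (𝓡 n) x₀) q w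

/-- The covariant derivative `∇_X V` at `τ` of the field `V` along `γ`, for the Levi-Civita
connection of the metric `g`. -/
def covDeriv (g : Metric n M) (γ : ℝ → M) (V : ∀ τ, TangentSpace (𝓡 n) (γ τ)) (τ : ℝ) :
    TangentSpace (𝓡 n) (γ τ) :=
  (deriv (fun t => chartVector (γ τ) (γ t) (V t)) τ
    + christoffel (chartMetric g (γ τ)) (extChartAt (𝓡 n) (γ τ) (γ τ))
        (velocity (n := n) γ τ) (V τ) : Mod n)

/-- `V` is a piecewise smooth (in particular continuous) vector field along `γ` on `[τ₁, τ₂]`,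
with respect to the parameter `σ = √τ`. For `τ₁ > 0` this is piecewise smoothness in `τ`; for
`τ₁ = 0` it is the notion adapted to curves for which `√τ γ'(τ)` has a limit as `τ → 0`.
Between two consecutive break points (the elements of `P`) the field is smooth up to the ends. -/
def IsPiecewiseSmoothAlong (τ₁ τ₂ : ℝ) (γ : ℝ → M)
    (V : ∀ τ, TangentSpace (𝓡 n) (γ τ)) : Prop :=
  ContinuousOn (fun σ : ℝ => (⟨γ (σ ^ 2), V (σ ^ 2)⟩ : TangentBundle (𝓡 n) M))
    (Icc (√τ₁) (√τ₂)) ∧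
  ∃ P : Finset ℝ, ∀ a b : ℝ, √τ₁ ≤ a → a < b → b ≤ √τ₂ → (∀ c ∈ P, c ∉ Ioo a b) →
    ContMDiffOn 𝓘(ℝ, ℝ) (𝓡 n).tangent ∞
      (fun σ : ℝ => (⟨γ (σ ^ 2), V (σ ^ 2)⟩ : TangentBundle (𝓡 n) M)) (Icc a b)

/-! ### `𝓛`-geometry -/

/-- `γ` is an `𝓛`-geodesic on `[τ₁, τ₂]`: it is smooth in `σ = √τ` up to the ends and satisfies the
Euler-Lagrange equation `∇_X X - ½ ∇R + X / (2τ) + 2 Ric(X) = 0` of the `𝓛`-length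
`∫ √τ (R + |γ'|²) dτ`. -/
structure IsLGeodesic (g : ℝ → Metric n M) (τ₁ τ₂ : ℝ) (γ : ℝ → M) : Prop where
  smooth : ContMDiffOn 𝓘(ℝ, ℝ) (𝓡 n) ∞ (fun σ : ℝ => γ (σ ^ 2)) (Icc (√τ₁) (√τ₂))
  equation : ∀ τ ∈ Ioo τ₁ τ₂, ∀ z : TangentSpace (𝓡 n) (γ τ),
    (g τ).inner (γ τ) (covDeriv (g τ) γ (velocity γ) τ) z
      - 1 / 2 * dScal (g τ) (γ τ) z
      + 1 / (2 * τ) * (g τ).inner (γ τ) (velocity γ τ) z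
      + 2 * Ric (g τ) (γ τ) (velocity γ τ) z = 0

/-- `γ` is an `𝓛`-geodesic on `[τ₁, τ₂]` with `γ(τ₁) = p` and `√τ γ'(τ) → v` as `τ → τ₁`. -/
structure IsLGeodesicFrom (g : ℝ → Metric n M) (τ₁ τ₂ : ℝ) (p : M) (v : TangentSpace (𝓡 n) p)
    (γ : ℝ → M) : Prop where
  geodesic : IsLGeodesic g τ₁ τ₂ γ
  start : γ τ₁ = p
  initial : Tendsto (fun τ : ℝ => (⟨γ τ, √τ • velocity γ τ⟩ : TangentBundle (𝓡 n) M))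
    (𝓝[>] τ₁) (𝓝 ⟨p, v⟩)

open scoped Classical in
/-- The `𝓛_τ`-exponential map at `(p, τ₁)`: it maps `w` to `γ_w(τ)`, where `γ_w` is the
`𝓛`-geodesic on `[τ₁, τ]` that starts at `p` with `√t γ_w'(t) → w` as `t → τ₁` (and to `p`, as a
default value, if this `𝓛`-geodesic does not exist up to the time `τ`). -/
def LExp (g : ℝ → Metric n M) (τ₁ τ : ℝ) (p : M) (w : Mod n) : M :=
  if h : ∃ c : ℝ → M, IsLGeodesicFrom g τ₁ τ p w c then h.choose τ else p

/-- `γ_v(τ)` is `𝓛`-conjugate to `p = γ_v(τ₁)` along `γ_v`: the vector `v` is a critical point of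
the `𝓛_τ`-exponential map. -/
def IsLConjugate (g : ℝ → Metric n M) (τ₁ τ : ℝ) (p : M) (v : TangentSpace (𝓡 n) p) : Prop :=
  ¬ Function.Surjective (mfderiv (𝓡 n) (𝓡 n) (LExp g τ₁ τ p) v)

/-- `U` is an `𝓛`-Jacobi field along `γ` on `[τ₁, τ₂]`: the variation field of a smooth
one-parameter family `Γ s` of `𝓛`-geodesics with `Γ 0 = γ`. -/
def IsLJacobiField (g : ℝ → Metric n M) (τ₁ τ₂ : ℝ) (γ : ℝ → M)
    (U : ∀ τ, TangentSpace (𝓡 n) (γ τ)) : Prop :=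
  ∃ ε : ℝ, 0 < ε ∧ ∃ Γ : ℝ → ℝ → M,
    ContMDiffOn 𝓘(ℝ, ℝ × ℝ) (𝓡 n) ∞ (fun q : ℝ × ℝ => Γ q.1 (q.2 ^ 2))
      (Ioo (-ε) ε ×ˢ Icc (√τ₁) (√τ₂)) ∧
    (∀ s ∈ Ioo (-ε) ε, IsLGeodesic g τ₁ τ₂ (Γ s)) ∧
    (∀ τ ∈ Icc τ₁ τ₂, Γ 0 τ = γ τ) ∧
    ∀ τ ∈ Icc τ₁ τ₂,
      (⟨Γ 0 τ, mfderiv 𝓘(ℝ, ℝ) (𝓡 n) (fun s => Γ s τ) (0 : ℝ) (1 : ℝ)⟩ : TangentBundle (𝓡 n) M)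
        = ⟨γ τ, U τ⟩

/-- The integrand of the `𝓛`-index form. -/
def indexIntegrand (g : ℝ → Metric n M) (γ : ℝ → M) (U V : ∀ τ, TangentSpace (𝓡 n) (γ τ))
    (τ : ℝ) : ℝ :=
  √τ * (HessScal (g τ) (γ τ) (U τ) (V τ)
    + 2 * (g τ).inner (γ τ) (covDeriv (g τ) γ U τ) (covDeriv (g τ) γ V τ)
    + 2 * (g τ).inner (γ τ) (Rm (g τ) (γ τ) (U τ) (velocity γ τ) (V τ)) (velocity γ τ)
    - 2 * nablaRic (g τ) (γ τ) (U τ) (V τ) (velocity γ τ)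
    - 2 * nablaRic (g τ) (γ τ) (V τ) (U τ) (velocity γ τ)
    + 2 * nablaRic (g τ) (γ τ) (velocity γ τ) (U τ) (V τ))

/-- The `𝓛`-index form `I(U, V)` along `γ` on `[τ₁, τ₂]`. -/
def indexForm (g : ℝ → Metric n M) (τ₁ τ₂ : ℝ) (γ : ℝ → M)
    (U V : ∀ τ, TangentSpace (𝓡 n) (γ τ)) : ℝ :=
  ∫ τ in τ₁..τ₂, indexIntegrand g γ U V τ

end Manifolds

end LGeometry

end

noncomputable section

set_option maxSynthPendingDepth 3
set_option linter.unusedSectionVars false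

namespace LGeometry

/-! Put σ = √τ and let u be the velocity of the curve with respect to σ, so that X = u / (2σ). The
term X / (2τ) cancels against the derivative of 1 / (2σ), and the 𝓛-geodesic equation becomes D_σ u
= 2σ² ∇R - 4σ Ric(u), which is regular up to σ = √τ₁ even for τ₁ = 0. Let q(V, W) be the index
integrand times dτ/dσ = 2σ, so that I(V, W) = ∫ q(V, W) dσ. The second variation formula says that
d/dσ ⟨D_σ J, W⟩ = q(J, W) whenever J solves the linearized geodesic equation
(`IsJacobi.hasDerivAt_momentum`); the evolution of the metric and of its Levi-Civita connection
under ∂g/∂τ = 2 Ric supplies the Ricci terms of q.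

Let W = Y - U, which vanishes at both ends. Integrating q(U, W) leaves only boundary terms ⟨D_σ U,
W⟩ = 0, hence I(Y, Y) = I(U, U) + I(W, W), and it remains to see that I is positive definite on such
W.

This is Jacobi's classical argument. Without conjugate points, varying the initial vector v in the n
coordinate directions gives Jacobi fields Jᵢ which vanish at τ₁ and form a basis at every later time
(`exists_jacobi_basis`). Write W = ∑ fᵢ Jᵢ. The quantities ⟨D_σ Jᵢ, Jⱼ⟩ are symmetric in i and j,
because the difference is constant and vanishes at the start (`IsJacobi.momentum_symm`). With this
symmetry, q(W, W) = d/dσ ∑ fᵢ ⟨D_σ Jᵢ, W⟩ + |∑ fᵢ' Jᵢ|². At the start the frame degenerates, but W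
and all Jᵢ vanish there to first order and the derivatives of the Jᵢ are independent, so the fᵢ stay
bounded (`IsJacobiFrame.exists_tendsto_frameCoeff`) and the boundary terms vanish. Thus I(W, W) = ∫
|∑ fᵢ' Jᵢ|² dσ ≥ 0. If it is zero, then all fᵢ' vanish off finitely many points, f is constant, and
f = 0 at the right end gives W = 0.

Two foundations are needed. The tensors are defined at each point in the preferred chart of that
point, so their naturality under coordinate changes is proved in order to compute along a curve in
one fixed chart. And variation fields of 𝓛-geodesics must solve the linearized equation, also for
families not known to be smooth, such as those behind the exponential map; this is differentiable
dependence of ODE solutions on the parameter (`hasDerivAt_ode_family`), carried from chart to chart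
along the curve. -/

/-- Continuous bilinear forms on `E`. -/
abbrev Bil (E : Type*) [NormedAddCommGroup E] [NormedSpace ℝ E] : Type _ := E →L[ℝ] E →L[ℝ] ℝ

/-! ### Smooth dependence of derivatives on parameters -/

section ParametricDerivative

theorem one_add_one_le_infty : (1 + 1 : WithTop ℕ∞) ≤ ((⊤ : ℕ∞) : WithTop ℕ∞) :=
  WithTop.coe_le_coe.2 (le_top : (1 + 1 : ℕ∞) ≤ ⊤)

theorem minSmoothness_two_le_infty : minSmoothness ℝ 2 ≤ ((⊤ : ℕ∞) : WithTop ℕ∞) := by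
  rw [minSmoothness_of_isRCLikeNormedField]
  exact WithTop.coe_le_coe.2 (le_top : (2 : ℕ∞) ≤ ⊤)

variable {P E F : Type*} [NormedAddCommGroup P] [NormedSpace ℝ P] [NormedAddCommGroup E]
  [NormedSpace ℝ E] [NormedAddCommGroup F] [NormedSpace ℝ F]

/-- Only `T` has to be open, which identifies the derivative within `T` with the ordinary one. The
parameter set is arbitrary, so that closed time intervals are admitted. -/
theorem contDiffOn_fderiv_param {H : P → E → F} {s : Set P} {T : Set E} (hT : IsOpen T)
    (hH : ContDiffOn ℝ ∞ (Function.uncurry H) (s ×ˢ T)) {y : P → E} (hy : ContDiffOn ℝ ∞ y s)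
    (hyT : MapsTo y s T) : ContDiffOn ℝ ∞ (fun q => fderiv ℝ (H q) (y q)) s := by
  intro q hq
  have h := ContDiffWithinAt.fderivWithin (m := ∞) (hH (q, y q) ⟨hq, hyT hq⟩) (hy q hq)
    hT.uniqueDiffOn (by simp) hq hyT
  refine h.congr (fun z hz => ?_) ?_
  · rw [fderivWithin_of_isOpen hT (hyT hz)]
  · rw [fderivWithin_of_isOpen hT (hyT hq)]

end ParametricDerivative

/-! ### Levi-Civita connection and symmetries of the curvature in coordinates -/

section Christoffel

variable {E : Type*} [NormedAddCommGroup E] [NormedSpace ℝ E]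

/-- The lowered Christoffel symbols `Γ(a, b, c) = G(Γ(a, b), c)`. -/
def christoffelLower (G : E → Bil E) (y : E) : E →L[ℝ] Bil E :=
  (1 / 2 : ℝ) • (fderiv ℝ G y + (fderiv ℝ G y).flip
    - ((ContinuousLinearMap.flipₗᵢ ℝ (E) (E) ℝ).toContinuousLinearEquiv :
        Bil E →L[ℝ] Bil E).comp (fderiv ℝ G y).flip)

/-- The Christoffel symbols as a bilinear map. -/
def christoffelL (G : E → Bil E) (y : E) : E →L[ℝ] E →L[ℝ] E :=
  (ContinuousLinearMap.compL ℝ (E) (E →L[ℝ] ℝ) (E) (G y).inverse).comp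
    (christoffelLower G y)

/-- The curvature tensor, in terms of `christoffelL`. -/
def curvatureL (G : E → Bil E) (y a b c : E) : E :=
  fderiv ℝ (christoffelL G) y a b c - fderiv ℝ (christoffelL G) y b a c
    + christoffelL G y a (christoffelL G y b c) - christoffelL G y b (christoffelL G y a c)

theorem christoffelLower_apply (G : E → Bil E) (y a b c : E) :
    christoffelLower G y a b c
      = 1 / 2 * (fderiv ℝ G y a b c + fderiv ℝ G y b a c - fderiv ℝ G y c a b) := rfl

/-- `G t`, `t ∈ S`, is a smooth family of Riemannian metrics on `T`. -/
structure IsMetricFamilyOn (G : ℝ → E → Bil E) (S : Set ℝ) (T : Set (E)) : Prop where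
  isOpen : IsOpen T
  smooth : ContDiffOn ℝ ∞ (fun q : ℝ × E => G q.1 q.2) (S ×ˢ T)
  symm : ∀ t ∈ S, ∀ y ∈ T, ∀ a b, G t y a b = G t y b a
  pos : ∀ t ∈ S, ∀ y ∈ T, ∀ a, a ≠ 0 → 0 < G t y a a

theorem isInvertible_of_pos [FiniteDimensional ℝ E] {B : Bil E} (h : ∀ a, a ≠ 0 → 0 < B a a) :
    B.IsInvertible := by
  have hinj : Function.Injective (B : E →ₗ[ℝ] E →L[ℝ] ℝ) := by
    rw [← LinearMap.ker_eq_bot, LinearMap.ker_eq_bot']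
    intro a ha
    by_contra h0
    have h1 := h a h0
    have h2 : B a = 0 := ha
    simp [h2] at h1
  have hdim : Module.finrank ℝ (E) = Module.finrank ℝ (E →L[ℝ] ℝ) := by
    rw [← LinearMap.toContinuousLinearMap.finrank_eq]
    exact (Subspace.dual_finrank_eq).symm
  refine ⟨(LinearEquiv.ofInjectiveOfFinrankEq (B : E →ₗ[ℝ] E →L[ℝ] ℝ) hinj
    hdim).toContinuousLinearEquiv, ?_⟩
  ext a b
  rfl

variable {G : ℝ → E → Bil E} {S : Set ℝ} {T : Set (E)}

namespace IsMetricFamilyOn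

variable [FiniteDimensional ℝ E] (hG : IsMetricFamilyOn G S T)
include hG

theorem isInvertible {t : ℝ} (ht : t ∈ S) {y : E} (hy : y ∈ T) : (G t y).IsInvertible :=
  isInvertible_of_pos (hG.pos t ht y hy)

theorem ext_inner {t : ℝ} (ht : t ∈ S) {y : E} (hy : y ∈ T) {a b : E}
    (h : ∀ c, G t y a c = G t y b c) : a = b := by
  by_contra hab
  have := hG.pos t ht y hy (a - b) (sub_ne_zero.2 hab)
  rw [map_sub] at this
  simp [h] at this

theorem restrict {S' : Set ℝ} {T' : Set (E)} (hS : S' ⊆ S) (hT' : IsOpen T') (hT : T' ⊆ T) :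
    IsMetricFamilyOn G S' T' :=
  ⟨hT', hG.smooth.mono (prod_mono hS hT), fun t ht y hy => hG.symm t (hS ht) y (hT hy),
    fun t ht y hy => hG.pos t (hS ht) y (hT hy)⟩

section Smoothness

variable {P : Type*} [NormedAddCommGroup P] [NormedSpace ℝ P] {s : Set P} {t : P → ℝ}
  {y : P → E}

theorem contDiffOn_metric (ht : ContDiffOn ℝ ∞ t s) (hy : ContDiffOn ℝ ∞ y s) (htS : MapsTo t s S)
    (hyT : MapsTo y s T) : ContDiffOn ℝ ∞ (fun q => G (t q) (y q)) s :=
  hG.smooth.comp (ht.prodMk hy) fun _ hq => ⟨htS hq, hyT hq⟩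

theorem contDiffOn_fderiv (ht : ContDiffOn ℝ ∞ t s) (hy : ContDiffOn ℝ ∞ y s) (htS : MapsTo t s S)
    (hyT : MapsTo y s T) : ContDiffOn ℝ ∞ (fun q => fderiv ℝ (G (t q)) (y q)) s := by
  refine contDiffOn_fderiv_param (H := fun q => G (t q)) hG.isOpen ?_ hy hyT
  exact hG.contDiffOn_metric (t := fun z : P × E => t z.1) (y := fun z => z.2)
    (ht.comp contDiffOn_fst fun _ h => h.1) contDiffOn_snd (fun _ h => htS h.1) fun _ h => h.2

theorem contDiffOn_inverse (ht : ContDiffOn ℝ ∞ t s) (hy : ContDiffOn ℝ ∞ y s)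
    (htS : MapsTo t s S) (hyT : MapsTo y s T) :
    ContDiffOn ℝ ∞ (fun q => (G (t q) (y q)).inverse) s := by
  intro q hq
  exact (hG.isInvertible (htS hq) (hyT hq)).contDiffAt_map_inverse.comp_contDiffWithinAt q
    (hG.contDiffOn_metric ht hy htS hyT q hq)

set_option synthInstance.maxHeartbeats 200000 in
theorem contDiffOn_christoffelL (ht : ContDiffOn ℝ ∞ t s) (hy : ContDiffOn ℝ ∞ y s)
    (htS : MapsTo t s S) (hyT : MapsTo y s T) :
    ContDiffOn ℝ ∞ (fun q => christoffelL (G (t q)) (y q)) s := by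
  have h1 := hG.contDiffOn_fderiv ht hy htS hyT
  have h2 := hG.contDiffOn_inverse ht hy htS hyT
  have h3 : ContDiffOn ℝ ∞ (fun q => (fderiv ℝ (G (t q)) (y q)).flip) s :=
    (ContinuousLinearMap.flipₗᵢ ℝ (E) (E) (E →L[ℝ] ℝ)).contDiff.comp_contDiffOn h1
  have h4 : ContDiffOn ℝ ∞ (fun q => christoffelLower (G (t q)) (y q)) s :=
    ((h1.add h3).sub (contDiffOn_const.clm_comp h3)).const_smul _
  exact ((ContinuousLinearMap.contDiff _).comp_contDiffOn h2).clm_comp h4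

end Smoothness

section FixedTime

variable {t : ℝ} (ht : t ∈ S)
include ht

theorem contDiffAt_metric {y : E} (hy : y ∈ T) : ContDiffAt ℝ ∞ (G t) y :=
  (hG.contDiffOn_metric (s := T) (t := fun _ => t) (y := id) contDiffOn_const contDiffOn_id
    (fun _ _ => ht) fun _ h => h).contDiffAt (hG.isOpen.mem_nhds hy)

theorem contDiffAt_christoffelL {y : E} (hy : y ∈ T) :
    ContDiffAt ℝ ∞ (christoffelL (G t)) y :=
  (hG.contDiffOn_christoffelL (s := T) (t := fun _ => t) (y := id) contDiffOn_const contDiffOn_id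
    (fun _ _ => ht) fun _ h => h).contDiffAt (hG.isOpen.mem_nhds hy)

theorem fderiv_christoffelL_apply {y : E} (hy : y ∈ T) (a b c : E) :
    fderiv ℝ (fun z => christoffelL (G t) z b c) y a = fderiv ℝ (christoffelL (G t)) y a b c := by
  have h : HasFDerivAt (christoffelL (G t)) _ y :=
    ((hG.contDiffAt_christoffelL ht hy).differentiableAt (by simp)).hasFDerivAt
  have := ((h.clm_apply (hasFDerivAt_const b y)).clm_apply (hasFDerivAt_const c y)).fderiv
  rw [this]
  simp

theorem fderiv_metric_apply {y : E} (hy : y ∈ T) (a b c : E) :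
    fderiv ℝ (fun z => G t z b c) y a = fderiv ℝ (G t) y a b c := by
  have h : HasFDerivAt (G t) _ y :=
    ((hG.contDiffAt_metric ht hy).differentiableAt (by simp)).hasFDerivAt
  have := ((h.clm_apply (hasFDerivAt_const b y)).clm_apply (hasFDerivAt_const c y)).fderiv
  rw [this]
  simp

theorem fderiv_metric_symm {y : E} (hy : y ∈ T) (a b c : E) :
    fderiv ℝ (G t) y a b c = fderiv ℝ (G t) y a c b := by
  rw [← hG.fderiv_metric_apply ht hy, ← hG.fderiv_metric_apply ht hy]
  have : (fun z => G t z b c) =ᶠ[𝓝 y] fun z => G t z c b := by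
    filter_upwards [hG.isOpen.mem_nhds hy] with z hz using hG.symm t ht z hz b c
  rw [this.fderiv_eq]

theorem metric_christoffelL {y : E} (hy : y ∈ T) (a b c : E) :
    G t y (christoffelL (G t) y a b) c
      = 1 / 2 * (fderiv ℝ (G t) y a b c + fderiv ℝ (G t) y b a c - fderiv ℝ (G t) y c a b) := by
  have h : G t y (christoffelL (G t) y a b) = christoffelLower (G t) y a b :=
    (hG.isInvertible ht hy).self_apply_inverse _
  rw [h, christoffelLower_apply]

theorem christoffelL_symm {y : E} (hy : y ∈ T) (a b : E) :
    christoffelL (G t) y a b = christoffelL (G t) y b a := by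
  refine hG.ext_inner ht hy fun c => ?_
  rw [hG.metric_christoffelL ht hy, hG.metric_christoffelL ht hy,
    hG.fderiv_metric_symm ht hy c a b]
  ring

theorem fderiv_metric {y : E} (hy : y ∈ T) (a b c : E) :
    fderiv ℝ (G t) y a b c
      = G t y (christoffelL (G t) y a b) c + G t y b (christoffelL (G t) y a c) := by
  rw [hG.symm t ht y hy b, hG.metric_christoffelL ht hy, hG.metric_christoffelL ht hy,
    hG.fderiv_metric_symm ht hy c a b, hG.fderiv_metric_symm ht hy b a c,
    hG.fderiv_metric_symm ht hy a c b]
  ring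

theorem fderiv_christoffelL_symm {y : E} (hy : y ∈ T) (a b c : E) :
    fderiv ℝ (christoffelL (G t)) y a b c = fderiv ℝ (christoffelL (G t)) y a c b := by
  rw [← hG.fderiv_christoffelL_apply ht hy, ← hG.fderiv_christoffelL_apply ht hy]
  have : (fun z => christoffelL (G t) z b c) =ᶠ[𝓝 y] fun z => christoffelL (G t) z c b := by
    filter_upwards [hG.isOpen.mem_nhds hy] with z hz using hG.christoffelL_symm ht hz b c
  rw [this.fderiv_eq]

theorem curvature_antisymm (y a b c : E) :
    curvatureL (G t) y a b c = - curvatureL (G t) y b a c := by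
  simp only [curvatureL]
  abel

theorem curvature_bianchi {y : E} (hy : y ∈ T) (a b c : E) :
    curvatureL (G t) y a b c + curvatureL (G t) y b c a + curvatureL (G t) y c a b = 0 := by
  simp only [curvatureL]
  rw [hG.fderiv_christoffelL_symm ht hy a c b, hG.fderiv_christoffelL_symm ht hy b a c,
    hG.fderiv_christoffelL_symm ht hy c b a, hG.christoffelL_symm ht hy c b,
    hG.christoffelL_symm ht hy c a, hG.christoffelL_symm ht hy b a]
  abel

/-- Metric compatibility expresses ∂_b G(c, d) by Christoffel symbols. Differentiating once more in
the direction a and antisymmetrizing in a and b kills the left side, since second derivatives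
commute, as well as the products of two Christoffel symbols that are paired by G; what remains is
the sum of the two curvature terms. -/
theorem metric_curvature_antisymm {y : E} (hy : y ∈ T) (a b c d : E) :
    G t y (curvatureL (G t) y a b c) d = - G t y (curvatureL (G t) y a b d) c := by
  have hsnd : ∀ a b, fderiv ℝ (fun z => fderiv ℝ (G t) z b c d) y a
      = G t y (fderiv ℝ (christoffelL (G t)) y a b c) d
        + G t y (christoffelL (G t) y a (christoffelL (G t) y b c)) d
        + G t y (christoffelL (G t) y b c) (christoffelL (G t) y a d)
        + G t y (fderiv ℝ (christoffelL (G t)) y a b d) c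
        + G t y (christoffelL (G t) y a (christoffelL (G t) y b d)) c
        + G t y (christoffelL (G t) y b d) (christoffelL (G t) y a c) := by
    intro a b
    have heq : (fun z => fderiv ℝ (G t) z b c d) =ᶠ[𝓝 y] fun z =>
        G t z (christoffelL (G t) z b c) d + G t z (christoffelL (G t) z b d) c := by
      filter_upwards [hG.isOpen.mem_nhds hy] with z hz
      rw [hG.fderiv_metric ht hz, hG.symm t ht z hz c]
    have h1 : HasFDerivAt (G t) _ y :=
      ((hG.contDiffAt_metric ht hy).differentiableAt (by simp)).hasFDerivAt
    have h2 : HasFDerivAt (christoffelL (G t)) _ y :=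
      ((hG.contDiffAt_christoffelL ht hy).differentiableAt (by simp)).hasFDerivAt
    have h3 := ((h1.clm_apply ((h2.clm_apply (hasFDerivAt_const b y)).clm_apply
      (hasFDerivAt_const c y))).clm_apply (hasFDerivAt_const d y)).add
      ((h1.clm_apply ((h2.clm_apply (hasFDerivAt_const b y)).clm_apply
      (hasFDerivAt_const d y))).clm_apply (hasFDerivAt_const c y))
    rw [heq.fderiv_eq]
    have h4 := h3.fderiv
    erw [h4]
    simp [hG.fderiv_metric ht hy]
    ring
  have hsymm : fderiv ℝ (fun z => fderiv ℝ (G t) z b c d) y a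
      = fderiv ℝ (fun z => fderiv ℝ (G t) z a c d) y b := by
    have hs : ∀ a b, fderiv ℝ (fun z => fderiv ℝ (G t) z b c d) y a
        = fderiv ℝ (fderiv ℝ (G t)) y a b c d := by
      intro a b
      have h : HasFDerivAt (fderiv ℝ (G t)) _ y :=
        (((hG.contDiffAt_metric ht hy).fderiv_right (m := 1) one_add_one_le_infty).differentiableAt
          (by simp)).hasFDerivAt
      have := (((h.clm_apply (hasFDerivAt_const b y)).clm_apply
        (hasFDerivAt_const c y)).clm_apply (hasFDerivAt_const d y)).fderiv
      rw [this]
      simp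
    rw [hs, hs, ((hG.contDiffAt_metric ht hy).isSymmSndFDerivAt minSmoothness_two_le_infty).eq]
  rw [hsnd, hsnd] at hsymm
  simp only [curvatureL, map_sub, map_add, _root_.sub_apply,
    _root_.add_apply]
  have h5 := hG.symm t ht y hy (christoffelL (G t) y b c) (christoffelL (G t) y a d)
  have h6 := hG.symm t ht y hy (christoffelL (G t) y a c) (christoffelL (G t) y b d)
  linarith

/-- The usual octahedron argument: four instances of the Bianchi identity, combined by means of the
two antisymmetries. -/
theorem metric_curvature_pair_symm {y : E} (hy : y ∈ T) (a b c d : E) :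
    G t y (curvatureL (G t) y a b c) d = G t y (curvatureL (G t) y c d a) b := by
  have bi : ∀ a b c d, G t y (curvatureL (G t) y a b c) d + G t y (curvatureL (G t) y b c a) d
      + G t y (curvatureL (G t) y c a b) d = 0 := by
    intro a b c d
    have := congrArg (fun w => G t y w d) (hG.curvature_bianchi ht hy a b c)
    simpa using this
  have an : ∀ a b c d, G t y (curvatureL (G t) y a b c) d
      = - G t y (curvatureL (G t) y b a c) d := by
    intro a b c d
    rw [hG.curvature_antisymm ht y a b c]
    simp
  have hm := hG.metric_curvature_antisymm ht hy
  linarith [bi a b c d, bi b c d a, bi c d a b, bi d a b c, an a b c d, an b c a d, an c a b d,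
    an a b d c, an b c d a, an c d a b, an c d b a, an d a b c, an d a c b, an a c b d, an a c d b,
    an b d c a, an b d a c, hm a b c d, hm b c a d, hm c a b d, hm c d a b, hm d a b c, hm b d c a,
    hm a c d b, hm b a c d, hm a d b c, hm d b a c, an d b c a, an d b a c]

end FixedTime

end IsMetricFamilyOn

end Christoffel

/-! ### Behaviour of connection and curvature under local diffeomorphisms -/

section Naturality

variable {E : Type*} [NormedAddCommGroup E] [NormedSpace ℝ E] [FiniteDimensional ℝ E]

/-- On `T'` the family `G'` is the pullback of `G` by the local diffeomorphism `ψ`. -/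
structure IsPullbackOn (ψ : E → E) (G' G : ℝ → E → Bil E) (S : Set ℝ) (T' T : Set E) : Prop where
  smooth : ContDiffOn ℝ ∞ ψ T'
  mapsTo : MapsTo ψ T' T
  isInvertible : ∀ y ∈ T', (fderiv ℝ ψ y).IsInvertible
  pullback : ∀ t ∈ S, ∀ y ∈ T', ∀ a b,
    G' t y a b = G t (ψ y) (fderiv ℝ ψ y a) (fderiv ℝ ψ y b)

namespace IsPullbackOn

variable {ψ : E → E} {G' G : ℝ → E → Bil E} {S : Set ℝ} {T' T : Set E}
  (hψ : IsPullbackOn ψ G' G S T' T) (hG' : IsMetricFamilyOn G' S T') (hG : IsMetricFamilyOn G S T)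
  {t : ℝ} (ht : t ∈ S) {y : E} (hy : y ∈ T')
include hψ hG' hG ht hy

theorem contDiffAt : ContDiffAt ℝ ∞ ψ y :=
  hψ.smooth.contDiffAt (hG'.isOpen.mem_nhds hy)

theorem hasFDerivAt : HasFDerivAt ψ (fderiv ℝ ψ y) y :=
  ((hψ.contDiffAt hG' hG ht hy).differentiableAt (by simp)).hasFDerivAt

theorem contDiffAt_fderiv : ContDiffAt ℝ ∞ (fderiv ℝ ψ) y :=
  (hψ.contDiffAt hG' hG ht hy).fderiv_right (m := ∞) (by simp)

theorem hasFDerivAt_fderiv : HasFDerivAt (fderiv ℝ ψ) (fderiv ℝ (fderiv ℝ ψ) y) y :=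
  ((hψ.contDiffAt_fderiv hG' hG ht hy).differentiableAt (by simp)).hasFDerivAt

theorem snd_symm (a b : E) : fderiv ℝ (fderiv ℝ ψ) y a b = fderiv ℝ (fderiv ℝ ψ) y b a :=
  ((hψ.contDiffAt hG' hG ht hy).isSymmSndFDerivAt minSmoothness_two_le_infty).eq a b

theorem fderiv_metric (a b c : E) :
    fderiv ℝ (G' t) y a b c
      = fderiv ℝ (G t) (ψ y) (fderiv ℝ ψ y a) (fderiv ℝ ψ y b) (fderiv ℝ ψ y c)
        + G t (ψ y) (fderiv ℝ (fderiv ℝ ψ) y a b) (fderiv ℝ ψ y c)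
        + G t (ψ y) (fderiv ℝ ψ y b) (fderiv ℝ (fderiv ℝ ψ) y a c) := by
  rw [← hG'.fderiv_metric_apply ht hy]
  have heq : (fun z => G' t z b c) =ᶠ[𝓝 y] fun z =>
      G t (ψ z) (fderiv ℝ ψ z b) (fderiv ℝ ψ z c) := by
    filter_upwards [hG'.isOpen.mem_nhds hy] with z hz using hψ.pullback t ht z hz b c
  have h1 : HasFDerivAt (G t) _ (ψ y) :=
    ((hG.contDiffAt_metric ht (hψ.mapsTo hy)).differentiableAt (by simp)).hasFDerivAt
  have h2 := hψ.hasFDerivAt_fderiv hG' hG ht hy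
  have h3 := (((h1.comp y (hψ.hasFDerivAt hG' hG ht hy)).clm_apply
    (h2.clm_apply (hasFDerivAt_const b y))).clm_apply (h2.clm_apply (hasFDerivAt_const c y))).fderiv
  rw [heq.fderiv_eq]
  erw [h3]
  simp
  ring

/-- The inhomogeneous transformation law. Inserting the derivative of the pullback metric into the
Koszul formula, the second derivatives of ψ cancel by symmetry except for one pair, which adds up to
D²ψ(a, b). -/
theorem christoffelL (a b : E) :
    fderiv ℝ ψ y (christoffelL (G' t) y a b) = fderiv ℝ (fderiv ℝ ψ) y a b
      + LGeometry.christoffelL (G t) (ψ y) (fderiv ℝ ψ y a) (fderiv ℝ ψ y b) := by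
  have hψy := hψ.mapsTo hy
  refine hG.ext_inner ht hψy fun c' => ?_
  obtain ⟨c, rfl⟩ : ∃ c, fderiv ℝ ψ y c = c' :=
    ⟨_, (hψ.isInvertible y hy).self_apply_inverse c'⟩
  rw [← hψ.pullback t ht y hy, hG'.metric_christoffelL ht hy, map_add, _root_.add_apply,
    hG.metric_christoffelL ht hψy, hψ.fderiv_metric hG' hG ht hy, hψ.fderiv_metric hG' hG ht hy,
    hψ.fderiv_metric hG' hG ht hy, hψ.snd_symm hG' hG ht hy b a, hψ.snd_symm hG' hG ht hy c a,
    hψ.snd_symm hG' hG ht hy c b, hG.symm t ht _ hψy (fderiv ℝ (fderiv ℝ ψ) y a c)]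
  ring

set_option maxHeartbeats 1000000 in
-- The transformation law of the Christoffel symbols, differentiated in the direction a.
theorem fderiv_christoffelL (a b c : E) :
    fderiv ℝ (fderiv ℝ ψ) y a (LGeometry.christoffelL (G' t) y b c)
        + fderiv ℝ ψ y (fderiv ℝ (LGeometry.christoffelL (G' t)) y a b c)
      = fderiv ℝ (fderiv ℝ (fderiv ℝ ψ)) y a b c
        + fderiv ℝ (LGeometry.christoffelL (G t)) (ψ y) (fderiv ℝ ψ y a) (fderiv ℝ ψ y b)
            (fderiv ℝ ψ y c)
        + LGeometry.christoffelL (G t) (ψ y) (fderiv ℝ (fderiv ℝ ψ) y a b) (fderiv ℝ ψ y c)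
        + LGeometry.christoffelL (G t) (ψ y) (fderiv ℝ ψ y b) (fderiv ℝ (fderiv ℝ ψ) y a c) := by
  have heq : (fun z => fderiv ℝ ψ z (LGeometry.christoffelL (G' t) z b c)) =ᶠ[𝓝 y] fun z =>
      fderiv ℝ (fderiv ℝ ψ) z b c
        + LGeometry.christoffelL (G t) (ψ z) (fderiv ℝ ψ z b) (fderiv ℝ ψ z c) := by
    filter_upwards [hG'.isOpen.mem_nhds hy] with z hz using hψ.christoffelL hG' hG ht hz b c
  have hb := hasFDerivAt_const (𝕜 := ℝ) b y
  have hc := hasFDerivAt_const (𝕜 := ℝ) c y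
  have h1 : HasFDerivAt (LGeometry.christoffelL (G t)) _ (ψ y) :=
    ((hG.contDiffAt_christoffelL ht (hψ.mapsTo hy)).differentiableAt (by simp)).hasFDerivAt
  have h1' : HasFDerivAt (LGeometry.christoffelL (G' t)) _ y :=
    ((hG'.contDiffAt_christoffelL ht hy).differentiableAt (by simp)).hasFDerivAt
  have h2 := hψ.hasFDerivAt_fderiv hG' hG ht hy
  have h3 : HasFDerivAt (fderiv ℝ (fderiv ℝ ψ)) _ y :=
    (((hψ.contDiffAt_fderiv hG' hG ht hy).fderiv_right (m := 1) one_add_one_le_infty).differentiableAt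
      (by simp)).hasFDerivAt
  have hL := h2.clm_apply ((h1'.clm_apply hb).clm_apply hc)
  have hR := ((h3.clm_apply hb).clm_apply hc).add
    (((h1.comp y (hψ.hasFDerivAt hG' hG ht hy)).clm_apply (h2.clm_apply hb)).clm_apply
      (h2.clm_apply hc))
  have := congrArg (fun L : E →L[ℝ] E => L a) (hL.unique (hR.congr_of_eventuallyEq heq))
  simp at this
  rw [add_comm, this]
  abel

/-- On antisymmetrizing in a and b, D³ψ(a, b, c) drops out by symmetry, and the terms with D²ψ
cancel against those produced by the transformation law of the quadratic Christoffel terms. -/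
theorem curvatureL (a b c : E) :
    fderiv ℝ ψ y (curvatureL (G' t) y a b c)
      = LGeometry.curvatureL (G t) (ψ y) (fderiv ℝ ψ y a) (fderiv ℝ ψ y b) (fderiv ℝ ψ y c) := by
  have h1 := hψ.fderiv_christoffelL hG' hG ht hy a b c
  have h2 := hψ.fderiv_christoffelL hG' hG ht hy b a c
  have h3 := hψ.christoffelL hG' hG ht hy a (LGeometry.christoffelL (G' t) y b c)
  have h4 := hψ.christoffelL hG' hG ht hy b (LGeometry.christoffelL (G' t) y a c)
  have h5 : fderiv ℝ (fderiv ℝ (fderiv ℝ ψ)) y a b = fderiv ℝ (fderiv ℝ (fderiv ℝ ψ)) y b a :=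
    ((hψ.contDiffAt_fderiv hG' hG ht hy).isSymmSndFDerivAt minSmoothness_two_le_infty).eq a b
  rw [hψ.christoffelL hG' hG ht hy b c, map_add] at h3
  rw [hψ.christoffelL hG' hG ht hy a c, map_add] at h4
  rw [h5, hψ.snd_symm hG' hG ht hy a b] at h1
  rw [← eq_sub_iff_add_eq'] at h1 h2
  simp only [LGeometry.curvatureL, map_add, map_sub]
  rw [h1, h2, h3, h4]
  abel

end IsPullbackOn

end Naturality

/-! ### Ricci and scalar curvature as traces -/

section Ricci

variable {n : ℕ} {G : ℝ → Mod n → Bil (Mod n)} {S : Set ℝ} {T : Set (Mod n)}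

theorem christoffelL_apply (G : Mod n → Bil (Mod n)) (y a b : Mod n) :
    christoffelL G y a b = christoffel G y a b := rfl

namespace IsMetricFamilyOn

variable (hG : IsMetricFamilyOn G S T)
include hG

section Smoothness

variable {P : Type*} [NormedAddCommGroup P] [NormedSpace ℝ P] {s : Set P} {t : P → ℝ}
  {y : P → Mod n}

theorem contDiffOn_christoffel {a b : P → Mod n} (ht : ContDiffOn ℝ ∞ t s)
    (hy : ContDiffOn ℝ ∞ y s) (htS : MapsTo t s S) (hyT : MapsTo y s T)
    (ha : ContDiffOn ℝ ∞ a s) (hb : ContDiffOn ℝ ∞ b s) :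
    ContDiffOn ℝ ∞ (fun q => christoffel (G (t q)) (y q) (a q) (b q)) s :=
  ((hG.contDiffOn_christoffelL ht hy htS hyT).clm_apply ha).clm_apply hb

theorem contDiffOn_curvature {a b c : P → Mod n} (ht : ContDiffOn ℝ ∞ t s)
    (hy : ContDiffOn ℝ ∞ y s) (htS : MapsTo t s S) (hyT : MapsTo y s T)
    (ha : ContDiffOn ℝ ∞ a s) (hb : ContDiffOn ℝ ∞ b s) (hc : ContDiffOn ℝ ∞ c s) :
    ContDiffOn ℝ ∞ (fun q => curvature (G (t q)) (y q) (a q) (b q) (c q)) s := by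
  have key : ∀ {a b : P → Mod n}, ContDiffOn ℝ ∞ a s → ContDiffOn ℝ ∞ b s →
      ContDiffOn ℝ ∞ (fun q => fderiv ℝ (fun z => christoffel (G (t q)) z (a q) (b q)) (y q)) s := by
    intro a b ha hb
    refine contDiffOn_fderiv_param (H := fun q z => christoffel (G (t q)) z (a q) (b q))
      hG.isOpen ?_ hy hyT
    exact hG.contDiffOn_christoffel (t := fun z : P × Mod n => t z.1) (y := fun z => z.2)
      (ht.comp contDiffOn_fst fun _ h => h.1) contDiffOn_snd (fun _ h => htS h.1) (fun _ h => h.2)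
      (ha.comp contDiffOn_fst fun _ h => h.1) (hb.comp contDiffOn_fst fun _ h => h.1)
  exact ((((key hb hc).clm_apply ha).sub ((key ha hc).clm_apply hb)).add
    (hG.contDiffOn_christoffel ht hy htS hyT ha
      (hG.contDiffOn_christoffel ht hy htS hyT hb hc))).sub
    (hG.contDiffOn_christoffel ht hy htS hyT hb
      (hG.contDiffOn_christoffel ht hy htS hyT ha hc))

theorem contDiffOn_ricci {b c : P → Mod n} (ht : ContDiffOn ℝ ∞ t s)
    (hy : ContDiffOn ℝ ∞ y s) (htS : MapsTo t s S) (hyT : MapsTo y s T)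
    (hb : ContDiffOn ℝ ∞ b s) (hc : ContDiffOn ℝ ∞ c s) :
    ContDiffOn ℝ ∞ (fun q => ricci (G (t q)) (y q) (b q) (c q)) s := by
  refine ContDiffOn.sum fun i _ => ?_
  exact (EuclideanSpace.proj i : Mod n →L[ℝ] ℝ).contDiff.comp_contDiffOn
    (hG.contDiffOn_curvature ht hy htS hyT contDiffOn_const hb hc)

theorem contDiffOn_scalarCurvature (ht : ContDiffOn ℝ ∞ t s)
    (hy : ContDiffOn ℝ ∞ y s) (htS : MapsTo t s S) (hyT : MapsTo y s T) :
    ContDiffOn ℝ ∞ (fun q => scalarCurvature (G (t q)) (y q)) s := by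
  refine ContDiffOn.sum fun i _ => ContDiffOn.sum fun j _ => ContDiffOn.mul ?_ ?_
  · exact (EuclideanSpace.proj j : Mod n →L[ℝ] ℝ).contDiff.comp_contDiffOn
      ((hG.contDiffOn_inverse ht hy htS hyT).clm_apply contDiffOn_const)
  · exact hG.contDiffOn_ricci ht hy htS hyT contDiffOn_const contDiffOn_const

theorem contDiffOn_fderiv_scalarCurvature (ht : ContDiffOn ℝ ∞ t s)
    (hy : ContDiffOn ℝ ∞ y s) (htS : MapsTo t s S) (hyT : MapsTo y s T) :
    ContDiffOn ℝ ∞ (fun q => fderiv ℝ (scalarCurvature (G (t q))) (y q)) s := by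
  refine contDiffOn_fderiv_param (H := fun q => scalarCurvature (G (t q))) hG.isOpen ?_ hy hyT
  exact hG.contDiffOn_scalarCurvature (t := fun z : P × Mod n => t z.1) (y := fun z => z.2)
    (ht.comp contDiffOn_fst fun _ h => h.1) contDiffOn_snd (fun _ h => htS h.1) fun _ h => h.2

end Smoothness

section FixedTime

variable {t : ℝ} (ht : t ∈ S)
include ht

theorem contDiffAt_scalarCurvature {y : Mod n} (hy : y ∈ T) :
    ContDiffAt ℝ ∞ (scalarCurvature (G t)) y :=
  (hG.contDiffOn_scalarCurvature (s := T) (t := fun _ => t) (y := id) contDiffOn_const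
    contDiffOn_id (fun _ _ => ht) fun _ h => h).contDiffAt (hG.isOpen.mem_nhds hy)

theorem curvature_eq {y : Mod n} (hy : y ∈ T) (a b c : Mod n) :
    curvature (G t) y a b c = curvatureL (G t) y a b c := by
  rw [curvature]
  simp only [← christoffelL_apply]
  rw [hG.fderiv_christoffelL_apply ht hy, hG.fderiv_christoffelL_apply ht hy]
  rfl

end FixedTime

end IsMetricFamilyOn

/-- The endomorphism `a ↦ R(a, b)c`. -/
def curvatureEnd (G : Mod n → Bil (Mod n)) (y b c : Mod n) : Mod n →ₗ[ℝ] Mod n :=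
  IsLinearMap.mk' (fun a => curvatureL G y a b c)
    ⟨fun a a' => by simp [curvatureL]; abel, fun r a => by simp [curvatureL, smul_sub, smul_add]⟩

theorem trace_eq_sum_apply (f : Mod n →ₗ[ℝ] Mod n) :
    LinearMap.trace ℝ (Mod n) f = ∑ i, f (EuclideanSpace.single i 1) i := by
  rw [LinearMap.trace_eq_sum_inner f (EuclideanSpace.basisFun (Fin n) ℝ)]
  simp [EuclideanSpace.inner_single_left]

/-- The Ricci tensor as a bilinear form. -/
def ricciForm (G : Mod n → Bil (Mod n)) (y : Mod n) : Mod n →ₗ[ℝ] Mod n →ₗ[ℝ] ℝ :=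
  LinearMap.mk₂ ℝ (fun b c => LinearMap.trace ℝ (Mod n) (curvatureEnd G y b c))
    (fun b b' c => by
      rw [← map_add]; congr 1; ext1 a; simp [curvatureEnd, curvatureL]; abel)
    (fun r b c => by
      rw [← map_smul]; congr 1; ext1 a; simp [curvatureEnd, curvatureL, smul_sub, smul_add])
    (fun b c c' => by
      rw [← map_add]; congr 1; ext1 a; simp [curvatureEnd, curvatureL]; abel)
    (fun r b c => by
      rw [← map_smul]; congr 1; ext1 a; simp [curvatureEnd, curvatureL, smul_sub, smul_add])

theorem ricciForm_apply (G : Mod n → Bil (Mod n)) (y b c : Mod n) :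
    ricciForm G y b c = LinearMap.trace ℝ (Mod n) (curvatureEnd G y b c) := rfl

/-- The Ricci endomorphism. -/
def ricciEnd (G : Mod n → Bil (Mod n)) (y : Mod n) : Mod n →ₗ[ℝ] Mod n :=
  (G y).inverse.toLinearMap ∘ₗ LinearMap.toContinuousLinearMap.toLinearMap ∘ₗ ricciForm G y

namespace IsMetricFamilyOn

variable (hG : IsMetricFamilyOn G S T) {t : ℝ} (ht : t ∈ S)
include hG ht

theorem ricci_eq {y : Mod n} (hy : y ∈ T) (b c : Mod n) :
    ricci (G t) y b c = ricciForm (G t) y b c := by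
  rw [ricciForm_apply, trace_eq_sum_apply, ricci]
  refine Finset.sum_congr rfl fun i _ => ?_
  rw [hG.curvature_eq ht hy]
  rfl

theorem metric_ricciEnd {y : Mod n} (hy : y ∈ T) (b c : Mod n) :
    G t y (ricciEnd (G t) y b) c = ricciForm (G t) y b c := by
  have h : G t y (ricciEnd (G t) y b) = LinearMap.toContinuousLinearMap (ricciForm (G t) y b) :=
    (hG.isInvertible ht hy).self_apply_inverse _
  rw [h]
  rfl

theorem inverse_symm {y : Mod n} (hy : y ∈ T) (l m : Mod n →L[ℝ] ℝ) :
    l ((G t y).inverse m) = m ((G t y).inverse l) := by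
  have h := (hG.isInvertible ht hy).self_apply_inverse
  conv_lhs => rw [← h l]
  rw [hG.symm t ht y hy, h m]

/-- As the trace of an endomorphism the scalar curvature no longer refers to a basis, which is what
its invariance under coordinate changes rests on. -/
theorem scalarCurvature_eq {y : Mod n} (hy : y ∈ T) :
    scalarCurvature (G t) y = LinearMap.trace ℝ (Mod n) (ricciEnd (G t) y) := by
  rw [trace_eq_sum_apply, scalarCurvature]
  refine Finset.sum_congr rfl fun i _ => ?_
  have h1 : ricciEnd (G t) y (EuclideanSpace.single i 1) i
      = ricciForm (G t) y (EuclideanSpace.single i 1)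
          ((G t y).inverse (EuclideanSpace.proj i : Mod n →L[ℝ] ℝ)) :=
    hG.inverse_symm ht hy (EuclideanSpace.proj i : Mod n →L[ℝ] ℝ)
      (LinearMap.toContinuousLinearMap (ricciForm (G t) y (EuclideanSpace.single i 1)))
  rw [h1]
  conv_rhs =>
    rw [← (EuclideanSpace.basisFun (Fin n) ℝ).sum_repr
      ((G t y).inverse (EuclideanSpace.proj i : Mod n →L[ℝ] ℝ))]
  rw [map_sum]
  refine Finset.sum_congr rfl fun j _ => ?_
  rw [map_smul, hG.ricci_eq ht hy]
  simp [inverseMetric]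

end IsMetricFamilyOn

namespace IsPullbackOn

variable {ψ : Mod n → Mod n} {G' : ℝ → Mod n → Bil (Mod n)} {T' : Set (Mod n)}
  (hψ : IsPullbackOn ψ G' G S T' T) (hG' : IsMetricFamilyOn G' S T') (hG : IsMetricFamilyOn G S T)
  {t : ℝ} (ht : t ∈ S) {y : Mod n} (hy : y ∈ T')
include hψ hG' hG ht hy

/-- The two endomorphisms are conjugate by the invertible differential of ψ. -/
theorem trace_eq {f' f : Mod n →ₗ[ℝ] Mod n} (h : ∀ a, fderiv ℝ ψ y (f' a) = f (fderiv ℝ ψ y a)) :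
    LinearMap.trace ℝ (Mod n) f' = LinearMap.trace ℝ (Mod n) f := by
  obtain ⟨e, he⟩ := hψ.isInvertible y hy
  rw [← LinearMap.trace_conj' f' e.toLinearEquiv]
  congr 1
  ext1 a
  have h1 := h (e.symm a)
  rw [← he] at h1
  simpa [LinearEquiv.conj_apply] using h1

theorem ricciForm (b c : Mod n) :
    ricciForm (G' t) y b c
      = LGeometry.ricciForm (G t) (ψ y) (fderiv ℝ ψ y b) (fderiv ℝ ψ y c) := by
  rw [ricciForm_apply, ricciForm_apply]
  exact hψ.trace_eq hG' hG ht hy fun a => hψ.curvatureL hG' hG ht hy a b c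

theorem ricci (b c : Mod n) :
    ricci (G' t) y b c = LGeometry.ricci (G t) (ψ y) (fderiv ℝ ψ y b) (fderiv ℝ ψ y c) := by
  rw [hG'.ricci_eq ht hy, hG.ricci_eq ht (hψ.mapsTo hy), hψ.ricciForm hG' hG ht hy]

theorem scalarCurvature : scalarCurvature (G' t) y = LGeometry.scalarCurvature (G t) (ψ y) := by
  rw [hG'.scalarCurvature_eq ht hy, hG.scalarCurvature_eq ht (hψ.mapsTo hy)]
  refine hψ.trace_eq hG' hG ht hy fun a => ?_
  refine hG.ext_inner ht (hψ.mapsTo hy) fun c' => ?_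
  obtain ⟨c, rfl⟩ : ∃ c, fderiv ℝ ψ y c = c' :=
    ⟨_, (hψ.isInvertible y hy).self_apply_inverse c'⟩
  rw [← hψ.pullback t ht y hy, hG'.metric_ricciEnd ht hy, hG.metric_ricciEnd ht (hψ.mapsTo hy),
    hψ.ricciForm hG' hG ht hy]

theorem fderiv_scalarCurvature (a : Mod n) :
    fderiv ℝ (LGeometry.scalarCurvature (G' t)) y a
      = fderiv ℝ (LGeometry.scalarCurvature (G t)) (ψ y) (fderiv ℝ ψ y a) := by
  have heq : LGeometry.scalarCurvature (G' t) =ᶠ[𝓝 y] LGeometry.scalarCurvature (G t) ∘ ψ := by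
    filter_upwards [hG'.isOpen.mem_nhds hy] with z hz using hψ.scalarCurvature hG' hG ht hz
  have h1 : HasFDerivAt (LGeometry.scalarCurvature (G t)) _ (ψ y) :=
    ((hG.contDiffAt_scalarCurvature ht (hψ.mapsTo hy)).differentiableAt (by simp)).hasFDerivAt
  rw [heq.fderiv_eq, (h1.comp y (hψ.hasFDerivAt hG' hG ht hy)).fderiv]
  rfl

end IsPullbackOn

end Ricci

/-! ### Metrics and tensors on the manifold in an arbitrary chart -/

section ChartChange

variable {n : ℕ} {M : Type*} [TopologicalSpace M] [ChartedSpace (Mod n) M]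
  [IsManifold (𝓡 n) ∞ M]

instance isManifold_one : IsManifold (𝓡 n) 1 M := IsManifold.of_le (n := ∞) (by simp)

/-- The change of coordinates from the chart at `x` to the chart at `x₀`. -/
def chartChange (x x₀ : M) : Mod n → Mod n :=
  extChartAt (𝓡 n) x₀ ∘ (extChartAt (𝓡 n) x).symm

/-- The domain of the change of coordinates from the chart at `x` to the chart at `x₀`. -/
def chartOverlap (x x₀ : M) : Set (Mod n) :=
  (extChartAt (𝓡 n) x).target ∩ (extChartAt (𝓡 n) x).symm ⁻¹' (extChartAt (𝓡 n) x₀).source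

theorem isOpen_chartOverlap (x x₀ : M) : IsOpen (chartOverlap (n := n) x x₀) :=
  (continuousOn_extChartAt_symm x).isOpen_inter_preimage (isOpen_extChartAt_target x)
    (isOpen_extChartAt_source x₀)

theorem mem_chartOverlap {x x₀ q : M} (hx : q ∈ (extChartAt (𝓡 n) x).source)
    (hx₀ : q ∈ (extChartAt (𝓡 n) x₀).source) : extChartAt (𝓡 n) x q ∈ chartOverlap (n := n) x x₀ :=
  ⟨(extChartAt (𝓡 n) x).map_source hx, by
    rw [mem_preimage, (extChartAt (𝓡 n) x).left_inv hx]; exact hx₀⟩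

theorem chartChange_apply {x q : M} (x₀ : M) (hx : q ∈ (extChartAt (𝓡 n) x).source) :
    chartChange x x₀ (extChartAt (𝓡 n) x q) = extChartAt (𝓡 n) x₀ q := by
  simp only [chartChange, Function.comp_apply, (extChartAt (𝓡 n) x).left_inv hx]

theorem contDiffOn_chartChange (x x₀ : M) :
    ContDiffOn ℝ ∞ (chartChange (n := n) x x₀) (chartOverlap x x₀) := by
  have h := contDiffOn_ext_coord_change (I := 𝓡 n) (n := ∞) x₀ x
  refine h.mono ?_
  intro y hy
  exact ⟨hy.1, hy.2⟩

theorem tangentCoordChange_eq (x x₀ q : M) :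
    tangentCoordChange (𝓡 n) x x₀ q
      = fderiv ℝ (chartChange (n := n) x x₀) (extChartAt (𝓡 n) x q) := by
  rw [tangentCoordChange_def, ModelWithCorners.range_eq_univ, fderivWithin_univ]
  rfl

theorem mfderiv_extChartAt_eq {x₀ q : M} (hq : q ∈ (extChartAt (𝓡 n) x₀).source) :
    mfderiv (𝓡 n) 𝓘(ℝ, Mod n) (extChartAt (𝓡 n) x₀) q = tangentCoordChange (𝓡 n) q x₀ q := by
  rw [extChartAt_source] at hq
  rw [(hasMFDerivAt_extChartAt hq).mfderiv]
  exact mfderiv_chartAt_eq_tangentCoordChange hq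

theorem chartVector_eq {x₀ q : M} (hq : q ∈ (extChartAt (𝓡 n) x₀).source)
    (w : TangentSpace (𝓡 n) q) : chartVector x₀ q w = tangentCoordChange (𝓡 n) q x₀ q w := by
  rw [← mfderiv_extChartAt_eq hq]
  rfl

theorem chartVector_self (q : M) (w : TangentSpace (𝓡 n) q) : chartVector q q w = w := by
  rw [chartVector_eq (mem_extChartAt_source q)]
  exact tangentCoordChange_self (mem_extChartAt_source q)

theorem fderiv_chartChange_chartVector {x x₀ q : M} (hx : q ∈ (extChartAt (𝓡 n) x).source)
    (hx₀ : q ∈ (extChartAt (𝓡 n) x₀).source) (w : TangentSpace (𝓡 n) q) :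
    fderiv ℝ (chartChange (n := n) x x₀) (extChartAt (𝓡 n) x q) (chartVector x q w)
      = chartVector x₀ q w := by
  rw [← tangentCoordChange_eq, chartVector_eq hx, chartVector_eq hx₀]
  exact tangentCoordChange_comp ⟨⟨mem_extChartAt_source q, hx⟩, hx₀⟩

theorem chartVector_add (x₀ q : M) (v w : TangentSpace (𝓡 n) q) :
    chartVector x₀ q (v + w) = chartVector x₀ q v + chartVector x₀ q w := map_add _ _ _

theorem chartVector_sub (x₀ q : M) (v w : TangentSpace (𝓡 n) q) :
    chartVector x₀ q (v - w) = chartVector x₀ q v - chartVector x₀ q w := map_sub _ _ _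

theorem chartVector_smul (x₀ q : M) (r : ℝ) (w : TangentSpace (𝓡 n) q) :
    chartVector x₀ q (r • w) = r • chartVector x₀ q w := map_smul _ _ _

theorem fderiv_chartChange_comp {x x₀ q : M} (hx : q ∈ (extChartAt (𝓡 n) x).source)
    (hx₀ : q ∈ (extChartAt (𝓡 n) x₀).source) (a : Mod n) :
    fderiv ℝ (chartChange (n := n) x x₀) (extChartAt (𝓡 n) x q)
      (fderiv ℝ (chartChange (n := n) x₀ x) (extChartAt (𝓡 n) x₀ q) a) = a := by
  rw [← tangentCoordChange_eq, ← tangentCoordChange_eq]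
  have := tangentCoordChange_comp (I := 𝓡 n) (v := a) ⟨⟨hx₀, hx⟩, hx₀⟩
  rw [tangentCoordChange_self hx₀] at this
  exact this

theorem chartVector_injective {x₀ q : M} (hq : q ∈ (extChartAt (𝓡 n) x₀).source) :
    Function.Injective (chartVector (n := n) x₀ q) := by
  intro v w h
  have h1 := fderiv_chartChange_chartVector hq (mem_extChartAt_source q) v
  have h2 := fderiv_chartChange_chartVector hq (mem_extChartAt_source q) w
  rw [chartVector_self] at h1 h2
  rw [← h1, ← h2, h]

/-- The tangent vector at `q` with components `a` in the chart at `x₀`. -/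
def vectorOfChart (x₀ q : M) (a : Mod n) : TangentSpace (𝓡 n) q :=
  fderiv ℝ (chartChange (n := n) x₀ q) (extChartAt (𝓡 n) x₀ q) a

theorem chartVector_vectorOfChart {x₀ q : M} (hq : q ∈ (extChartAt (𝓡 n) x₀).source)
    (a : Mod n) : chartVector x₀ q (vectorOfChart x₀ q a) = a := by
  have h1 := fderiv_chartChange_chartVector (mem_extChartAt_source q) hq (vectorOfChart x₀ q a)
  have h2 : chartVector q q (vectorOfChart x₀ q a)
      = fderiv ℝ (chartChange (n := n) x₀ q) (extChartAt (𝓡 n) x₀ q) a := chartVector_self q _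
  exact h1.symm.trans ((congrArg _ h2).trans
    (fderiv_chartChange_comp (mem_extChartAt_source q) hq a))

theorem chartSymmDeriv_chartVector {x₀ q : M} (hq : q ∈ (extChartAt (𝓡 n) x₀).source)
    (w : TangentSpace (𝓡 n) q) :
    chartSymmDeriv x₀ (extChartAt (𝓡 n) x₀ q) (chartVector x₀ q w) = w := by
  have h := mfderivWithin_extChartAt_symm_comp_mfderiv_extChartAt (I := 𝓡 n)
    ((extChartAt (𝓡 n) x₀).map_source hq)
  rw [ModelWithCorners.range_eq_univ, mfderivWithin_univ, (extChartAt (𝓡 n) x₀).left_inv hq] at h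
  exact congrArg (fun L : Mod n →L[ℝ] Mod n => L w) h

theorem chartMetric_chartVector (g : Metric n M) {x₀ q : M}
    (hq : q ∈ (extChartAt (𝓡 n) x₀).source) (v w : TangentSpace (𝓡 n) q) :
    chartMetric g x₀ (extChartAt (𝓡 n) x₀ q) (chartVector x₀ q v) (chartVector x₀ q w)
      = g.inner q v w := by
  have h1 := chartSymmDeriv_chartVector hq v
  have h2 := chartSymmDeriv_chartVector hq w
  have h3 := (extChartAt (𝓡 n) x₀).left_inv hq
  rw [chartMetric, ContinuousLinearMap.bilinearComp_apply, h1, h2, h3]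
  rfl

theorem chartMetric_apply (g : Metric n M) {x₀ : M} {y : Mod n}
    (hy : y ∈ (extChartAt (𝓡 n) x₀).target) (a b : Mod n) :
    ∃ v w : TangentSpace (𝓡 n) ((extChartAt (𝓡 n) x₀).symm y),
      chartVector x₀ _ v = a ∧ chartVector x₀ _ w = b ∧
        chartMetric g x₀ y a b = g.inner ((extChartAt (𝓡 n) x₀).symm y) v w := by
  have hq := (extChartAt (𝓡 n) x₀).map_target hy
  have h1 := chartVector_vectorOfChart hq a
  have h2 := chartVector_vectorOfChart hq b
  refine ⟨_, _, h1, h2, ?_⟩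
  rw [← chartMetric_chartVector g hq, h1, h2, (extChartAt (𝓡 n) x₀).right_inv hy]

variable {g : ℝ → Metric n M} {τ₁ τ₂ : ℝ} (hg : IsBackwardRicciFlow g τ₁ τ₂)
include hg

theorem isMetricFamilyOn_chartMetric (x₀ : M) :
    IsMetricFamilyOn (fun t => chartMetric (g t) x₀) (Icc τ₁ τ₂) (extChartAt (𝓡 n) x₀).target where
  isOpen := isOpen_extChartAt_target x₀
  smooth := hg.smooth x₀
  symm t _ y _ a b := (g t).symm _ _ _
  pos t _ y hy a ha := by
    obtain ⟨v, w, hv, hw, h⟩ := chartMetric_apply (g t) hy a a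
    have : v = w := chartVector_injective ((extChartAt (𝓡 n) x₀).map_target hy) (hv.trans hw.symm)
    rw [h, ← this]
    refine (g t).pos _ v fun h0 => ha ?_
    rw [← hv, h0]
    exact map_zero _

theorem isMetricFamilyOn_chartOverlap (x x₀ : M) :
    IsMetricFamilyOn (fun t => chartMetric (g t) x) (Icc τ₁ τ₂) (chartOverlap x x₀) :=
  (isMetricFamilyOn_chartMetric hg x).restrict subset_rfl (isOpen_chartOverlap x x₀)
    fun _ h => h.1

theorem isPullbackOn_chartChange (x x₀ : M) :
    IsPullbackOn (chartChange (n := n) x x₀) (fun t => chartMetric (g t) x)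
      (fun t => chartMetric (g t) x₀) (Icc τ₁ τ₂) (chartOverlap x x₀)
      (extChartAt (𝓡 n) x₀).target where
  smooth := contDiffOn_chartChange x x₀
  mapsTo y hy := (extChartAt (𝓡 n) x₀).map_source hy.2
  isInvertible y hy := by
    have hx := (extChartAt (𝓡 n) x).map_target hy.1
    have hr := (extChartAt (𝓡 n) x).right_inv hy.1
    have h1 := fderiv_chartChange_comp hx hy.2
    have h2 := fderiv_chartChange_comp hy.2 hx
    rw [hr] at h1 h2
    exact ⟨ContinuousLinearEquiv.equivOfInverse _ _ h2 h1, rfl⟩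
  pullback t _ y hy a b := by
    have hx := (extChartAt (𝓡 n) x).map_target hy.1
    have hr := (extChartAt (𝓡 n) x).right_inv hy.1
    obtain ⟨v, w, hv, hw, h⟩ := chartMetric_apply (g t) hy.1 a b
    rw [h, ← chartMetric_chartVector (g t) hy.2, ← fderiv_chartChange_chartVector hx hy.2 v,
      ← fderiv_chartChange_chartVector hx hy.2 w, hv, hw, hr]
    rfl

/-- The left side uses the preferred chart at q, which jumps as q moves along a curve; the right
side uses a fixed chart and can be differentiated along it. -/
theorem Ric_eq {τ : ℝ} (hτ : τ ∈ Icc τ₁ τ₂) {x₀ q : M} (hq : q ∈ (extChartAt (𝓡 n) x₀).source)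
    (a b : TangentSpace (𝓡 n) q) :
    Ric (g τ) q a b = ricci (chartMetric (g τ) x₀) (extChartAt (𝓡 n) x₀ q)
      (chartVector x₀ q a) (chartVector x₀ q b) := by
  have h := (isPullbackOn_chartChange hg q x₀).ricci (isMetricFamilyOn_chartOverlap hg q x₀)
    (isMetricFamilyOn_chartMetric hg x₀) hτ (mem_chartOverlap (mem_extChartAt_source q) hq)
    (chartVector q q a) (chartVector q q b)
  rw [fderiv_chartChange_chartVector (mem_extChartAt_source q) hq,
    fderiv_chartChange_chartVector (mem_extChartAt_source q) hq,
    chartChange_apply x₀ (mem_extChartAt_source q), chartVector_self, chartVector_self] at h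
  exact h

theorem dScal_eq {τ : ℝ} (hτ : τ ∈ Icc τ₁ τ₂) {x₀ q : M} (hq : q ∈ (extChartAt (𝓡 n) x₀).source)
    (a : TangentSpace (𝓡 n) q) :
    dScal (g τ) q a = fderiv ℝ (scalarCurvature (chartMetric (g τ) x₀)) (extChartAt (𝓡 n) x₀ q)
      (chartVector x₀ q a) := by
  have h := (isPullbackOn_chartChange hg q x₀).fderiv_scalarCurvature
    (isMetricFamilyOn_chartOverlap hg q x₀)
    (isMetricFamilyOn_chartMetric hg x₀) hτ (mem_chartOverlap (mem_extChartAt_source q) hq)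
    (chartVector q q a)
  rw [fderiv_chartChange_chartVector (mem_extChartAt_source q) hq,
    chartChange_apply x₀ (mem_extChartAt_source q), chartVector_self] at h
  exact h

theorem hasDerivWithinAt_chartMetric {τ : ℝ} (hτ : τ ∈ Icc τ₁ τ₂) {x₀ : M} {y : Mod n}
    (hy : y ∈ (extChartAt (𝓡 n) x₀).target) (a b : Mod n) :
    HasDerivWithinAt (fun t => chartMetric (g t) x₀ y a b)
      (2 * ricci (chartMetric (g τ) x₀) y a b) (Icc τ₁ τ₂) τ := by
  have hq := (extChartAt (𝓡 n) x₀).map_target hy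
  have e := (extChartAt (𝓡 n) x₀).right_inv hy
  have h := hg.evolution τ hτ _ (vectorOfChart x₀ ((extChartAt (𝓡 n) x₀).symm y) a)
    (vectorOfChart x₀ ((extChartAt (𝓡 n) x₀).symm y) b)
  rw [Ric_eq hg hτ hq, chartVector_vectorOfChart hq, chartVector_vectorOfChart hq, e] at h
  refine h.congr_of_mem (fun t _ => ?_) hτ
  rw [← chartMetric_chartVector (g t) hq, chartVector_vectorOfChart hq,
    chartVector_vectorOfChart hq, e]

end ChartChange

/-! ### Velocity and covariant derivative in an arbitrary chart -/

section Curves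

variable {n : ℕ} {M : Type*} [TopologicalSpace M] [ChartedSpace (Mod n) M]
  [IsManifold (𝓡 n) ∞ M]

theorem mfderiv_curve {c : ℝ → M} {t : ℝ} {u : Mod n} (hc : ContinuousAt c t)
    (hu : HasDerivAt (fun s => extChartAt (𝓡 n) (c t) (c s)) u t) :
    mfderiv 𝓘(ℝ, ℝ) (𝓡 n) c t (1 : ℝ) = u := by
  have hd : HasMFDerivAt 𝓘(ℝ, ℝ) (𝓡 n) c t (ContinuousLinearMap.toSpanSingleton ℝ u) := by
    refine ⟨hc, ?_⟩
    exact hu.hasFDerivAt.hasFDerivWithinAt.mono (subset_univ (range 𝓘(ℝ, ℝ)))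
  rw [hd.mfderiv]
  exact one_smul ℝ u

theorem hasDerivAt_chartChange {c : ℝ → M} {t : ℝ} {x₀ : M} {u : Mod n} (hc : ContinuousAt c t)
    (hx₀ : c t ∈ (extChartAt (𝓡 n) x₀).source) {x : M} (hx : c t ∈ (extChartAt (𝓡 n) x).source)
    (hu : HasDerivAt (fun s => extChartAt (𝓡 n) x₀ (c s)) u t) :
    HasDerivAt (fun s => extChartAt (𝓡 n) x (c s))
      (fderiv ℝ (chartChange (n := n) x₀ x) (extChartAt (𝓡 n) x₀ (c t)) u) t := by
  have hd : HasFDerivAt (chartChange (n := n) x₀ x) _ (extChartAt (𝓡 n) x₀ (c t)) :=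
    (((contDiffOn_chartChange x₀ x).contDiffAt ((isOpen_chartOverlap x₀ x).mem_nhds
      (mem_chartOverlap hx₀ hx))).differentiableAt (by simp)).hasFDerivAt
  refine (hd.comp_hasDerivAt t hu).congr_of_eventuallyEq ?_
  filter_upwards [hc.preimage_mem_nhds ((isOpen_extChartAt_source x₀).mem_nhds hx₀)] with s hs
  exact (chartChange_apply x hs).symm

theorem chartVector_mfderiv {c : ℝ → M} {t : ℝ} {x₀ : M} {u : Mod n} (hc : ContinuousAt c t)
    (hx₀ : c t ∈ (extChartAt (𝓡 n) x₀).source)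
    (hu : HasDerivAt (fun s => extChartAt (𝓡 n) x₀ (c s)) u t) :
    chartVector x₀ (c t) (mfderiv 𝓘(ℝ, ℝ) (𝓡 n) c t (1 : ℝ)) = u := by
  have h : mfderiv 𝓘(ℝ, ℝ) (𝓡 n) c t (1 : ℝ) = vectorOfChart x₀ (c t) u :=
    mfderiv_curve hc (hasDerivAt_chartChange hc hx₀ (mem_extChartAt_source _) hu)
  rw [h, chartVector_vectorOfChart hx₀]

set_option maxHeartbeats 1000000 in
-- Passing to the chart at γ(τ), differentiating the components of V brings in the second derivative
-- of the coordinate change. It is exactly the inhomogeneous term in the transformation law of the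
-- Christoffel symbols.
theorem chartVector_covDeriv {g : ℝ → Metric n M} {τ₁ τ₂ : ℝ} (hg : IsBackwardRicciFlow g τ₁ τ₂)
    {t : ℝ} (ht : t ∈ Icc τ₁ τ₂) {γ : ℝ → M} {τ : ℝ} {x₀ : M} (hγ : ContinuousAt γ τ)
    (hx₀ : γ τ ∈ (extChartAt (𝓡 n) x₀).source) {u v' : Mod n}
    (hu : HasDerivAt (fun s => extChartAt (𝓡 n) x₀ (γ s)) u τ) {V : ∀ s, TangentSpace (𝓡 n) (γ s)}
    (hV : HasDerivAt (fun s => chartVector x₀ (γ s) (V s)) v' τ) :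
    chartVector x₀ (γ τ) (covDeriv (g t) γ V τ)
      = v' + christoffelL (chartMetric (g t) x₀) (extChartAt (𝓡 n) x₀ (γ τ)) u
          (chartVector x₀ (γ τ) (V τ)) := by
  have hmem := mem_chartOverlap hx₀ (mem_extChartAt_source (I := 𝓡 n) (γ τ))
  have hψ := isPullbackOn_chartChange hg x₀ (γ τ)
  have h2 := hψ.hasFDerivAt_fderiv (isMetricFamilyOn_chartOverlap hg x₀ (γ τ))
    (isMetricFamilyOn_chartMetric hg (γ τ)) ht hmem
  have hd := ((h2.comp_hasDerivAt τ hu).clm_apply hV).congr_of_eventuallyEq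
    (f₁ := fun s => chartVector (γ τ) (γ s) (V s)) (by
      filter_upwards [hγ.preimage_mem_nhds ((isOpen_extChartAt_source x₀).mem_nhds hx₀),
        hγ.preimage_mem_nhds ((isOpen_extChartAt_source (γ τ)).mem_nhds
          (mem_extChartAt_source (I := 𝓡 n) (γ τ)))] with s hs hs'
      exact (fderiv_chartChange_chartVector hs hs' (V s)).symm)
  have key := hψ.christoffelL (isMetricFamilyOn_chartOverlap hg x₀ (γ τ))
    (isMetricFamilyOn_chartMetric hg (γ τ)) ht hmem u (chartVector x₀ (γ τ) (V τ))
  have hvel : velocity (n := n) γ τ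
      = fderiv ℝ (chartChange (n := n) x₀ (γ τ)) (extChartAt (𝓡 n) x₀ (γ τ)) u :=
    mfderiv_curve hγ (hasDerivAt_chartChange hγ hx₀ (mem_extChartAt_source _) hu)
  have hVτ : chartVector (γ τ) (γ τ) (V τ)
      = fderiv ℝ (chartChange (n := n) x₀ (γ τ)) (extChartAt (𝓡 n) x₀ (γ τ))
        (chartVector x₀ (γ τ) (V τ)) :=
    (fderiv_chartChange_chartVector hx₀ (mem_extChartAt_source _) _).symm
  have hcov : covDeriv (g t) γ V τ = vectorOfChart x₀ (γ τ)
        (v' + christoffelL (chartMetric (g t) x₀) (extChartAt (𝓡 n) x₀ (γ τ)) u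
          (chartVector x₀ (γ τ) (V τ))) := by
    have e : covDeriv (g t) γ V τ = (deriv (fun t => chartVector (γ τ) (γ t) (V t)) τ
        + christoffelL (chartMetric (g t) (γ τ)) (extChartAt (𝓡 n) (γ τ) (γ τ))
          (velocity (n := n) γ τ : Mod n) (chartVector (γ τ) (γ τ) (V τ)) : Mod n) := by
      rw [chartVector_self]
      rfl
    rw [e, vectorOfChart, map_add, key, hd.deriv, hvel, hVτ, chartChange_apply (γ τ) hx₀]
    simp only [Function.comp_apply]
    abel
  rw [hcov, chartVector_vectorOfChart hx₀]

end Curves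

/-! ### Backward Ricci flow in coordinates and the geodesic equation in σ = √τ -/

section CoordinateFlow

variable {n : ℕ}

/-- `G t`, `t ∈ S`, is a backward Ricci flow on `T ⊆ ℝⁿ`. -/
structure IsFlowOn (G : ℝ → Mod n → Bil (Mod n)) (S : Set ℝ) (T : Set (Mod n)) : Prop
    extends IsMetricFamilyOn G S T where
  uniqueDiffOn : UniqueDiffOn ℝ S
  evolution : ∀ t ∈ S, ∀ y ∈ T, ∀ a b,
    HasDerivWithinAt (fun t => G t y a b) (2 * ricci (G t) y a b) S t

/-- The Ricci tensor of a backward Ricci flow as half of the time derivative of the metric. -/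
def ricL (G : ℝ → Mod n → Bil (Mod n)) (S : Set ℝ) (t : ℝ) (y : Mod n) : Bil (Mod n) :=
  (1 / 2 : ℝ) • fderivWithin ℝ (fun t => G t y) S t 1

namespace IsFlowOn

variable {G : ℝ → Mod n → Bil (Mod n)} {S : Set ℝ} {T : Set (Mod n)} (hG : IsFlowOn G S T)
include hG

theorem hasDerivWithinAt_metric {t : ℝ} (ht : t ∈ S) {y : Mod n} (hy : y ∈ T) :
    HasDerivWithinAt (fun t => G t y) ((2 : ℝ) • ricL G S t y) S t := by
  have h : ContDiffOn ℝ ∞ (fun t => G t y) S :=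
    hG.contDiffOn_metric (t := id) (y := fun _ => y) contDiffOn_id contDiffOn_const (fun _ h => h)
      fun _ _ => hy
  have h2 := ((h.differentiableOn (by simp)) t ht).hasFDerivWithinAt.hasDerivWithinAt
  rw [ricL, smul_smul]
  simpa using h2

theorem ricL_apply {t : ℝ} (ht : t ∈ S) {y : Mod n} (hy : y ∈ T) (a b : Mod n) :
    ricL G S t y a b = ricci (G t) y a b := by
  have h1 := hG.evolution t ht y hy a b
  have h2 := ((hG.hasDerivWithinAt_metric ht hy).clm_apply
    (hasDerivWithinAt_const t S a)).clm_apply (hasDerivWithinAt_const t S b)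
  have := (hG.uniqueDiffOn t ht).eq_deriv S h1 h2
  simp at this
  linarith

/-- The symmetry of the Ricci tensor is inherited from that of the metrics through the evolution
equation, without appeal to curvature identities. -/
theorem ricL_symm {t : ℝ} (ht : t ∈ S) {y : Mod n} (hy : y ∈ T) (a b : Mod n) :
    ricL G S t y a b = ricL G S t y b a := by
  have h1 := hG.evolution t ht y hy a b
  have h2 := (hG.evolution t ht y hy b a).congr (fun s hs => hG.symm s hs y hy a b)
    (hG.symm t ht y hy a b)
  have := (hG.uniqueDiffOn t ht).eq_deriv S h1 h2
  rw [hG.ricL_apply ht hy, hG.ricL_apply ht hy]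
  linarith

theorem contDiffOn_ricL {P : Type*} [NormedAddCommGroup P] [NormedSpace ℝ P] {s : Set P}
    {t : P → ℝ} {y : P → Mod n} (ht : ContDiffOn ℝ ∞ t s) (hy : ContDiffOn ℝ ∞ y s)
    (htS : MapsTo t s S) (hyT : MapsTo y s T) :
    ContDiffOn ℝ ∞ (fun q => ricL G S (t q) (y q)) s := by
  intro q hq
  have h1 : ContDiffOn ℝ ∞ (Function.uncurry fun (q : P) (t : ℝ) => G t (y q)) (s ×ˢ S) :=
    hG.contDiffOn_metric (t := fun z : P × ℝ => z.2) (y := fun z => y z.1) contDiffOn_snd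
      (hy.comp contDiffOn_fst fun _ h => h.1) (fun _ h => h.2) fun _ h => hyT h.1
  have h2 := ContDiffWithinAt.fderivWithin (m := ∞) (h1 (q, t q) ⟨hq, htS hq⟩) (ht q hq)
    hG.uniqueDiffOn (by simp) hq htS
  exact (h2.clm_apply contDiffWithinAt_const).const_smul _

end IsFlowOn

/-- The force in the `𝓛`-geodesic equation, in terms of the parameter `σ = √τ`. -/
def geodesicForce (G : ℝ → Mod n → Bil (Mod n)) (S : Set ℝ) (σ : ℝ) (x u : Mod n) :
    Mod n →L[ℝ] ℝ :=
  (2 * σ ^ 2) • fderiv ℝ (scalarCurvature (G (σ ^ 2))) x - (4 * σ) • ricL G S (σ ^ 2) x u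

/-- The acceleration `x''` of an `𝓛`-geodesic, in terms of the parameter `σ = √τ`. -/
def geodesicAccel (G : ℝ → Mod n → Bil (Mod n)) (S : Set ℝ) (σ : ℝ) (x u : Mod n) : Mod n :=
  (G (σ ^ 2) x).inverse (geodesicForce G S σ x u) - christoffelL (G (σ ^ 2)) x u u

namespace IsFlowOn

variable {G : ℝ → Mod n → Bil (Mod n)} {S : Set ℝ} {T : Set (Mod n)} (hG : IsFlowOn G S T)
include hG

section Smooth

variable {P : Type*} [NormedAddCommGroup P] [NormedSpace ℝ P] {s : Set P} {σ : P → ℝ}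
    {x u : P → Mod n} (hσ : ContDiffOn ℝ ∞ σ s) (hx : ContDiffOn ℝ ∞ x s)
    (hu : ContDiffOn ℝ ∞ u s) (hσS : MapsTo (fun q => σ q ^ 2) s S) (hxT : MapsTo x s T)
include hσ hx hu hσS hxT

theorem contDiffOn_geodesicForce :
    ContDiffOn ℝ ∞ (fun q => geodesicForce G S (σ q) (x q) (u q)) s :=
  ((contDiffOn_const.mul (hσ.pow 2)).smul
    (hG.contDiffOn_fderiv_scalarCurvature (hσ.pow 2) hx hσS hxT)).sub
    ((contDiffOn_const.mul hσ).smul ((hG.contDiffOn_ricL (hσ.pow 2) hx hσS hxT).clm_apply hu))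

theorem contDiffOn_geodesicAccel :
    ContDiffOn ℝ ∞ (fun q => geodesicAccel G S (σ q) (x q) (u q)) s :=
  ((hG.contDiffOn_inverse (hσ.pow 2) hx hσS hxT).clm_apply
    (hG.contDiffOn_geodesicForce hσ hx hu hσS hxT)).sub
    (((hG.contDiffOn_christoffelL (hσ.pow 2) hx hσS hxT).clm_apply hu).clm_apply hu)

end Smooth

theorem metric_geodesicAccel {σ : ℝ} (hσ : σ ^ 2 ∈ S) {x : Mod n} (hx : x ∈ T) (u c : Mod n) :
    G (σ ^ 2) x (geodesicAccel G S σ x u + christoffelL (G (σ ^ 2)) x u u) c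
      = geodesicForce G S σ x u c := by
  rw [geodesicAccel, sub_add_cancel, (hG.isInvertible hσ hx).self_apply_inverse]

theorem eq_geodesicAccel {σ : ℝ} (hσ : σ ^ 2 ∈ S) {x : Mod n} (hx : x ∈ T) {u A : Mod n}
    (h : ∀ c, G (σ ^ 2) x (A + christoffelL (G (σ ^ 2)) x u u) c = geodesicForce G S σ x u c) :
    A = geodesicAccel G S σ x u := by
  have : A + christoffelL (G (σ ^ 2)) x u u
      = geodesicAccel G S σ x u + christoffelL (G (σ ^ 2)) x u u :=
    hG.ext_inner hσ hx fun c => by rw [h, hG.metric_geodesicAccel hσ hx]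
  exact add_right_cancel this

end IsFlowOn

end CoordinateFlow

/-! ### The substitution τ = σ² -/

section GeodesicEquation

variable {n : ℕ} {M : Type*} [TopologicalSpace M] [ChartedSpace (Mod n) M]
  [IsManifold (𝓡 n) ∞ M]

theorem isFlowOn_chartMetric {g : ℝ → Metric n M} {τ₁ τ₂ : ℝ} (hτ : τ₁ < τ₂)
    (hg : IsBackwardRicciFlow g τ₁ τ₂) (x₀ : M) :
    IsFlowOn (fun t => chartMetric (g t) x₀) (Icc τ₁ τ₂) (extChartAt (𝓡 n) x₀).target where
  toIsMetricFamilyOn := isMetricFamilyOn_chartMetric hg x₀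
  uniqueDiffOn := uniqueDiffOn_Icc hτ
  evolution _ ht _ hy a b := hasDerivWithinAt_chartMetric hg ht hy a b

theorem continuousAt_of_comp_sq {X : Type*} [TopologicalSpace X] {γ : ℝ → X} {σ : ℝ} (hσ : 0 < σ)
    (h : ContinuousAt (fun s => γ (s ^ 2)) σ) : ContinuousAt γ (σ ^ 2) := by
  have h1 : ContinuousAt (fun t => γ (√t ^ 2)) (σ ^ 2) := by
    refine ContinuousAt.comp (f := fun t => √t) (g := fun s => γ (s ^ 2)) ?_
      Real.continuous_sqrt.continuousAt
    rwa [Real.sqrt_sq hσ.le]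
  refine h1.congr ?_
  filter_upwards [lt_mem_nhds (show 0 < σ ^ 2 by positivity)] with t ht
  rw [Real.sq_sqrt ht.le]

theorem hasDerivAt_of_comp_sq {F : Type*} [NormedAddCommGroup F] [NormedSpace ℝ F] {f : ℝ → F}
    {σ : ℝ} {u : F} (hσ : 0 < σ) (h : HasDerivAt (fun s => f (s ^ 2)) u σ) :
    HasDerivAt f ((1 / (2 * σ)) • u) (σ ^ 2) := by
  have h1 : HasDerivAt (fun t => √t) (1 / (2 * σ)) (σ ^ 2) := by
    have := Real.hasDerivAt_sqrt (x := σ ^ 2) (by positivity)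
    rwa [Real.sqrt_sq hσ.le] at this
  have h2 : HasDerivAt (fun s => f (s ^ 2)) u (√(σ ^ 2)) := by rwa [Real.sqrt_sq hσ.le]
  refine (h2.scomp (σ ^ 2) h1).congr_of_eventuallyEq ?_
  filter_upwards [lt_mem_nhds (show 0 < σ ^ 2 by positivity)] with t ht
  simp [Real.sq_sqrt ht.le]

variable {g : ℝ → Metric n M} {τ₁ τ₂ : ℝ} {γ : ℝ → M} {σ : ℝ} {x₀ : M}

theorem chartVector_velocity_sq (hσ : 0 < σ) (hγ : ContinuousAt (fun s => γ (s ^ 2)) σ)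
    (hx₀ : γ (σ ^ 2) ∈ (extChartAt (𝓡 n) x₀).source) {u : Mod n}
    (hu : HasDerivAt (fun s => extChartAt (𝓡 n) x₀ (γ (s ^ 2))) u σ) :
    chartVector x₀ (γ (σ ^ 2)) (velocity (n := n) γ (σ ^ 2)) = (1 / (2 * σ)) • u :=
  chartVector_mfderiv (continuousAt_of_comp_sq hσ hγ) hx₀
    (hasDerivAt_of_comp_sq (f := fun t => extChartAt (𝓡 n) x₀ (γ t)) hσ hu)

theorem chartVector_covDeriv_sq (hg : IsBackwardRicciFlow g τ₁ τ₂) (hσ : 0 < σ)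
    (hσI : σ ^ 2 ∈ Icc τ₁ τ₂) (hγ : ContinuousAt (fun s => γ (s ^ 2)) σ)
    (hx₀ : γ (σ ^ 2) ∈ (extChartAt (𝓡 n) x₀).source) {u v' : Mod n}
    (hu : HasDerivAt (fun s => extChartAt (𝓡 n) x₀ (γ (s ^ 2))) u σ)
    {V : ∀ s, TangentSpace (𝓡 n) (γ s)}
    (hV : HasDerivAt (fun s => chartVector x₀ (γ (s ^ 2)) (V (s ^ 2))) v' σ) :
    chartVector x₀ (γ (σ ^ 2)) (covDeriv (g (σ ^ 2)) γ V (σ ^ 2))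
      = (1 / (2 * σ)) • (v' + christoffelL (chartMetric (g (σ ^ 2)) x₀)
          (extChartAt (𝓡 n) x₀ (γ (σ ^ 2))) u (chartVector x₀ (γ (σ ^ 2)) (V (σ ^ 2)))) := by
  rw [chartVector_covDeriv hg hσI (continuousAt_of_comp_sq hσ hγ) hx₀
    (hasDerivAt_of_comp_sq (f := fun t => extChartAt (𝓡 n) x₀ (γ t)) hσ hu)
    (hasDerivAt_of_comp_sq (f := fun t => chartVector x₀ (γ t) (V t)) hσ hV), map_smul,
    _root_.smul_apply, smul_add]

theorem sq_mem_Icc (hτ₁ : 0 ≤ τ₁) (hτ : τ₁ < τ₂) (hσ : σ ∈ Icc (√τ₁) (√τ₂)) :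
    σ ^ 2 ∈ Icc τ₁ τ₂ := by
  have h0 : 0 ≤ σ := (Real.sqrt_nonneg _).trans hσ.1
  exact ⟨(Real.sqrt_le_left h0).1 hσ.1, (Real.le_sqrt h0 (hτ₁.trans hτ.le)).1 hσ.2⟩

theorem sq_mem_Ioo (hσ : σ ∈ Ioo (√τ₁) (√τ₂)) : σ ^ 2 ∈ Ioo τ₁ τ₂ := by
  have h0 : 0 < σ := (Real.sqrt_nonneg _).trans_lt hσ.1
  exact ⟨(Real.sqrt_lt' h0).1 hσ.1, (Real.lt_sqrt h0.le).1 hσ.2⟩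

end GeodesicEquation

/-! ### 𝓛-geodesics as solutions of a first order system in a chart -/

section ChartPhase

variable {n : ℕ} {M : Type*} [TopologicalSpace M] [ChartedSpace (Mod n) M]
  [IsManifold (𝓡 n) ∞ M]

/-- Position and velocity of the curve `c` on `I` in the chart at `x₀`. -/
def chartPhase (I : Set ℝ) (x₀ : M) (c : ℝ → M) (σ : ℝ) : Mod n × Mod n :=
  (extChartAt (𝓡 n) x₀ (c σ), derivWithin (fun s => extChartAt (𝓡 n) x₀ (c s)) I σ)

variable {I : Set ℝ} {c : ℝ → M} {σ : ℝ} {x₀ : M}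

theorem source_mem_nhdsWithin (hc : ContinuousWithinAt c I σ)
    (hx₀ : c σ ∈ (extChartAt (𝓡 n) x₀).source) :
    {s | c s ∈ (extChartAt (𝓡 n) x₀).source} ∈ 𝓝[I] σ :=
  hc ((isOpen_extChartAt_source x₀).mem_nhds hx₀)

theorem contDiffWithinAt_chart (hc : ContMDiffOn 𝓘(ℝ, ℝ) (𝓡 n) ∞ c I) (hσ : σ ∈ I)
    (hx₀ : c σ ∈ (extChartAt (𝓡 n) x₀).source) :
    ContDiffWithinAt ℝ ∞ (fun s => extChartAt (𝓡 n) x₀ (c s)) I σ := by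
  rw [← contMDiffWithinAt_iff_contDiffWithinAt]
  rw [extChartAt_source] at hx₀
  exact (contMDiffAt_extChartAt' hx₀).comp_contMDiffWithinAt σ (hc σ hσ)

theorem contDiffWithinAt_derivWithin_chart (hI : UniqueDiffOn ℝ I)
    (hc : ContMDiffOn 𝓘(ℝ, ℝ) (𝓡 n) ∞ c I) (hσ : σ ∈ I)
    (hx₀ : c σ ∈ (extChartAt (𝓡 n) x₀).source) :
    ContDiffWithinAt ℝ ∞ (derivWithin (fun s => extChartAt (𝓡 n) x₀ (c s)) I) I σ := by
  have h := (contDiffWithinAt_chart hc hσ hx₀).fderivWithin_right (m := ∞) hI (by simp) hσ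
  exact h.clm_apply (contDiffWithinAt_const (c := (1 : ℝ)))

theorem contDiffWithinAt_chartPhase (hI : UniqueDiffOn ℝ I)
    (hc : ContMDiffOn 𝓘(ℝ, ℝ) (𝓡 n) ∞ c I) (hσ : σ ∈ I)
    (hx₀ : c σ ∈ (extChartAt (𝓡 n) x₀).source) :
    ContDiffWithinAt ℝ ∞ (chartPhase (n := n) I x₀ c) I σ :=
  (contDiffWithinAt_chart hc hσ hx₀).prodMk (contDiffWithinAt_derivWithin_chart hI hc hσ hx₀)

theorem hasDerivWithinAt_chart (hc : ContMDiffOn 𝓘(ℝ, ℝ) (𝓡 n) ∞ c I) (hσ : σ ∈ I)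
    (hx₀ : c σ ∈ (extChartAt (𝓡 n) x₀).source) :
    HasDerivWithinAt (fun s => extChartAt (𝓡 n) x₀ (c s)) (chartPhase I x₀ c σ).2 I σ :=
  ((contDiffWithinAt_chart hc hσ hx₀).differentiableWithinAt (by simp)).hasDerivWithinAt

theorem chartPhase_chartChange (hI : UniqueDiffOn ℝ I) (hc : ContMDiffOn 𝓘(ℝ, ℝ) (𝓡 n) ∞ c I)
    (hσ : σ ∈ I) (hx₀ : c σ ∈ (extChartAt (𝓡 n) x₀).source) {x : M}
    (hx : c σ ∈ (extChartAt (𝓡 n) x).source) :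
    chartPhase (n := n) I x c σ = (chartChange x₀ x (chartPhase I x₀ c σ).1,
      fderiv ℝ (chartChange x₀ x) (chartPhase I x₀ c σ).1 (chartPhase I x₀ c σ).2) := by
  have hd : HasFDerivAt (chartChange (n := n) x₀ x) _ (extChartAt (𝓡 n) x₀ (c σ)) :=
    (((contDiffOn_chartChange x₀ x).contDiffAt ((isOpen_chartOverlap x₀ x).mem_nhds
      (mem_chartOverlap hx₀ hx))).differentiableAt (by simp)).hasFDerivAt
  have h1 := hd.comp_hasDerivWithinAt σ (hasDerivWithinAt_chart hc hσ hx₀)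
  have h2 : HasDerivWithinAt (fun s => extChartAt (𝓡 n) x (c s)) _ I σ :=
    h1.congr_of_eventuallyEq_of_mem (by
    filter_upwards [source_mem_nhdsWithin (hc σ hσ).continuousWithinAt hx₀] with s hs
    exact (chartChange_apply x hs).symm) hσ
  ext1
  · exact (chartChange_apply x hx₀).symm
  · exact h2.derivWithin (hI σ hσ)

variable {g : ℝ → Metric n M} {τ₁ τ₂ : ℝ} {γ : ℝ → M}

theorem uniqueDiffOn_sqrt (hτ₁ : 0 ≤ τ₁) (hτ : τ₁ < τ₂) : UniqueDiffOn ℝ (Icc (√τ₁) (√τ₂)) :=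
  uniqueDiffOn_Icc (Real.sqrt_lt_sqrt hτ₁ hτ)

/-- The velocity in τ is u / (2σ). Its covariant derivative contains a multiple of u from
differentiating 1 / (2σ), which cancels the term X / (2τ); the rest, multiplied by (2σ)², is the
equation in σ. -/
theorem IsLGeodesic.deriv_phase_interior (hτ₁ : 0 ≤ τ₁) (hτ : τ₁ < τ₂)
    (hg : IsBackwardRicciFlow g τ₁ τ₂) (hγ : IsLGeodesic g τ₁ τ₂ γ)
    (hσ : σ ∈ Ioo (√τ₁) (√τ₂)) (hx₀ : γ (σ ^ 2) ∈ (extChartAt (𝓡 n) x₀).source) :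
    derivWithin (derivWithin (fun s => extChartAt (𝓡 n) x₀ (γ (s ^ 2))) (Icc (√τ₁) (√τ₂)))
        (Icc (√τ₁) (√τ₂)) σ
      = geodesicAccel (fun t => chartMetric (g t) x₀) (Icc τ₁ τ₂) σ
          (extChartAt (𝓡 n) x₀ (γ (σ ^ 2)))
          (derivWithin (fun s => extChartAt (𝓡 n) x₀ (γ (s ^ 2))) (Icc (√τ₁) (√τ₂)) σ) := by
  have hσI := Ioo_subset_Icc_self hσ
  have hI := uniqueDiffOn_sqrt hτ₁ hτ
  have h0 : 0 < σ := (Real.sqrt_nonneg _).trans_lt hσ.1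
  have hτI := sq_mem_Icc hτ₁ hτ hσI
  have hcont : ∀ s ∈ Ioo (√τ₁) (√τ₂), ContinuousAt (fun s => γ (s ^ 2)) s := fun s hs =>
    (hγ.smooth s (Ioo_subset_Icc_self hs)).continuousWithinAt.continuousAt
      (Icc_mem_nhds hs.1 hs.2)
  set U := derivWithin (fun s => extChartAt (𝓡 n) x₀ (γ (s ^ 2))) (Icc (√τ₁) (√τ₂)) with hU
  have hev : ∀ᶠ s in 𝓝 σ, s ∈ Ioo (√τ₁) (√τ₂) ∧ γ (s ^ 2) ∈ (extChartAt (𝓡 n) x₀).source :=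
    Filter.Eventually.and (Ioo_mem_nhds hσ.1 hσ.2)
      ((hcont σ hσ).preimage_mem_nhds ((isOpen_extChartAt_source x₀).mem_nhds hx₀))
  have hX : ∀ᶠ s in 𝓝 σ, HasDerivAt (fun s => extChartAt (𝓡 n) x₀ (γ (s ^ 2))) (U s) s := by
    filter_upwards [hev] with s hs
    exact (hasDerivWithinAt_chart hγ.smooth (Ioo_subset_Icc_self hs.1) hs.2).hasDerivAt
      (Icc_mem_nhds hs.1.1 hs.1.2)
  have hA : HasDerivAt U (derivWithin U (Icc (√τ₁) (√τ₂)) σ) σ :=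
    ((contDiffWithinAt_derivWithin_chart hI hγ.smooth hσI hx₀).differentiableWithinAt
      (by simp)).hasDerivWithinAt.hasDerivAt (Icc_mem_nhds hσ.1 hσ.2)
  set A := derivWithin U (Icc (√τ₁) (√τ₂)) σ with hA'
  have hv : HasDerivAt (fun s => chartVector x₀ (γ (s ^ 2)) (velocity (n := n) γ (s ^ 2)))
      ((1 / (2 * σ)) • A - (1 / (2 * σ ^ 2)) • U σ) σ := by
    have h1 : HasDerivAt (fun s : ℝ => 1 / (2 * s)) (-(1 / (2 * σ ^ 2))) σ := by
      have := ((hasDerivAt_id σ).const_mul 2).inv (by simpa using h0.ne')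
      simp only [one_div]
      convert! this using 1
      simp
      field_simp
    have h2 := h1.smul hA
    refine (h2.congr_deriv ?_).congr_of_eventuallyEq ?_
    · rw [neg_smul, sub_eq_add_neg]
    · filter_upwards [hev, hX] with s hs hs'
      exact chartVector_velocity_sq ((Real.sqrt_nonneg _).trans_lt hs.1.1) (hcont s hs.1) hs.2 hs'
  have hG := isFlowOn_chartMetric hτ hg x₀
  have hxT := (extChartAt (𝓡 n) x₀).map_source hx₀
  refine hG.eq_geodesicAccel hτI hxT fun w => ?_
  -- Testing against the vector with components w in the chart turns the equation into an identity
  -- of components.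
  have heq := hγ.equation (σ ^ 2) (sq_mem_Ioo hσ) (vectorOfChart x₀ (γ (σ ^ 2)) w)
  rw [← chartMetric_chartVector (g (σ ^ 2)) hx₀, ← chartMetric_chartVector (g (σ ^ 2)) hx₀,
    dScal_eq hg hτI hx₀, Ric_eq hg hτI hx₀, chartVector_vectorOfChart hx₀,
    chartVector_covDeriv_sq hg h0 hτI (hcont σ hσ) hx₀ hX.self_of_nhds hv,
    chartVector_velocity_sq h0 (hcont σ hσ) hx₀ hX.self_of_nhds, ← hG.ricL_apply hτI hxT] at heq
  simp only [geodesicForce, map_add, map_sub, map_smul, _root_.add_apply, _root_.sub_apply,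
    _root_.smul_apply, smul_eq_mul] at heq ⊢
  field_simp at heq
  field_simp
  refine mul_left_cancel₀ h0.ne' ?_
  linear_combination heq

/-- The equation is required only in the open interval. Both sides are continuous up to the ends
because the curve is smooth there in σ, so the equation extends by density. -/
theorem IsLGeodesic.hasDerivWithinAt_chartPhase (hτ₁ : 0 ≤ τ₁) (hτ : τ₁ < τ₂)
    (hg : IsBackwardRicciFlow g τ₁ τ₂) (hγ : IsLGeodesic g τ₁ τ₂ γ)
    (hσ : σ ∈ Icc (√τ₁) (√τ₂)) (hx₀ : γ (σ ^ 2) ∈ (extChartAt (𝓡 n) x₀).source) :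
    HasDerivWithinAt (chartPhase (Icc (√τ₁) (√τ₂)) x₀ (fun s => γ (s ^ 2)))
      ((chartPhase (Icc (√τ₁) (√τ₂)) x₀ (fun s => γ (s ^ 2)) σ).2,
        geodesicAccel (fun t => chartMetric (g t) x₀) (Icc τ₁ τ₂) σ
          (chartPhase (Icc (√τ₁) (√τ₂)) x₀ (fun s => γ (s ^ 2)) σ).1
          (chartPhase (Icc (√τ₁) (√τ₂)) x₀ (fun s => γ (s ^ 2)) σ).2)
      (Icc (√τ₁) (√τ₂)) σ := by
  set I := Icc (√τ₁) (√τ₂) with hIdef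
  have hlt := Real.sqrt_lt_sqrt hτ₁ hτ
  have hI : UniqueDiffOn ℝ I := uniqueDiffOn_sqrt hτ₁ hτ
  have hG := isFlowOn_chartMetric hτ hg x₀
  refine (hasDerivWithinAt_chart hγ.smooth hσ hx₀).prodMk ?_
  have hU := contDiffWithinAt_derivWithin_chart hI hγ.smooth hσ hx₀
  refine ((hU.differentiableWithinAt (by simp)).hasDerivWithinAt).congr_deriv ?_
  have hclos : σ ∈ closure (Ioo (√τ₁) (√τ₂)) := by rwa [closure_Ioo hlt.ne]
  have hne : (𝓝[Ioo (√τ₁) (√τ₂)] σ).NeBot := mem_closure_iff_nhdsWithin_neBot.1 hclos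
  have hmono : 𝓝[Ioo (√τ₁) (√τ₂)] σ ≤ 𝓝[I] σ := nhdsWithin_mono σ Ioo_subset_Icc_self
  have hsrc := source_mem_nhdsWithin (hγ.smooth σ hσ).continuousWithinAt hx₀
  have h1 : Tendsto (derivWithin (derivWithin (fun s => extChartAt (𝓡 n) x₀ (γ (s ^ 2))) I) I)
      (𝓝[Ioo (√τ₁) (√τ₂)] σ) (𝓝 _) :=
    ((hU.fderivWithin_right (m := ∞) hI (by simp) hσ).clm_apply
      (contDiffWithinAt_const (c := (1 : ℝ)))).continuousWithinAt.mono_left hmono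
  refine tendsto_nhds_unique h1 ?_
  have h2 : Tendsto (fun s => geodesicAccel (fun t => chartMetric (g t) x₀) (Icc τ₁ τ₂) s
      (chartPhase I x₀ (fun s => γ (s ^ 2)) s).1 (chartPhase I x₀ (fun s => γ (s ^ 2)) s).2)
      (𝓝[I] σ) (𝓝 (geodesicAccel (fun t => chartMetric (g t) x₀) (Icc τ₁ τ₂) σ
      (chartPhase I x₀ (fun s => γ (s ^ 2)) σ).1 (chartPhase I x₀ (fun s => γ (s ^ 2)) σ).2)) := by
    have hO : ContDiffOn ℝ ∞ (fun s => geodesicAccel (fun t => chartMetric (g t) x₀) (Icc τ₁ τ₂) s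
        (chartPhase I x₀ (fun s => γ (s ^ 2)) s).1 (chartPhase I x₀ (fun s => γ (s ^ 2)) s).2)
        (I ∩ {s | γ (s ^ 2) ∈ (extChartAt (𝓡 n) x₀).source}) := by
      refine hG.contDiffOn_geodesicAccel contDiffOn_id (fun s hs => ?_) (fun s hs => ?_)
        (fun s hs => sq_mem_Icc hτ₁ hτ hs.1) (fun s hs => (extChartAt (𝓡 n) x₀).map_source hs.2)
      · exact (contDiffWithinAt_chart hγ.smooth hs.1 hs.2).mono inter_subset_left
      · exact (contDiffWithinAt_derivWithin_chart hI hγ.smooth hs.1 hs.2).mono inter_subset_left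
    have h3 := (hO σ ⟨hσ, hx₀⟩).continuousWithinAt
    rwa [ContinuousWithinAt, inter_comm, nhdsWithin_inter_of_mem hsrc] at h3
  refine (h2.mono_left hmono).congr' ?_
  filter_upwards [hmono hsrc, self_mem_nhdsWithin] with s hs hs'
  exact (hγ.deriv_phase_interior hτ₁ hτ hg hs' hs).symm

end ChartPhase

/-! ### Differentiable dependence of solutions of an ODE on a parameter -/

section ODE

variable {Z : Type*} [NormedAddCommGroup Z] [NormedSpace ℝ Z] {Φ : ℝ → Z → Z} {a b : ℝ}

open scoped NNReal

theorem HasDerivWithinAt.Ici_of_Icc {f : ℝ → Z} {f' : Z} {t : ℝ}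
    (h : HasDerivWithinAt f f' (Icc a b) t) (ht : t ∈ Ico a b) :
    HasDerivWithinAt f f' (Ici t) t :=
  h.mono_of_mem_nhdsWithin
    (mem_of_superset (Icc_mem_nhdsGE ht.2) (Icc_subset_Icc_left ht.1))

/-- A solution of an ODE that starts close to `z₀` stays close to `z₀`, also if it is only known
to solve the ODE while it is `good`. -/
theorem forall_good_and_dist_le {y z₀ : ℝ → Z} {good : ℝ → Prop} {ε r : ℝ} {L : ℝ≥0}
    (hab : a ≤ b) (hlip : ∀ t ∈ Icc a b, LipschitzOnWith L (Φ t) (Metric.ball (z₀ t) ε))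
    (hz₀ : ∀ t ∈ Icc a b, HasDerivWithinAt z₀ (Φ t (z₀ t)) (Icc a b) t)
    (hy : ∀ t ∈ Icc a b, good t → HasDerivWithinAt y (Φ t (y t)) (Icc a b) t)
    (hopen : ∀ t ∈ Icc a b, good t → ∀ᶠ ρ in 𝓝[Icc a b] t, good ρ)
    (hclosed : ∀ σ ∈ Ioc a b, (∀ ρ ∈ Ico a σ, good ρ ∧ dist (y ρ) (z₀ ρ) ≤ r) → good σ)
    (ha : good a) (hr : dist (y a) (z₀ a) * Real.exp (L * (b - a)) ≤ r) (hrε : r < ε) :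
    ∀ t ∈ Icc a b, good t ∧ dist (y t) (z₀ t) ≤ r := by
  have hcont₀ : ContinuousOn z₀ (Icc a b) := fun t ht => (hz₀ t ht).continuousWithinAt
  have ha' : dist (y a) (z₀ a) ≤ r := by
    refine le_trans ?_ hr
    refine le_mul_of_one_le_right dist_nonneg (Real.one_le_exp ?_)
    have := sub_nonneg.2 hab
    positivity
  have hε : 0 < ε := lt_of_le_of_lt (dist_nonneg.trans ha') hrε
  -- Grönwall improves the open condition dist < ε to the closed condition dist ≤ r.
  have key : ∀ c ∈ Icc a b, (∀ ρ ∈ Icc a c, good ρ ∧ dist (y ρ) (z₀ ρ) < ε) →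
      ∀ ρ ∈ Icc a c, good ρ ∧ dist (y ρ) (z₀ ρ) ≤ r := by
    intro c hc h ρ hρ
    refine ⟨(h ρ hρ).1, ?_⟩
    have hsub : Icc a c ⊆ Icc a b := Icc_subset_Icc_right hc.2
    have hsub' : Ico a c ⊆ Icc a c := Ico_subset_Icc_self
    have h1 := dist_le_of_trajectories_ODE_of_mem (v := Φ) (K := L)
      (s := fun t => Metric.ball (z₀ t) ε) (f := y) (g := z₀) (a := a) (b := c)
      (fun t ht => hlip t (hsub (hsub' ht)))
      (fun t ht => ((hy t (hsub ht) (h t ht).1).continuousWithinAt).mono hsub)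
      (fun t ht => HasDerivWithinAt.Ici_of_Icc
        ((hy t (hsub (hsub' ht)) (h t (hsub' ht)).1).mono hsub) ht)
      (fun t ht => (h t (hsub' ht)).2) (hcont₀.mono hsub)
      (fun t ht => HasDerivWithinAt.Ici_of_Icc ((hz₀ t (hsub (hsub' ht))).mono hsub) ht)
      (fun t ht => Metric.mem_ball_self hε) le_rfl ρ hρ
    refine h1.trans (le_trans ?_ hr)
    gcongr
    exact hρ.2.trans hc.2
  -- Continuous induction: the set of times up to which the conclusion holds is closed by `hclosed`
  -- and continuity, and it can be prolonged by `hopen` and the gap between r and ε, after which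
  -- `key` restores the bound r.
  have main : Icc a b ⊆ {σ | ∀ ρ ∈ Icc a σ, good ρ ∧ dist (y ρ) (z₀ ρ) ≤ r} := by
    refine IsClosed.Icc_subset_of_forall_exists_gt ?_ ?_ ?_
    · refine isClosed_of_closure_subset fun σ hσ => ?_
      have hσI : σ ∈ Icc a b := isClosed_Icc.closure_subset_iff.2 inter_subset_right hσ
      refine ⟨?_, hσI⟩
      have hlt : ∀ ρ ∈ Ico a σ, good ρ ∧ dist (y ρ) (z₀ ρ) ≤ r := by
        intro ρ hρ
        obtain ⟨σ', hσ', hd⟩ := mem_closure_iff.1 hσ (Ioi ρ) isOpen_Ioi hρ.2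
        exact hd.1 ρ ⟨hρ.1, le_of_lt hσ'⟩
      intro ρ hρ
      rcases lt_or_eq_of_le hρ.2 with h | rfl
      · exact hlt ρ ⟨hρ.1, h⟩
      rcases eq_or_lt_of_le hρ.1 with rfl | h
      · exact ⟨ha, ha'⟩
      have hgood := hclosed ρ ⟨h, hσI.2⟩ hlt
      refine ⟨hgood, ?_⟩
      have hc : ContinuousWithinAt (fun t => dist (y t) (z₀ t)) (Ico a ρ) ρ :=
        ContinuousWithinAt.mono (t := Icc a b)
          ((hy ρ hσI hgood).continuousWithinAt.dist (hcont₀ ρ hσI))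
          fun t ht => ⟨ht.1, ht.2.le.trans hσI.2⟩
      refine hc.closure_le ?_ continuousWithinAt_const fun t ht => (hlt t ht).2
      rw [closure_Ico h.ne]
      exact hρ
    · intro ρ hρ
      have : ρ = a := le_antisymm hρ.2 hρ.1
      rw [this]
      exact ⟨ha, ha'⟩
    · intro x hx y' hy'
      have hxI : x ∈ Icc a b := Ico_subset_Icc_self hx.2
      have hgx := hx.1 x ⟨hxI.1, le_rfl⟩
      have hev : ∀ᶠ ρ in 𝓝[Icc a b] x, good ρ ∧ dist (y ρ) (z₀ ρ) < ε :=
        (hopen x hxI hgx.1).and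
          (((hy x hxI hgx.1).continuousWithinAt.dist (hcont₀ x hxI)).eventually
            (gt_mem_nhds (hgx.2.trans_lt hrε)))
      have hev2 : ∀ᶠ ρ in 𝓝[≥] x, good ρ ∧ dist (y ρ) (z₀ ρ) < ε :=
        hev.filter_mono (nhdsWithin_le_of_mem
          (mem_of_superset (Icc_mem_nhdsGE hx.2.2) (Icc_subset_Icc_left hxI.1)))
      obtain ⟨u, hu, hu'⟩ := (mem_nhdsGE_iff_exists_Icc_subset).1 hev2
      refine ⟨min (min u y') b, ?_, ?_, (min_le_left _ _).trans (min_le_right _ _)⟩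
      · refine key _ ⟨hxI.1.trans ?_, min_le_right _ _⟩ fun ρ hρ => ?_
        · exact le_min (le_min (le_of_lt hu) (le_of_lt hy')) hxI.2
        · rcases le_or_gt ρ x with h | h
          · have := hx.1 ρ ⟨hρ.1, h⟩
            exact ⟨this.1, this.2.trans_lt hrε⟩
          · exact hu' ⟨h.le, hρ.2.trans ((min_le_left _ _).trans (min_le_left _ _))⟩
      · exact lt_min (lt_min hu hy') hx.2.2
  exact fun t ht => main ht t ⟨ht.1, le_rfl⟩

theorem exists_linear_ode [CompleteSpace Z] {A : ℝ → Z →L[ℝ] Z} (hab : a ≤ b)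
    (hA : ContinuousOn A (Icc a b)) {K : ℝ≥0} (hK : ∀ t ∈ Icc a b, ‖A t‖ ≤ K)
    (hsmall : K * (b - a) ≤ 1 / 2) (ζ : Z) :
    ∃ w : ℝ → Z, w a = ζ ∧ ∀ t ∈ Icc a b, HasDerivWithinAt w (A t (w t)) (Icc a b) t := by
  -- On the ball of radius ‖ζ‖ + 1 about ζ one has ‖x‖ ≤ 2‖ζ‖ + 1, so the field is bounded by K(2‖ζ‖
  -- + 1). As K(b - a) ≤ 1/2, the solution moves by at most ‖ζ‖ + 1/2 and cannot leave the ball.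
  have hP : IsPicardLindelof (fun t z => A t z) (tmin := a) (tmax := b) ⟨a, le_rfl, hab⟩ ζ
      (‖ζ‖₊ + 1) 0 (K * (2 * ‖ζ‖₊ + 1)) K := by
    refine ⟨fun t ht => ?_, fun x _ => hA.clm_apply continuousOn_const, fun t ht x hx => ?_, ?_⟩
    · exact ((A t).lipschitz.weaken (hK t ht)).lipschitzOnWith
    · have h1 : ‖x‖ ≤ 2 * ‖ζ‖ + 1 := by
        have := norm_le_norm_add_norm_sub' x ζ
        rw [mem_closedBall_iff_norm] at hx
        push_cast at hx
        linarith
      push_cast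
      exact ((A t).le_opNorm x).trans (mul_le_mul (hK t ht) h1 (norm_nonneg _) K.2)
    · push_cast
      rw [sub_self, sub_zero, max_eq_left (sub_nonneg.2 hab)]
      nlinarith [norm_nonneg ζ]
  exact hP.exists_eq_forall_mem_Icc_hasDerivWithinAt₀

theorem gronwallBound_le {δ K ε x : ℝ} (hK : 1 ≤ K) (hε : 0 ≤ ε) :
    gronwallBound δ K ε x ≤ (δ + ε) * Real.exp (K * x) := by
  have hK0 : 0 < K := by linarith
  rw [gronwallBound_of_K_ne_0 hK0.ne']
  have h2 : ε / K ≤ ε := div_le_self hε hK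
  have h3 := Real.exp_pos (K * x)
  have h4 : ε / K * (Real.exp (K * x) - 1) ≤ ε * Real.exp (K * x) := by
    have : 0 ≤ ε / K := by positivity
    nlinarith
  simp only
  linarith

/-- The curves z s are known to solve the equation only while they are `good`, which in the
application means inside the chart, and nothing is assumed about their dependence on s except at the
initial time. Grönwall is used twice: for z s - z 0, which keeps the curves in a compact tube and is
O(s), and for z s - z 0 - s w, which is o(s). -/
theorem hasDerivAt_ode_family [ProperSpace Z] {O : Set Z} (hO : IsOpen O) (hab : a ≤ b)
    {D : ℝ → Z → Z →L[ℝ] Z}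
    (hD : ∀ t ∈ Icc a b, ∀ z ∈ O, HasFDerivAt (Φ t) (D t z) z)
    (hDc : ContinuousOn (Function.uncurry D) (Icc a b ×ˢ O))
    {z : ℝ → ℝ → Z} {good : ℝ → ℝ → Prop}
    (hz₀O : ∀ t ∈ Icc a b, z 0 t ∈ O) (hgood₀ : ∀ t ∈ Icc a b, good 0 t)
    (hz : ∀ᶠ s in 𝓝 0, ∀ t ∈ Icc a b, good s t →
      HasDerivWithinAt (z s) (Φ t (z s t)) (Icc a b) t ∧ ∀ᶠ ρ in 𝓝[Icc a b] t, good s ρ)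
    (hclosed : ∀ C : Set Z, IsCompact C → C ⊆ O → ∀ᶠ s in 𝓝 0, ∀ σ ∈ Ioc a b,
      (∀ ρ ∈ Ico a σ, good s ρ ∧ z s ρ ∈ C) → good s σ)
    (ha : ∀ᶠ s in 𝓝 0, good s a) {ζ : Z} (hζ : HasDerivAt (fun s => z s a) ζ 0)
    {w : ℝ → Z} (hwa : w a = ζ)
    (hw : ∀ t ∈ Icc a b, HasDerivWithinAt w (D t (z 0 t) (w t)) (Icc a b) t) :
    (∀ᶠ s in 𝓝 0, ∀ t ∈ Icc a b, good s t) ∧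
      ∀ t ∈ Icc a b, HasDerivAt (fun s => z s t) (w t) 0 := by
  have haI : a ∈ Icc a b := ⟨le_rfl, hab⟩
  have hz₀ : ∀ t ∈ Icc a b, HasDerivWithinAt (z 0) (Φ t (z 0 t)) (Icc a b) t := fun t ht =>
    (hz.self_of_nhds t ht (hgood₀ t ht)).1
  have hcont₀ : ContinuousOn (z 0) (Icc a b) := fun t ht => (hz₀ t ht).continuousWithinAt
  obtain ⟨ε, hε, hεO⟩ := (isCompact_Icc.image_of_continuousOn hcont₀).exists_cthickening_subset_open
    hO (image_subset_iff.2 hz₀O)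
  set C := Metric.cthickening ε (z 0 '' Icc a b) with hC
  have hCc : IsCompact C := (isCompact_Icc.image_of_continuousOn hcont₀).cthickening
  have hball : ∀ t ∈ Icc a b, Metric.closedBall (z 0 t) ε ⊆ C := fun t ht =>
    Metric.closedBall_subset_cthickening (mem_image_of_mem _ ht) ε
  have hcomp : IsCompact (Icc a b ×ˢ C) := isCompact_Icc.prod hCc
  have hDC : ContinuousOn (Function.uncurry D) (Icc a b ×ˢ C) := hDc.mono (prod_mono_right hεO)
  obtain ⟨L₀, hL₀⟩ := hcomp.exists_bound_of_continuousOn hDC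
  -- The lower bound 1 makes the simplified estimate `gronwallBound_le` applicable.
  set L : ℝ≥0 := ⟨max L₀ 1, le_max_of_le_right zero_le_one⟩ with hLdef
  have hL1 : (1 : ℝ) ≤ L := le_max_right _ _
  have hL : ∀ t ∈ Icc a b, ∀ y ∈ C, ‖D t y‖ ≤ L := fun t ht y hy =>
    (hL₀ (t, y) ⟨ht, hy⟩).trans (le_max_left _ _)
  have hlip : ∀ t ∈ Icc a b, LipschitzOnWith L (Φ t) (Metric.ball (z 0 t) ε) := fun t ht =>
    (convex_ball _ _).lipschitzOnWith_of_nnnorm_hasFDerivWithin_le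
      (fun y hy => (hD t ht y (hεO (hball t ht (Metric.ball_subset_closedBall hy)))).hasFDerivWithinAt)
      fun y hy => hL t ht y (hball t ht (Metric.ball_subset_closedBall hy))
  set B := Real.exp (L * (b - a)) with hB
  have hB1 : 1 ≤ B := Real.one_le_exp (mul_nonneg L.2 (sub_nonneg.2 hab))
  have hta : Tendsto (fun s => dist (z s a) (z 0 a) * B) (𝓝 0) (𝓝 0) := by
    have := (hζ.continuousAt.tendsto.dist (tendsto_const_nhds (x := z 0 a))).mul_const B
    simpa using this
  have htube : ∀ᶠ s in 𝓝 0, ∀ t ∈ Icc a b,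
      good s t ∧ dist (z s t) (z 0 t) ≤ dist (z s a) (z 0 a) * B := by
    filter_upwards [hz, hclosed C hCc hεO, ha, hta.eventually (gt_mem_nhds hε)] with s h1 h2 h3 h4
    refine forall_good_and_dist_le hab hlip hz₀ (fun t ht hg => (h1 t ht hg).1)
      (fun t ht hg => (h1 t ht hg).2) (fun σ hσ h => h2 σ hσ fun ρ hρ => ⟨(h ρ hρ).1, ?_⟩) h3 le_rfl h4
    exact hball ρ ⟨hρ.1, hρ.2.le.trans hσ.2⟩ (Metric.mem_closedBall.2 ((h ρ hρ).2.trans h4.le))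
  refine ⟨htube.mono fun s hs t ht => (hs t ht).1, fun t ht => ?_⟩
  rw [hasDerivAt_iff_isLittleO, Asymptotics.isLittleO_iff]
  intro c hc
  obtain ⟨C₂, hC₂⟩ := hζ.differentiableAt.isBigO_sub.bound
  have hlit := (Asymptotics.isLittleO_iff.1 (hasDerivAt_iff_isLittleO.1 hζ))
    (show 0 < c / (2 * B) by positivity)
  -- Chosen so that η times the bound (|C₂| + 1) B |s| for z s - z 0 equals (c / (2B)) |s|. The
  -- initial error has the same bound, and Grönwall multiplies their sum by at most B, which gives c
  -- |s|.
  set η := c / (2 * B) / ((|C₂| + 1) * B) with hη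
  have hη0 : 0 < η := by positivity
  obtain ⟨ε', hε', hunif⟩ := Metric.uniformContinuousOn_iff.1
    (hcomp.uniformContinuousOn_of_continuous hDC) η hη0
  filter_upwards [hz, htube, hta.eventually (gt_mem_nhds (lt_min hε hε')), hlit, hC₂]
    with s h1 h2 h3 h4 h5
  have hdist : ∀ t ∈ Icc a b, dist (z s t) (z 0 t) < ε ∧ dist (z s t) (z 0 t) < ε' := fun t ht =>
    lt_min_iff.1 ((h2 t ht).2.trans_lt h3)
  have hdiff : ∀ t ∈ Icc a b, ‖z s t - z 0 t‖ ≤ (|C₂| + 1) * B * |s| := by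
    intro t ht
    rw [← dist_eq_norm]
    refine (h2 t ht).2.trans ?_
    rw [dist_eq_norm]
    simp only [sub_zero, Real.norm_eq_abs] at h5
    have : C₂ * |s| ≤ (|C₂| + 1) * |s| := by
      gcongr
      linarith [le_abs_self C₂]
    calc ‖z s a - z 0 a‖ * B ≤ ((|C₂| + 1) * |s|) * B := by gcongr; exact h5.trans this
      _ = _ := by ring
  -- The first order Taylor remainder of Φ, estimated by the mean value inequality and the uniform
  -- continuity of D on the tube.
  have hrem : ∀ t ∈ Icc a b, ‖Φ t (z s t) - Φ t (z 0 t) - D t (z 0 t) (z s t - z 0 t)‖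
      ≤ c / (2 * B) * |s| := by
    intro t ht
    have hr := (convex_ball (z 0 t) (min ε ε')).norm_image_sub_le_of_norm_hasFDerivWithin_le'
      (f := Φ t) (f' := D t) (φ := D t (z 0 t)) (C := η) (x := z 0 t) (y := z s t)
      (fun y hy => (hD t ht y (hεO (hball t ht (Metric.ball_subset_closedBall
        (Metric.ball_subset_ball (min_le_left _ _) hy))))).hasFDerivWithinAt)
      (fun y hy => by
        have hy1 := Metric.ball_subset_ball (min_le_left _ _) hy
        have hy2 := Metric.ball_subset_ball (min_le_right _ _) hy
        have := hunif (t, y) ⟨ht, hball t ht (Metric.ball_subset_closedBall hy1)⟩ (t, z 0 t)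
          ⟨ht, hball t ht (Metric.mem_closedBall_self hε.le)⟩ (by
            rw [Prod.dist_eq]; simpa [hε'] using hy2)
        rw [dist_eq_norm] at this
        exact this.le)
      (Metric.mem_ball_self (lt_min hε hε')) (lt_min (hdist t ht).1 (hdist t ht).2)
    refine hr.trans ?_
    calc η * ‖z s t - z 0 t‖ ≤ η * ((|C₂| + 1) * B * |s|) := by gcongr; exact hdiff t ht
      _ = _ := by rw [hη]; field_simp
  have hsub' : Ico a b ⊆ Icc a b := Ico_subset_Icc_self
  have hder : ∀ t ∈ Icc a b, HasDerivWithinAt (fun t => z s t - z 0 t - s • w t)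
      (Φ t (z s t) - Φ t (z 0 t) - s • D t (z 0 t) (w t)) (Icc a b) t := fun t ht =>
    ((h1 t ht (h2 t ht).1).1.sub (hz₀ t ht)).sub ((hw t ht).const_smul s)
  have hgr := norm_le_gronwallBound_of_norm_deriv_right_le (K := L) (ε := c / (2 * B) * |s|)
    (δ := c / (2 * B) * |s|)
    (fun t ht => (hder t ht).continuousWithinAt)
    (fun t ht => HasDerivWithinAt.Ici_of_Icc (hder t (hsub' ht)) ht)
    (by
      rw [hwa]
      simpa using h4)
    (fun t ht => by
      -- The error z s - z 0 - s w solves the linear equation up to the Taylor remainder.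
      have e : Φ t (z s t) - Φ t (z 0 t) - s • D t (z 0 t) (w t)
          = D t (z 0 t) (z s t - z 0 t - s • w t)
            + (Φ t (z s t) - Φ t (z 0 t) - D t (z 0 t) (z s t - z 0 t)) := by
        simp only [map_sub, map_smul]
        abel
      rw [e]
      refine (norm_add_le _ _).trans (add_le_add ?_ (hrem t (hsub' ht)))
      refine ((D t (z 0 t)).le_opNorm _).trans ?_
      gcongr
      exact hL t (hsub' ht) _ (hball t (hsub' ht) (Metric.mem_closedBall_self hε.le)))
    t ht
  have h6 := hgr.trans (gronwallBound_le hL1 (by positivity))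
  have h7 : Real.exp (L * (t - a)) ≤ B := Real.exp_le_exp.2 (by
    have := ht.2
    gcongr)
  simp only [sub_zero, Real.norm_eq_abs] at h6 ⊢
  refine h6.trans ?_
  calc (c / (2 * B) * |s| + c / (2 * B) * |s|) * Real.exp (L * (t - a))
      ≤ (c / (2 * B) * |s| + c / (2 * B) * |s|) * B := by gcongr
    _ = c * |s| := by field_simp; ring

end ODE

/-! ### Smoothness of the geodesic vector field on phase space -/

section PhaseField

variable {n : ℕ}

/-- The vector field on phase space of the `𝓛`-geodesic equation. -/
def geodesicField (G : ℝ → Mod n → Bil (Mod n)) (S : Set ℝ) (σ : ℝ) (z : Mod n × Mod n) :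
    Mod n × Mod n :=
  (z.2, geodesicAccel G S σ z.1 z.2)

variable {G : ℝ → Mod n → Bil (Mod n)} {S : Set ℝ} {T : Set (Mod n)} (hG : IsFlowOn G S T)
include hG

theorem IsFlowOn.contDiffOn_geodesicField {I : Set ℝ} (hI : MapsTo (fun σ => σ ^ 2) I S) :
    ContDiffOn ℝ ∞ (Function.uncurry (geodesicField G S)) (I ×ˢ (T ×ˢ univ)) := by
  have h1 : ContDiffOn ℝ ∞ (fun q : ℝ × (Mod n × Mod n) => q.2.1) (I ×ˢ (T ×ˢ univ)) :=
    (contDiff_fst.comp contDiff_snd).contDiffOn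
  have h2 : ContDiffOn ℝ ∞ (fun q : ℝ × (Mod n × Mod n) => q.2.2) (I ×ˢ (T ×ˢ univ)) :=
    (contDiff_snd.comp contDiff_snd).contDiffOn
  exact h2.prodMk (hG.contDiffOn_geodesicAccel (σ := fun q : ℝ × (Mod n × Mod n) => q.1)
    contDiffOn_fst h1 h2 (fun q hq => hI hq.1) fun q hq => hq.2.1)

theorem IsFlowOn.hasFDerivAt_geodesicField {σ : ℝ} (hσ : σ ^ 2 ∈ S) {z : Mod n × Mod n}
    (hz : z.1 ∈ T) :
    HasFDerivAt (geodesicField G S σ) (fderiv ℝ (geodesicField G S σ) z) z := by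
  have h := hG.contDiffOn_geodesicField (I := {σ}) (by intro s hs; rw [hs]; exact hσ)
  have h2 : ContDiffOn ℝ ∞ (geodesicField G S σ) (T ×ˢ univ) :=
    h.comp (f := fun z => (σ, z)) (contDiffOn_const.prodMk contDiffOn_id) fun z hz => ⟨rfl, hz⟩
  exact ((h2.contDiffAt ((hG.isOpen.prod isOpen_univ).mem_nhds ⟨hz, trivial⟩)).differentiableAt
    (by simp)).hasFDerivAt

theorem IsFlowOn.continuousOn_fderiv_geodesicField {I : Set ℝ}
    (hI : MapsTo (fun σ => σ ^ 2) I S) :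
    ContinuousOn (Function.uncurry fun σ z => fderiv ℝ (geodesicField G S σ) z)
      (I ×ˢ (T ×ˢ univ)) := by
  refine (contDiffOn_fderiv_param (P := ℝ × (Mod n × Mod n))
    (H := fun q => geodesicField G S q.1) (y := fun q => q.2) (hG.isOpen.prod isOpen_univ) ?_
    contDiffOn_snd fun q hq => hq.2).continuousOn
  exact (hG.contDiffOn_geodesicField hI).comp
    (f := fun q : (ℝ × (Mod n × Mod n)) × (Mod n × Mod n) => (q.1.1, q.2))
    (contDiff_fst.fst.prodMk contDiff_snd).contDiffOn fun q hq => ⟨hq.1.1, hq.2⟩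

end PhaseField

/-! ### One-parameter families of 𝓛-geodesics -/

section Families

variable {n : ℕ} {M : Type*} [TopologicalSpace M] [T2Space M] [ChartedSpace (Mod n) M]
  [IsManifold (𝓡 n) ∞ M]

/-- The family of curves `c s` is differentiable at `s = 0` together with the velocities at `σ`. -/
def PhaseDifferentiableAt (n : ℕ) {M : Type*} [TopologicalSpace M] [ChartedSpace (Mod n) M]
    (I : Set ℝ) (c : ℝ → ℝ → M) (σ : ℝ) : Prop :=
  ContinuousAt (fun s => c s σ) 0 ∧ ∀ x₀, c 0 σ ∈ (extChartAt (𝓡 n) x₀).source →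
    DifferentiableAt ℝ (fun s => chartPhase (n := n) I x₀ (c s) σ) 0

/-- Differentiability of position and velocity may be checked in one chart, since the phase
transforms by the coordinate change and its differential, both of which are smooth. -/
theorem phaseDifferentiableAt_of_chart {I : Set ℝ} (hI : UniqueDiffOn ℝ I) {c : ℝ → ℝ → M}
    (hc : ∀ᶠ s in 𝓝 0, ContMDiffOn 𝓘(ℝ, ℝ) (𝓡 n) ∞ (c s) I) {σ : ℝ} (hσ : σ ∈ I) {x₀ : M}
    (hsrc : ∀ᶠ s in 𝓝 0, c s σ ∈ (extChartAt (𝓡 n) x₀).source)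
    (hd : DifferentiableAt ℝ (fun s => chartPhase (n := n) I x₀ (c s) σ) 0) :
    PhaseDifferentiableAt n I c σ := by
  have hx₀ := hsrc.self_of_nhds
  have hcont : ContinuousAt (fun s => c s σ) 0 := by
    have h1 : ContinuousAt (fun s => extChartAt (𝓡 n) x₀ (c s σ)) 0 := hd.continuousAt.fst
    have h2 := ContinuousAt.comp (f := fun s => extChartAt (𝓡 n) x₀ (c s σ))
      (g := (extChartAt (𝓡 n) x₀).symm) (continuousAt_extChartAt_symm' hx₀) h1
    refine h2.congr ?_
    filter_upwards [hsrc] with s hs using (extChartAt (𝓡 n) x₀).left_inv hs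
  refine ⟨hcont, fun x hx => ?_⟩
  have hmem : (chartPhase (n := n) I x₀ (c 0) σ).1 ∈ chartOverlap x₀ x := mem_chartOverlap hx₀ hx
  have hψ := (contDiffOn_chartChange x₀ x).contDiffAt ((isOpen_chartOverlap x₀ x).mem_nhds hmem)
  have h1 : DifferentiableAt ℝ (fun s => (chartPhase (n := n) I x₀ (c s) σ).1) 0 := hd.fst
  have h2 := (hψ.differentiableAt (by simp)).comp (0 : ℝ) h1
  have h3 := (((hψ.fderiv_right (m := 1) one_add_one_le_infty).differentiableAt
    (by simp)).comp (0 : ℝ) h1).clm_apply hd.snd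
  refine (h2.prodMk h3).congr_of_eventuallyEq ?_
  filter_upwards [hc, hsrc, hcont.preimage_mem_nhds ((isOpen_extChartAt_source x).mem_nhds hx)]
    with s h4 h5 h6
  exact chartPhase_chartChange hI h4 hσ h5 h6

variable {g : ℝ → Metric n M} {τ₁ τ₂ : ℝ} {Γ : ℝ → ℝ → M}

/-- The linearization of the `𝓛`-geodesic equation in the chart at `x₀`. -/
def jacobiField (g : ℝ → Metric n M) (τ₁ τ₂ : ℝ) (x₀ : M) (γ : ℝ → M) (σ : ℝ) :
    Mod n × Mod n →L[ℝ] Mod n × Mod n :=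
  fderiv ℝ (geodesicField (fun t => chartMetric (g t) x₀) (Icc τ₁ τ₂) σ)
    (chartPhase (Icc (√τ₁) (√τ₂)) x₀ (fun s => γ (s ^ 2)) σ)

theorem continuousWithinAt_jacobiField (hτ₁ : 0 ≤ τ₁) (hτ : τ₁ < τ₂)
    (hg : IsBackwardRicciFlow g τ₁ τ₂) {γ : ℝ → M} (hγ : IsLGeodesic g τ₁ τ₂ γ) {σ : ℝ}
    (hσ : σ ∈ Icc (√τ₁) (√τ₂)) {x₀ : M} (hx₀ : γ (σ ^ 2) ∈ (extChartAt (𝓡 n) x₀).source) :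
    ContinuousWithinAt (jacobiField g τ₁ τ₂ x₀ γ) (Icc (√τ₁) (√τ₂)) σ := by
  have hG := isFlowOn_chartMetric hτ hg x₀
  have h1 := hG.continuousOn_fderiv_geodesicField (I := Icc (√τ₁) (√τ₂))
    fun s hs => sq_mem_Icc hτ₁ hτ hs
  have hsrc := source_mem_nhdsWithin (hγ.smooth σ hσ).continuousWithinAt hx₀
  have h2 := (contDiffWithinAt_chartPhase (x₀ := x₀) (uniqueDiffOn_sqrt hτ₁ hτ) hγ.smooth hσ
    hx₀).continuousWithinAt
  have h3 : ContinuousWithinAt (jacobiField g τ₁ τ₂ x₀ γ)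
      (Icc (√τ₁) (√τ₂) ∩ {s | γ (s ^ 2) ∈ (extChartAt (𝓡 n) x₀).source}) σ := by
    refine ContinuousWithinAt.comp (f := fun s => (s, chartPhase (n := n) (Icc (√τ₁) (√τ₂)) x₀
      (fun s => γ (s ^ 2)) s)) (h1 (_, _) ⟨hσ, ?_, trivial⟩)
      (continuousWithinAt_id.prodMk (h2.mono inter_subset_left)) ?_
    · exact (extChartAt (𝓡 n) x₀).map_source hx₀
    · exact fun s hs => ⟨hs.1, (extChartAt (𝓡 n) x₀).map_source hs.2, trivial⟩
  rwa [ContinuousWithinAt, inter_comm, nhdsWithin_inter_of_mem hsrc] at h3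

/-- Differentiability of a family of `𝓛`-geodesics propagates within a chart. -/
theorem propagate_in_chart (hτ₁ : 0 ≤ τ₁) (hτ : τ₁ < τ₂) (hg : IsBackwardRicciFlow g τ₁ τ₂)
    (hΓ : ∀ᶠ s in 𝓝 0, IsLGeodesic g τ₁ τ₂ (Γ s)) {σ₀ : ℝ} (hσ₀ : σ₀ ∈ Icc (√τ₁) (√τ₂)) {x₀ : M}
    (hx₀ : Γ 0 (σ₀ ^ 2) ∈ (extChartAt (𝓡 n) x₀).source) :
    ∃ δ > 0, ∀ a ∈ Icc (√τ₁) (√τ₂), ∀ b ∈ Icc (√τ₁) (√τ₂), a ≤ b → σ₀ - δ ≤ a → b ≤ σ₀ + δ →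
      PhaseDifferentiableAt n (Icc (√τ₁) (√τ₂)) (fun s σ => Γ s (σ ^ 2)) a →
      (∀ t ∈ Icc a b, PhaseDifferentiableAt n (Icc (√τ₁) (√τ₂)) (fun s σ => Γ s (σ ^ 2)) t) ∧
      ∃ w : ℝ → Mod n × Mod n, ∀ t ∈ Icc a b,
        HasDerivAt (fun s => chartPhase (n := n) (Icc (√τ₁) (√τ₂)) x₀ (fun σ => Γ s (σ ^ 2)) t)
          (w t) 0 ∧
        HasDerivWithinAt w (jacobiField g τ₁ τ₂ x₀ (Γ 0) t (w t)) (Icc a b) t := by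
  have hI := uniqueDiffOn_sqrt hτ₁ hτ
  have hG := isFlowOn_chartMetric hτ hg x₀
  have hγ := hΓ.self_of_nhds
  have hjc := continuousWithinAt_jacobiField hτ₁ hτ hg hγ hσ₀ hx₀
  set K : NNReal := ⟨‖jacobiField g τ₁ τ₂ x₀ (Γ 0) σ₀‖ + 1, by positivity⟩ with hK
  have hev : ∀ᶠ t in 𝓝[Icc (√τ₁) (√τ₂)] σ₀, Γ 0 (t ^ 2) ∈ (extChartAt (𝓡 n) x₀).source ∧
      ‖jacobiField g τ₁ τ₂ x₀ (Γ 0) t‖ ≤ K := by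
    refine Filter.Eventually.and
      (source_mem_nhdsWithin (hγ.smooth σ₀ hσ₀).continuousWithinAt hx₀) ?_
    have h := hjc.norm.eventually (gt_mem_nhds (lt_add_one _))
    exact h.mono fun t ht => le_of_lt ht
  obtain ⟨δ₀, hδ₀, hball⟩ := Metric.mem_nhdsWithin_iff.1 hev
  have hKpos : (0 : ℝ) < K := by
    show 0 < ‖_‖ + 1
    positivity
  -- The first bound keeps Γ 0 in the chart and the linearization bounded by K. The second gives K(b
  -- - a) ≤ 2Kδ ≤ 1/2, as the local existence theorem for linear equations requires.
  set δ := min (δ₀ / 2) (1 / (4 * K)) with hδ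
  have hδpos : 0 < δ := by positivity
  refine ⟨δ, hδpos, fun a ha b hb hab haδ hbδ hP => ?_⟩
  have hsub : Icc a b ⊆ Icc (√τ₁) (√τ₂) := Icc_subset_Icc ha.1 hb.2
  have hnear : ∀ t ∈ Icc a b, Γ 0 (t ^ 2) ∈ (extChartAt (𝓡 n) x₀).source ∧
      ‖jacobiField g τ₁ τ₂ x₀ (Γ 0) t‖ ≤ K := by
    intro t ht
    refine hball ⟨?_, hsub ht⟩
    rw [Metric.mem_ball, Real.dist_eq, abs_lt]
    have : δ ≤ δ₀ / 2 := min_le_left _ _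
    constructor <;> linarith [ht.1, ht.2]
  have hAc : ContinuousOn (jacobiField g τ₁ τ₂ x₀ (Γ 0)) (Icc a b) := fun t ht =>
    (continuousWithinAt_jacobiField hτ₁ hτ hg hγ (hsub ht) (hnear t ht).1).mono hsub
  have hsmall : K * (b - a) ≤ 1 / 2 := by
    have h1 : b - a ≤ 2 * (1 / (4 * K)) := by
      have : δ ≤ 1 / (4 * K) := min_le_right _ _
      linarith
    calc (K : ℝ) * (b - a) ≤ K * (2 * (1 / (4 * K))) := by gcongr
      _ = 1 / 2 := by field_simp; norm_num
  have hd := (hP.2 x₀ (hnear a ⟨le_rfl, hab⟩).1).hasDerivAt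
  obtain ⟨w, hwa, hw⟩ := exists_linear_ode hab hAc (fun t ht => (hnear t ht).2) hsmall
    (deriv (fun s => chartPhase (n := n) (Icc (√τ₁) (√τ₂)) x₀ (fun σ => Γ s (σ ^ 2)) a) 0)
  have main := hasDerivAt_ode_family (O := (extChartAt (𝓡 n) x₀).target ×ˢ (univ : Set (Mod n)))
    (Φ := geodesicField (fun t => chartMetric (g t) x₀) (Icc τ₁ τ₂))
    (D := fun σ z => fderiv ℝ (geodesicField (fun t => chartMetric (g t) x₀) (Icc τ₁ τ₂) σ) z)
    (z := fun s t => chartPhase (n := n) (Icc (√τ₁) (√τ₂)) x₀ (fun σ => Γ s (σ ^ 2)) t)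
    (good := fun s t => Γ s (t ^ 2) ∈ (extChartAt (𝓡 n) x₀).source)
    (hG.isOpen.prod isOpen_univ) hab
    (fun t ht z hz => hG.hasFDerivAt_geodesicField (sq_mem_Icc hτ₁ hτ (hsub ht)) hz.1)
    (hG.continuousOn_fderiv_geodesicField fun t ht => sq_mem_Icc hτ₁ hτ (hsub ht))
    (fun t ht => ⟨(extChartAt (𝓡 n) x₀).map_source (hnear t ht).1, trivial⟩)
    (fun t ht => (hnear t ht).1)
    (hΓ.mono fun s hs t ht hgood =>
      ⟨(hs.hasDerivWithinAt_chartPhase hτ₁ hτ hg (hsub ht) hgood).mono hsub,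
        nhdsWithin_mono t hsub
          (source_mem_nhdsWithin (hs.smooth t (hsub ht)).continuousWithinAt hgood)⟩)
    (by
      intro C hC hCO
      filter_upwards [hΓ] with s hs σ hσ h
      -- While the phase lies in C, the curve lies in the compact image of the positions of C under
      -- the inverse chart. In a Hausdorff space this image is closed, so the limit at σ is still in
      -- the domain of the chart.
      have hC1 : IsCompact (Prod.fst '' C) := hC.image continuous_fst
      have hC1T : Prod.fst '' C ⊆ (extChartAt (𝓡 n) x₀).target := by
        rintro _ ⟨z, hz, rfl⟩
        exact (hCO hz).1
      have hK := (hC1.image_of_continuousOn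
        ((continuousOn_extChartAt_symm x₀).mono hC1T)).isClosed
      have hσI : σ ∈ Icc a b := Ioc_subset_Icc_self hσ
      have hcont : ContinuousWithinAt (fun t => Γ s (t ^ 2)) (Ico a σ) σ :=
        (hs.smooth σ (hsub hσI)).continuousWithinAt.mono
          fun t ht => hsub ⟨ht.1, ht.2.le.trans hσ.2⟩
      have hcl : σ ∈ closure (Ico a σ) := by
        rw [closure_Ico hσ.1.ne]
        exact ⟨hσ.1.le, le_rfl⟩
      have := hcont.mem_closure hcl (t := (extChartAt (𝓡 n) x₀).symm '' (Prod.fst '' C))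
        fun t ht => ⟨_, ⟨_, (h t ht).2, rfl⟩, (extChartAt (𝓡 n) x₀).left_inv (h t ht).1⟩
      rw [hK.closure_eq] at this
      obtain ⟨y, hy, hy'⟩ := this
      rw [← hy']
      exact (extChartAt (𝓡 n) x₀).map_target (hC1T hy))
    (hP.1.preimage_mem_nhds ((isOpen_extChartAt_source x₀).mem_nhds (hnear a ⟨le_rfl, hab⟩).1))
    hd hwa hw
  refine ⟨fun t ht => ?_, w, fun t ht => ⟨main.2 t ht, hw t ht⟩⟩
  exact phaseDifferentiableAt_of_chart hI (hΓ.mono fun s hs => hs.smooth) (hsub ht)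
    (main.1.mono fun s hs => hs t ht) (main.2 t ht).differentiableAt

/-- Continuous induction along the compact interval, each step taking place in the chart around the
current point. -/
theorem phaseDifferentiableAt_of_start (hτ₁ : 0 ≤ τ₁) (hτ : τ₁ < τ₂)
    (hg : IsBackwardRicciFlow g τ₁ τ₂) (hΓ : ∀ᶠ s in 𝓝 0, IsLGeodesic g τ₁ τ₂ (Γ s))
    (hP : PhaseDifferentiableAt n (Icc (√τ₁) (√τ₂)) (fun s σ => Γ s (σ ^ 2)) (√τ₁)) :
    ∀ σ ∈ Icc (√τ₁) (√τ₂),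
      PhaseDifferentiableAt n (Icc (√τ₁) (√τ₂)) (fun s σ => Γ s (σ ^ 2)) σ := by
  have hlt := Real.sqrt_lt_sqrt hτ₁ hτ
  suffices h : Icc (√τ₁) (√τ₂) ⊆ {σ | ∀ ρ ∈ Icc (√τ₁) σ,
      PhaseDifferentiableAt n (Icc (√τ₁) (√τ₂)) (fun s σ => Γ s (σ ^ 2)) ρ} from
    fun σ hσ => h hσ σ ⟨hσ.1, le_rfl⟩
  have hloc := fun σ hσ => propagate_in_chart hτ₁ hτ hg hΓ (σ₀ := σ) hσ
    (mem_extChartAt_source (I := 𝓡 n) (Γ 0 (σ ^ 2)))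
  refine IsClosed.Icc_subset_of_forall_exists_gt ?_ ?_ ?_
  · refine isClosed_of_closure_subset fun σ hσ => ?_
    have hσI : σ ∈ Icc (√τ₁) (√τ₂) := isClosed_Icc.closure_subset_iff.2 inter_subset_right hσ
    refine ⟨fun ρ hρ => ?_, hσI⟩
    rcases lt_or_eq_of_le hρ.2 with h | rfl
    · obtain ⟨σ', hσ', hd⟩ := mem_closure_iff.1 hσ (Ioi ρ) isOpen_Ioi h
      exact hd.1 ρ ⟨hρ.1, le_of_lt hσ'⟩
    rcases eq_or_lt_of_le hρ.1 with h | h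
    · rwa [← h]
    obtain ⟨δ, hδ, hprop⟩ := hloc ρ hσI
    have hmax : max (√τ₁) (ρ - δ) < ρ := max_lt h (by linarith)
    obtain ⟨σ', hσ', hd⟩ := mem_closure_iff.1 hσ (Ioi (max (√τ₁) (ρ - δ))) isOpen_Ioi hmax
    exact (hprop (max (√τ₁) (ρ - δ)) ⟨le_max_left _ _, hmax.le.trans hσI.2⟩ ρ hσI hmax.le
      (le_max_right _ _) (by linarith) (hd.1 _ ⟨le_max_left _ _, le_of_lt hσ'⟩)).1 ρ
        ⟨hmax.le, le_rfl⟩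
  · intro ρ hρ
    rwa [le_antisymm hρ.2 hρ.1]
  · intro x hx y hy
    have hxI : x ∈ Icc (√τ₁) (√τ₂) := Ico_subset_Icc_self hx.2
    obtain ⟨δ, hδ, hprop⟩ := hloc x hxI
    have hxb : x < min (min (x + δ) y) (√τ₂) := lt_min (lt_min (by linarith) hy) hx.2.2
    refine ⟨min (min (x + δ) y) (√τ₂), fun ρ hρ => ?_, hxb,
      (min_le_left _ _).trans (min_le_right _ _)⟩
    rcases le_or_gt ρ x with h | h
    · exact hx.1 ρ ⟨hρ.1, h⟩
    · exact (hprop x hxI _ ⟨hxI.1.trans hxb.le, min_le_right _ _⟩ hxb.le (by linarith)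
        ((min_le_left _ _).trans (min_le_left _ _)) (hx.1 x ⟨hxI.1, le_rfl⟩)).1 ρ ⟨h.le, hρ.2⟩

end Families

/-! ### The linearized equation and the uniqueness of 𝓛-geodesics -/

section JacobiFields

variable {n : ℕ} {M : Type*} [TopologicalSpace M] [T2Space M] [ChartedSpace (Mod n) M]
  [IsManifold (𝓡 n) ∞ M]

/-- The components of the field `V` along `γ` in the chart at `x₀`, in terms of `σ = √τ`. -/
def chartField (x₀ : M) (γ : ℝ → M) (V : ∀ τ, TangentSpace (𝓡 n) (γ τ)) (σ : ℝ) : Mod n :=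
  chartVector x₀ (γ (σ ^ 2)) (V (σ ^ 2))

/-- The components of `V` and their derivatives in the chart at `x₀`. -/
def chartJet (I : Set ℝ) (x₀ : M) (γ : ℝ → M) (V : ∀ τ, TangentSpace (𝓡 n) (γ τ)) (σ : ℝ) :
    Mod n × Mod n :=
  (chartField x₀ γ V σ, derivWithin (chartField x₀ γ V) I σ)

/-- `V` satisfies the linearized `𝓛`-geodesic equation along `γ`. -/
def IsJacobi (g : ℝ → Metric n M) (τ₁ τ₂ : ℝ) (γ : ℝ → M) (V : ∀ τ, TangentSpace (𝓡 n) (γ τ)) :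
    Prop :=
  ∀ σ ∈ Icc (√τ₁) (√τ₂), ∀ x₀ : M, γ (σ ^ 2) ∈ (extChartAt (𝓡 n) x₀).source →
    HasDerivWithinAt (chartJet (Icc (√τ₁) (√τ₂)) x₀ γ V)
      (jacobiField g τ₁ τ₂ x₀ γ σ (chartJet (Icc (√τ₁) (√τ₂)) x₀ γ V σ)) (Icc (√τ₁) (√τ₂)) σ

variable {g : ℝ → Metric n M} {τ₁ τ₂ : ℝ} {Γ : ℝ → ℝ → M} {γ : ℝ → M}

/-- The first component of the geodesic field is u itself, so the linearized system says that the
second component of a solution is the derivative of the first. -/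
theorem jacobiField_fst (hτ₁ : 0 ≤ τ₁) (hτ : τ₁ < τ₂) (hg : IsBackwardRicciFlow g τ₁ τ₂) {σ : ℝ}
    (hσ : σ ∈ Icc (√τ₁) (√τ₂)) {x₀ : M} (hx₀ : γ (σ ^ 2) ∈ (extChartAt (𝓡 n) x₀).source)
    (z : Mod n × Mod n) : (jacobiField g τ₁ τ₂ x₀ γ σ z).1 = z.2 := by
  have h := ((isFlowOn_chartMetric hτ hg x₀).hasFDerivAt_geodesicField (sq_mem_Icc hτ₁ hτ hσ)
    (z := chartPhase (Icc (√τ₁) (√τ₂)) x₀ (fun s => γ (s ^ 2)) σ)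
    ((extChartAt (𝓡 n) x₀).map_source hx₀)).fst
  have h2 : HasFDerivAt (fun z : Mod n × Mod n => z.2) (ContinuousLinearMap.snd ℝ (Mod n) (Mod n))
    (chartPhase (Icc (√τ₁) (√τ₂)) x₀ (fun s => γ (s ^ 2)) σ) := hasFDerivAt_snd
  exact congrArg (fun L : Mod n × Mod n →L[ℝ] Mod n => L z) (h.unique h2)

/-- The variation field of a family of `𝓛`-geodesics satisfies the linearized equation. -/
theorem isJacobi_of_family (hτ₁ : 0 ≤ τ₁) (hτ : τ₁ < τ₂) (hg : IsBackwardRicciFlow g τ₁ τ₂)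
    (hΓ : ∀ᶠ s in 𝓝 0, IsLGeodesic g τ₁ τ₂ (Γ s)) (h0 : Γ 0 = γ)
    (hP : PhaseDifferentiableAt n (Icc (√τ₁) (√τ₂)) (fun s σ => Γ s (σ ^ 2)) (√τ₁))
    {V : ∀ τ, TangentSpace (𝓡 n) (γ τ)}
    (hV : ∀ σ ∈ Icc (√τ₁) (√τ₂), ∀ x₀ : M, γ (σ ^ 2) ∈ (extChartAt (𝓡 n) x₀).source →
      HasDerivAt (fun s => extChartAt (𝓡 n) x₀ (Γ s (σ ^ 2))) (chartField x₀ γ V σ) 0) :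
    IsJacobi g τ₁ τ₂ γ V ∧
    ∀ σ ∈ Icc (√τ₁) (√τ₂), ∀ x₀ : M, γ (σ ^ 2) ∈ (extChartAt (𝓡 n) x₀).source →
      HasDerivAt (fun s => chartPhase (n := n) (Icc (√τ₁) (√τ₂)) x₀ (fun σ => Γ s (σ ^ 2)) σ)
        (chartJet (Icc (√τ₁) (√τ₂)) x₀ γ V σ) 0 := by
  rw [IsJacobi, ← forall₂_and]
  intro σ hσ
  rw [← forall₂_and]
  intro x₀ hx₀
  have hlt := Real.sqrt_lt_sqrt hτ₁ hτ
  have hall := phaseDifferentiableAt_of_start hτ₁ hτ hg hΓ hP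
  obtain ⟨δ, hδ, hprop⟩ := propagate_in_chart hτ₁ hτ hg hΓ hσ (x₀ := x₀) (by rwa [h0])
  set I := Icc (√τ₁) (√τ₂) with hI
  set a := max (√τ₁) (σ - δ)
  set b := min (√τ₂) (σ + δ)
  have hγ : IsLGeodesic g τ₁ τ₂ γ := h0 ▸ hΓ.self_of_nhds
  have haσ : a ≤ σ := max_le hσ.1 (by linarith)
  have hσb : σ ≤ b := le_min hσ.2 (by linarith)
  have haI : a ∈ I := ⟨le_max_left _ _, haσ.trans hσ.2⟩
  have hbI : b ∈ I := ⟨hσ.1.trans hσb, min_le_left _ _⟩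
  obtain ⟨-, w, hw⟩ := hprop a haI b hbI (haσ.trans hσb) (le_max_right _ _) (min_le_right _ _)
    (hall a haI)
  rw [h0] at hw
  have hab : ∀ t ∈ I, t ∈ Ioo (σ - δ) (σ + δ) → t ∈ Icc a b ∧ Icc a b ∈ 𝓝[I] t := by
    intro t ht ht'
    have h1 : I ∩ Ioo (σ - δ) (σ + δ) ⊆ Icc a b := fun r hr =>
      ⟨max_le hr.1.1 hr.2.1.le, le_min hr.1.2 hr.2.2.le⟩
    exact ⟨h1 ⟨ht, ht'⟩, mem_of_superset
      (inter_mem_nhdsWithin _ (Ioo_mem_nhds ht'.1 ht'.2)) h1⟩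
  have hev : ∀ᶠ t in 𝓝[I] σ, t ∈ I ∧ t ∈ Ioo (σ - δ) (σ + δ) ∧
      γ (t ^ 2) ∈ (extChartAt (𝓡 n) x₀).source :=
    Filter.Eventually.and self_mem_nhdsWithin (Filter.Eventually.and
      (mem_nhdsWithin_of_mem_nhds (Ioo_mem_nhds (by linarith) (by linarith)))
      (source_mem_nhdsWithin (hγ.smooth σ hσ).continuousWithinAt hx₀))
  -- The solution w of the linear system and the variation field are both s-derivatives of the
  -- position, hence agree. Differentiating in t identifies the velocity parts as well.
  have hfst : ∀ᶠ t in 𝓝[I] σ, chartField x₀ γ V t = (w t).1 := by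
    filter_upwards [hev] with t ht
    exact (hV t ht.1 x₀ ht.2.2).unique (hw t (hab t ht.1 ht.2.1).1).1.fst
  have hjet : ∀ᶠ t in 𝓝[I] σ, chartJet I x₀ γ V t = w t := by
    filter_upwards [hev, eventually_eventually_nhdsWithin.2 hfst] with t ht he
    have h1 := ((hasFDerivAt_fst (p := w t)).comp_hasDerivWithinAt t
      (hw t (hab t ht.1 ht.2.1).1).2).mono_of_mem_nhdsWithin (hab t ht.1 ht.2.1).2
    have h2 := h1.congr_of_eventuallyEq_of_mem he ht.1
    rw [ContinuousLinearMap.coe_fst', jacobiField_fst hτ₁ hτ hg ht.1 ht.2.2] at h2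
    have hu := (uniqueDiffOn_sqrt hτ₁ hτ) t ht.1
    exact Prod.ext (he.self_of_nhdsWithin ht.1) (h2.derivWithin hu)
  have hσab := hab σ hσ ⟨by linarith, by linarith⟩
  have h1 := (hw σ hσab.1).2.mono_of_mem_nhdsWithin hσab.2
  have h2 := (hw σ hσab.1).1
  rw [← hjet.self_of_nhdsWithin hσ] at h1 h2
  exact ⟨h1.congr_of_eventuallyEq_of_mem hjet hσ, h2⟩

/-- An `𝓛`-geodesic is determined by its position and velocity at the start. -/
theorem IsLGeodesic.eqOn_of_chartPhase_eq (hτ₁ : 0 ≤ τ₁) (hτ : τ₁ < τ₂)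
    (hg : IsBackwardRicciFlow g τ₁ τ₂) (hγ : IsLGeodesic g τ₁ τ₂ γ) {c : ℝ → M}
    (hc : IsLGeodesic g τ₁ τ₂ c) (h0 : c τ₁ = γ τ₁)
    (h1 : chartPhase (n := n) (Icc (√τ₁) (√τ₂)) (γ τ₁) (fun s => c (s ^ 2)) (√τ₁)
      = chartPhase (Icc (√τ₁) (√τ₂)) (γ τ₁) (fun s => γ (s ^ 2)) (√τ₁)) :
    EqOn c γ (Icc τ₁ τ₂) := by
  classical
  have hlt := Real.sqrt_lt_sqrt hτ₁ hτ
  -- Uniqueness from differentiable dependence: this family jumps from c to γ at s = 0, yet its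
  -- initial phase is constant. So the family is continuous at s = 0 at every time, which forces c =
  -- γ.
  set Γ : ℝ → ℝ → M := fun s => if s = 0 then γ else c with hΓdef
  have hΓ : ∀ s, IsLGeodesic g τ₁ τ₂ (Γ s) := fun s => by
    simp only [hΓdef]
    split_ifs <;> assumption
  have hsq : √τ₁ ^ 2 = τ₁ := Real.sq_sqrt hτ₁
  have hP : PhaseDifferentiableAt n (Icc (√τ₁) (√τ₂)) (fun s σ => Γ s (σ ^ 2)) (√τ₁) := by
    refine phaseDifferentiableAt_of_chart (x₀ := γ τ₁) (uniqueDiffOn_sqrt hτ₁ hτ)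
      (Eventually.of_forall fun s => (hΓ s).smooth) ⟨le_rfl, hlt.le⟩
      (Eventually.of_forall fun s => ?_) ?_
    · simp only [hΓdef, hsq]
      split_ifs
      · exact mem_extChartAt_source _
      · rw [h0]; exact mem_extChartAt_source _
    · have : (fun s => chartPhase (n := n) (Icc (√τ₁) (√τ₂)) (γ τ₁) (fun σ => Γ s (σ ^ 2)) (√τ₁))
          = fun _ => chartPhase (Icc (√τ₁) (√τ₂)) (γ τ₁) (fun s => γ (s ^ 2)) (√τ₁) := by
        funext s
        by_cases hs : s = 0
        · simp [hΓdef, hs]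
        · simp only [hΓdef, hs, if_false]
          exact h1
      rw [this]
      exact differentiableAt_const _
  intro τ hτI
  have hτ0 : 0 ≤ τ := hτ₁.trans hτI.1
  have h2 := (phaseDifferentiableAt_of_start hτ₁ hτ hg (Eventually.of_forall hΓ) hP (√τ)
    ⟨Real.sqrt_le_sqrt hτI.1, Real.sqrt_le_sqrt hτI.2⟩).1
  have h3 : Tendsto (fun s => Γ s (√τ ^ 2)) (𝓝[≠] 0) (𝓝 (Γ 0 (√τ ^ 2))) :=
    h2.tendsto.mono_left nhdsWithin_le_nhds
  have h4 : Tendsto (fun s => Γ s (√τ ^ 2)) (𝓝[≠] 0) (𝓝 (c (√τ ^ 2))) := by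
    refine tendsto_const_nhds.congr' ?_
    filter_upwards [self_mem_nhdsWithin] with s hs
    simp only [hΓdef, if_neg (show s ≠ 0 from hs)]
  have h5 := tendsto_nhds_unique h4 h3
  simpa [hΓdef, Real.sq_sqrt hτ0] using h5

theorem trivializationAt_eq_chartVector (x₀ q : M) (w : TangentSpace (𝓡 n) q)
    (hq : q ∈ (extChartAt (𝓡 n) x₀).source) :
    (trivializationAt (Mod n) (TangentSpace (𝓡 n)) x₀ (⟨q, w⟩ : TangentBundle (𝓡 n) M)).2
      = chartVector x₀ q w := by
  rw [TangentBundle.trivializationAt_apply, chartVector_eq hq]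
  rfl

/-- The velocity at the start of an `𝓛`-geodesic, in terms of the parameter `σ = √τ`. -/
theorem IsLGeodesicFrom.chartPhase_start (hτ₁ : 0 ≤ τ₁) (hτ : τ₁ < τ₂) {p : M}
    {w : TangentSpace (𝓡 n) p} {c : ℝ → M} (hc : IsLGeodesicFrom g τ₁ τ₂ p w c) :
    chartPhase (n := n) (Icc (√τ₁) (√τ₂)) p (fun s => c (s ^ 2)) (√τ₁)
      = (extChartAt (𝓡 n) p p, (2 : ℝ) • (w : Mod n)) := by
  have hlt := Real.sqrt_lt_sqrt hτ₁ hτ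
  have hsq : √τ₁ ^ 2 = τ₁ := Real.sq_sqrt hτ₁
  have hmem : √τ₁ ∈ Icc (√τ₁) (√τ₂) := ⟨le_rfl, hlt.le⟩
  have hsrc : c (√τ₁ ^ 2) ∈ (extChartAt (𝓡 n) p).source := by
    rw [hsq, hc.start]
    exact mem_extChartAt_source _
  refine Prod.ext ?_ ?_
  · simp only [chartPhase, hsq, hc.start]
  set u := derivWithin (fun s => extChartAt (𝓡 n) p (c (s ^ 2))) (Icc (√τ₁) (√τ₂)) with hu
  have hev : ∀ᶠ σ in 𝓝[>] (√τ₁), σ ∈ Ioo (√τ₁) (√τ₂) ∧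
      c (σ ^ 2) ∈ (extChartAt (𝓡 n) p).source := by
    refine Filter.Eventually.and (Ioo_mem_nhdsGT hlt) ?_
    have h1 := source_mem_nhdsWithin (hc.geodesic.smooth _ hmem).continuousWithinAt hsrc
    exact nhdsWithin_le_of_mem (Icc_mem_nhdsGT hlt) h1
  have hsqrt : Tendsto (fun τ => √τ) (𝓝[>] τ₁) (𝓝[>] (√τ₁)) := by
    refine tendsto_nhdsWithin_iff.2 ⟨Real.continuous_sqrt.continuousAt.mono_left
      nhdsWithin_le_nhds, ?_⟩
    filter_upwards [self_mem_nhdsWithin] with τ hτ'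
    exact Real.sqrt_lt_sqrt hτ₁ hτ'
  -- As γ'(τ) = u / (2√τ), the vector √τ γ'(τ) is u / 2; this is the origin of the factor 2 in the
  -- initial velocity 2w.
  have hvel : ∀ᶠ τ in 𝓝[>] τ₁, (trivializationAt (Mod n) (TangentSpace (𝓡 n)) p
      (⟨c τ, √τ • velocity c τ⟩ : TangentBundle (𝓡 n) M)).2 = (1 / 2 : ℝ) • u (√τ) := by
    filter_upwards [hsqrt.eventually hev, self_mem_nhdsWithin] with τ h1 h2
    have h0 : 0 < √τ := (Real.sqrt_nonneg _).trans_lt h1.1.1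
    have hτsq : √τ ^ 2 = τ := Real.sq_sqrt (hτ₁.trans (le_of_lt h2))
    have h3 := chartVector_velocity_sq h0
      ((hc.geodesic.smooth _ (Ioo_subset_Icc_self h1.1)).continuousWithinAt.continuousAt
        (Icc_mem_nhds h1.1.1 h1.1.2)) h1.2
      ((hasDerivWithinAt_chart hc.geodesic.smooth (Ioo_subset_Icc_self h1.1) h1.2).hasDerivAt
        (Icc_mem_nhds h1.1.1 h1.1.2))
    rw [hτsq] at h3 h1
    rw [trivializationAt_eq_chartVector _ _ _ h1.2, chartVector_smul, h3, smul_smul]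
    congr 1
    field_simp
  have hlim1 : Tendsto (fun τ => (1 / 2 : ℝ) • u (√τ)) (𝓝[>] τ₁) (𝓝 ((1 / 2 : ℝ) • u (√τ₁))) := by
    have h1 := (contDiffWithinAt_derivWithin_chart (x₀ := p) (uniqueDiffOn_sqrt hτ₁ hτ)
      hc.geodesic.smooth hmem hsrc).continuousWithinAt
    have h2 : Tendsto (fun τ => √τ) (𝓝[>] τ₁) (𝓝[Icc (√τ₁) (√τ₂)] (√τ₁)) :=
      hsqrt.mono_right (nhdsWithin_le_of_mem (Icc_mem_nhdsGT hlt))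
    exact (h1.tendsto.comp h2).const_smul _
  have hlim2 : Tendsto (fun τ => (trivializationAt (Mod n) (TangentSpace (𝓡 n)) p
      (⟨c τ, √τ • velocity c τ⟩ : TangentBundle (𝓡 n) M)).2) (𝓝[>] τ₁) (𝓝 w) := by
    have h1 : ContinuousAt (trivializationAt (Mod n) (TangentSpace (𝓡 n)) p)
        (⟨p, w⟩ : TangentBundle (𝓡 n) M) :=
      (trivializationAt (Mod n) (TangentSpace (𝓡 n)) p).toOpenPartialHomeomorph.continuousAt (by simp)
    have h2 := (continuous_snd.continuousAt.comp h1).tendsto.comp hc.initial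
    have h3 : (trivializationAt (Mod n) (TangentSpace (𝓡 n)) p
        (⟨p, w⟩ : TangentBundle (𝓡 n) M)).2 = w := by
      rw [trivializationAt_eq_chartVector _ _ _ (mem_extChartAt_source p), chartVector_self]
    simp only [Function.comp_def, h3] at h2
    exact h2
  have h5 : (1 / 2 : ℝ) • u (√τ₁) = (w : Mod n) :=
    tendsto_nhds_unique hlim1 (hlim2.congr' hvel)
  show u (√τ₁) = (2 : ℝ) • (w : Mod n)
  have h6 : u (√τ₁) = (2 : ℝ) • ((1 / 2 : ℝ) • u (√τ₁)) := by
    rw [smul_smul]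
    norm_num
  exact h6.trans (congrArg (fun z : Mod n => (2 : ℝ) • z) h5)

end JacobiFields

/-! ### Derivatives of time-dependent maps along curves and mixed derivatives -/

section MixedDerivatives

variable {E F : Type*} [NormedAddCommGroup E] [NormedSpace ℝ E] [NormedAddCommGroup F]
  [NormedSpace ℝ F]

theorem hasDerivAt_comp_sq_curve {H : ℝ → E → F} {σ : ℝ} {x : ℝ → E} {u : E}
    (hH : DifferentiableAt ℝ (Function.uncurry H) (σ ^ 2, x σ)) (hx : HasDerivAt x u σ) :
    HasDerivAt (fun s => H (s ^ 2) (x s))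
      ((2 * σ) • deriv (fun t => H t (x σ)) (σ ^ 2) + fderiv ℝ (H (σ ^ 2)) (x σ) u) σ := by
  have h1 : HasDerivAt (fun s : ℝ => (s ^ 2, x s)) (2 * σ, u) σ := by
    refine HasDerivAt.prodMk ?_ hx
    simpa using hasDerivAt_pow 2 σ
  have h2 := hH.hasFDerivAt.comp_hasDerivAt σ h1
  have h3 : HasDerivAt (fun t => H t (x σ))
      (fderiv ℝ (Function.uncurry H) (σ ^ 2, x σ) (1, 0)) (σ ^ 2) :=
    hH.hasFDerivAt.comp_hasDerivAt (σ ^ 2)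
      (f := fun t => (t, x σ)) ((hasDerivAt_id _).prodMk (hasDerivAt_const _ _))
  have h4 : HasFDerivAt (H (σ ^ 2)) ((fderiv ℝ (Function.uncurry H) (σ ^ 2, x σ)).comp
      ((0 : E →L[ℝ] ℝ).prod (ContinuousLinearMap.id ℝ E))) (x σ) :=
    hH.hasFDerivAt.comp (x σ) (f := fun y => (σ ^ 2, y))
      ((hasFDerivAt_const _ _).prodMk (hasFDerivAt_id _))
  refine h2.congr_deriv ?_
  rw [h3.deriv, h4.fderiv, ← map_smul]
  simp [← map_add]

/-- Time and space derivatives are interchanged by the symmetry of the second derivative of the map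
in both variables jointly. -/
theorem hasDerivAt_fderiv_apply {H : ℝ → E → F} {t : ℝ} {x : E}
    (hH : ContDiffAt ℝ ∞ (Function.uncurry H) (t, x)) {D : E → F}
    (hD : ∀ᶠ y in 𝓝 x, HasDerivAt (fun t => H t y) (D y) t) (a : E) :
    HasDerivAt (fun t' => fderiv ℝ (H t') x a) (fderiv ℝ D x a) t := by
  have hd : ∀ᶠ q in 𝓝 (t, x), DifferentiableAt ℝ (Function.uncurry H) q := by
    have h := hH.of_le (m := 1) (by simp)
    filter_upwards [h.eventually (by simp)] with q hq using hq.differentiableAt (by simp)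
  have h2 : HasFDerivAt (fderiv ℝ (Function.uncurry H)) _ (t, x) :=
    ((hH.fderiv_right (m := 1) one_add_one_le_infty).differentiableAt (by simp)).hasFDerivAt
  have hs : IsSymmSndFDerivAt ℝ (Function.uncurry H) (t, x) :=
    hH.isSymmSndFDerivAt minSmoothness_two_le_infty
  have e1 : (fun t' => fderiv ℝ (H t') x a)
      =ᶠ[𝓝 t] fun t' => fderiv ℝ (Function.uncurry H) (t', x) (0, a) := by
    have hc : ContinuousAt (fun t' => (t', x)) t := by fun_prop
    filter_upwards [hc.eventually hd] with t' ht'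
    have h4 : HasFDerivAt (H t') ((fderiv ℝ (Function.uncurry H) (t', x)).comp
        ((0 : E →L[ℝ] ℝ).prod (ContinuousLinearMap.id ℝ E))) x :=
      ht'.hasFDerivAt.comp x (f := fun y => (t', y))
        ((hasFDerivAt_const _ _).prodMk (hasFDerivAt_id _))
    rw [h4.fderiv]
    simp
  have e2 : D =ᶠ[𝓝 x] fun y => fderiv ℝ (Function.uncurry H) (t, y) (1, 0) := by
    have hc : ContinuousAt (fun y => (t, y)) x := by fun_prop
    filter_upwards [hc.eventually hd, hD] with y hy hDy
    refine hDy.unique ?_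
    exact hy.hasFDerivAt.comp_hasDerivAt t (f := fun t => (t, y))
      ((hasDerivAt_id _).prodMk (hasDerivAt_const _ _))
  have h3 : HasFDerivAt (fun y => fderiv ℝ (Function.uncurry H) (t, y)) _ x :=
    h2.comp x (f := fun y => (t, y)) ((hasFDerivAt_const _ _).prodMk (hasFDerivAt_id _))
  have h5 : HasDerivAt (fun t' => fderiv ℝ (Function.uncurry H) (t', x)) _ t :=
    h2.comp_hasDerivAt t (f := fun t' => (t', x)) ((hasDerivAt_id _).prodMk (hasDerivAt_const _ _))
  rw [e2.fderiv_eq, (h3.clm_apply (hasFDerivAt_const ((1 : ℝ), (0 : E)) x)).fderiv]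
  refine ((h5.clm_apply (hasDerivAt_const t ((0 : ℝ), a))).congr_of_eventuallyEq e1).congr_deriv ?_
  simpa using hs.eq (1, 0) (0, a)

end MixedDerivatives

/-! ### The second variation formula in coordinates -/

section SecondVariation

variable {n : ℕ}

/-- The zeroth order part of the integrand of the `𝓛`-index form, in terms of `σ = √τ`: here `u` is
the derivative of the curve with respect to `σ`. -/
def indexTensor (G : ℝ → Mod n → Bil (Mod n)) (σ : ℝ) (x u a b : Mod n) : ℝ :=
  2 * σ ^ 2 * hessScalar (G (σ ^ 2)) x a b + G (σ ^ 2) x (curvature (G (σ ^ 2)) x a u b) u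
    - 2 * σ * covRicci (G (σ ^ 2)) x a b u - 2 * σ * covRicci (G (σ ^ 2)) x b a u
    + 2 * σ * covRicci (G (σ ^ 2)) x u a b

variable {G : ℝ → Mod n → Bil (Mod n)} {S : Set ℝ} {T : Set (Mod n)}

namespace IsMetricFamilyOn

variable (hG : IsMetricFamilyOn G S T) {t : ℝ} (ht : t ∈ S) {x : Mod n} (hx : x ∈ T)
include hG ht hx

theorem hessScalar_eq (a b : Mod n) :
    hessScalar (G t) x a b = fderiv ℝ (fderiv ℝ (scalarCurvature (G t))) x a b
      - fderiv ℝ (scalarCurvature (G t)) x (christoffelL (G t) x a b) := by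
  have h : HasFDerivAt (fderiv ℝ (scalarCurvature (G t))) _ x :=
    (((hG.contDiffAt_scalarCurvature ht hx).fderiv_right (m := 1)
      one_add_one_le_infty).differentiableAt (by simp)).hasFDerivAt
  rw [hessScalar, (h.clm_apply (hasFDerivAt_const b x)).fderiv]
  simp [christoffelL_apply]

theorem hessScalar_symm (a b : Mod n) : hessScalar (G t) x a b = hessScalar (G t) x b a := by
  rw [hG.hessScalar_eq ht hx, hG.hessScalar_eq ht hx, hG.christoffelL_symm ht hx a b]
  congr 1
  exact ((hG.contDiffAt_scalarCurvature ht hx).isSymmSndFDerivAt minSmoothness_two_le_infty).eq a b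

end IsMetricFamilyOn

namespace IsFlowOn

variable (hG : IsFlowOn G S T)
include hG

theorem differentiableAt_ricL {t : ℝ} (ht : t ∈ S) {x : Mod n} (hx : x ∈ T) :
    DifferentiableAt ℝ (ricL G S t) x :=
  ((hG.contDiffOn_ricL (s := T) (t := fun _ => t) (y := id) contDiffOn_const contDiffOn_id
    (fun _ _ => ht) fun _ h => h).contDiffAt (hG.isOpen.mem_nhds hx)).differentiableAt (by simp)

theorem covRicci_eq {t : ℝ} (ht : t ∈ S) {x : Mod n} (hx : x ∈ T) (w a b : Mod n) :
    covRicci (G t) x w a b = fderiv ℝ (ricL G S t) x w a b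
      - ricL G S t x (christoffelL (G t) x w a) b - ricL G S t x a (christoffelL (G t) x w b) := by
  have h := (hG.differentiableAt_ricL ht hx).hasFDerivAt
  have e : (fun z => ricci (G t) z a b) =ᶠ[𝓝 x] fun z => ricL G S t z a b := by
    filter_upwards [hG.isOpen.mem_nhds hx] with z hz using (hG.ricL_apply ht hz a b).symm
  rw [covRicci, e.fderiv_eq, hG.ricL_apply ht hx, hG.ricL_apply ht hx,
    ((h.clm_apply (hasFDerivAt_const a x)).clm_apply (hasFDerivAt_const b x)).fderiv]
  simp [christoffelL_apply]

theorem fderiv_ricL_symm {t : ℝ} (ht : t ∈ S) {x : Mod n} (hx : x ∈ T) (w a b : Mod n) :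
    fderiv ℝ (ricL G S t) x w a b = fderiv ℝ (ricL G S t) x w b a := by
  have h := (hG.differentiableAt_ricL ht hx).hasFDerivAt
  have e : (fun z => ricL G S t z a b) =ᶠ[𝓝 x] fun z => ricL G S t z b a := by
    filter_upwards [hG.isOpen.mem_nhds hx] with z hz using hG.ricL_symm ht hz a b
  have h1 := e.fderiv_eq (𝕜 := ℝ)
  rw [((h.clm_apply (hasFDerivAt_const a x)).clm_apply (hasFDerivAt_const b x)).fderiv,
    ((h.clm_apply (hasFDerivAt_const b x)).clm_apply (hasFDerivAt_const a x)).fderiv] at h1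
  simpa using congrArg (fun L : Mod n →L[ℝ] ℝ => L w) h1

theorem covRicci_symm {t : ℝ} (ht : t ∈ S) {x : Mod n} (hx : x ∈ T) (w a b : Mod n) :
    covRicci (G t) x w a b = covRicci (G t) x w b a := by
  rw [hG.covRicci_eq ht hx, hG.covRicci_eq ht hx, hG.fderiv_ricL_symm ht hx,
    hG.ricL_symm ht hx a, hG.ricL_symm ht hx b]
  ring

theorem contDiffAt_uncurry {t : ℝ} (ht : S ∈ 𝓝 t) {x : Mod n} (hx : x ∈ T) :
    ContDiffAt ℝ ∞ (Function.uncurry G) (t, x) :=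
  hG.smooth.contDiffAt (prod_mem_nhds ht (hG.isOpen.mem_nhds hx))

theorem contDiffAt_uncurry_christoffelL {t : ℝ} (ht : S ∈ 𝓝 t) {x : Mod n} (hx : x ∈ T) :
    ContDiffAt ℝ ∞ (Function.uncurry fun t => christoffelL (G t)) (t, x) :=
  (hG.contDiffOn_christoffelL (s := S ×ˢ T) (t := Prod.fst) (y := Prod.snd) contDiffOn_fst
    contDiffOn_snd (fun _ h => h.1) fun _ h => h.2).contDiffAt
      (prod_mem_nhds ht (hG.isOpen.mem_nhds hx))

theorem hasDerivAt_metric {t : ℝ} (ht : S ∈ 𝓝 t) {x : Mod n} (hx : x ∈ T) :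
    HasDerivAt (fun t => G t x) ((2 : ℝ) • ricL G S t x) t :=
  (hG.hasDerivWithinAt_metric (mem_of_mem_nhds ht) hx).hasDerivAt ht

theorem hasDerivAt_fderiv_metric {t : ℝ} (ht : S ∈ 𝓝 t) {x : Mod n} (hx : x ∈ T) (a b c : Mod n) :
    HasDerivAt (fun t => fderiv ℝ (G t) x a b c) (2 * fderiv ℝ (ricL G S t) x a b c) t := by
  have h := hasDerivAt_fderiv_apply (hG.contDiffAt_uncurry ht hx)
    (D := fun y => (2 : ℝ) • ricL G S t y) (by
      filter_upwards [hG.isOpen.mem_nhds hx] with y hy using hG.hasDerivAt_metric ht hy) a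
  have h2 := (h.clm_apply (hasDerivAt_const t b)).clm_apply (hasDerivAt_const t c)
  have h3 : HasFDerivAt (fun y => (2 : ℝ) • ricL G S t y) ((2 : ℝ) • fderiv ℝ (ricL G S t) x) x :=
    (hG.differentiableAt_ricL (mem_of_mem_nhds ht) hx).hasFDerivAt.const_smul (2 : ℝ)
  refine h2.congr_deriv ?_
  rw [h3.fderiv]
  simp

/-- The evolution of the Christoffel symbols under the backward Ricci flow. -/
theorem metric_deriv_christoffelL {t : ℝ} (ht : S ∈ 𝓝 t) {x : Mod n} (hx : x ∈ T) (a b c : Mod n) :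
    G t x (deriv (fun t => christoffelL (G t) x) t a b) c
      = covRicci (G t) x a b c + covRicci (G t) x b a c - covRicci (G t) x c a b := by
  have htS := mem_of_mem_nhds ht
  have hΓ : HasDerivAt (fun t => christoffelL (G t) x) (deriv (fun t => christoffelL (G t) x) t) t :=
    (DifferentiableAt.comp t (f := fun t => (t, x))
      ((hG.contDiffAt_uncurry_christoffelL ht hx).differentiableAt (by simp))
      (by fun_prop)).hasDerivAt
  have h1 := ((hG.hasDerivAt_metric ht hx).clm_apply
    ((hΓ.clm_apply (hasDerivAt_const t a)).clm_apply (hasDerivAt_const t b))).clm_apply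
      (hasDerivAt_const t c)
  have h2 := (((hG.hasDerivAt_fderiv_metric ht hx a b c).add
    (hG.hasDerivAt_fderiv_metric ht hx b a c)).sub
      (hG.hasDerivAt_fderiv_metric ht hx c a b)).const_mul (1 / 2)
  -- The Koszul formula is differentiated in time on both sides. The term 2 Ric(Γ(a, b), c) from the
  -- derivative of G completes the partial derivatives of Ric to covariant ones.
  have h3 := h1.unique (h2.congr_of_eventuallyEq (by
    filter_upwards [ht] with s hs using hG.metric_christoffelL hs hx a b c))
  simp only [map_zero, add_zero, _root_.add_apply, _root_.smul_apply, smul_eq_mul] at h3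
  rw [hG.covRicci_eq htS hx, hG.covRicci_eq htS hx, hG.covRicci_eq htS hx,
    hG.christoffelL_symm htS hx c a, hG.christoffelL_symm htS hx c b,
    hG.christoffelL_symm htS hx b a, hG.ricL_symm htS hx b, hG.ricL_symm htS hx a (christoffelL _ _ b c)]
  linarith

set_option maxHeartbeats 1000000 in
/-- The linearization of the `𝓛`-geodesic equation. -/
theorem metric_fderiv_geodesicAccel {σ : ℝ} (hσ : σ ^ 2 ∈ S) {x : Mod n} (hx : x ∈ T)
    (u J K c : Mod n) :
    G (σ ^ 2) x ((fderiv ℝ (geodesicField G S σ) (x, u) (J, K)).2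
        + fderiv ℝ (christoffelL (G (σ ^ 2))) x J u u
        + (2 : ℝ) • christoffelL (G (σ ^ 2)) x u K) c
      = 2 * σ ^ 2 * fderiv ℝ (fderiv ℝ (scalarCurvature (G (σ ^ 2)))) x J c
        - 4 * σ * (fderiv ℝ (ricL G S (σ ^ 2)) x J u c + ricL G S (σ ^ 2) x K c)
        - fderiv ℝ (G (σ ^ 2)) x J
          (geodesicAccel G S σ x u + christoffelL (G (σ ^ 2)) x u u) c := by
  -- The defining identity G(u' + Γ(u, u), c) = force is differentiated along the line through (x,
  -- u) with direction (J, K).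
  have hz : HasDerivAt (fun s : ℝ => ((x + s • J, u + s • K) : Mod n × Mod n)) (J, K) 0 := by
    refine HasDerivAt.prodMk ?_ ?_
    · simpa using ((hasDerivAt_id (0 : ℝ)).smul_const J).const_add x
    · simpa using ((hasDerivAt_id (0 : ℝ)).smul_const K).const_add u
  have hp : HasDerivAt (fun s : ℝ => x + s • J) J 0 := by
    simpa using ((hasDerivAt_id (0 : ℝ)).smul_const J).const_add x
  have hq : HasDerivAt (fun s : ℝ => u + s • K) K 0 := by
    simpa using ((hasDerivAt_id (0 : ℝ)).smul_const K).const_add u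
  have hx0 : x + (0 : ℝ) • J = x := by simp
  have hu0 : u + (0 : ℝ) • K = u := by simp
  have hF : HasDerivAt (fun s : ℝ => geodesicField G S σ (x + s • J, u + s • K))
      (fderiv ℝ (geodesicField G S σ) (x, u) (J, K)) 0 :=
    (hG.hasFDerivAt_geodesicField hσ (z := (x, u)) hx).comp_hasDerivAt_of_eq 0 hz (by simp)
  have hA : HasDerivAt (fun s : ℝ => geodesicAccel G S σ (x + s • J) (u + s • K))
      (fderiv ℝ (geodesicField G S σ) (x, u) (J, K)).2 0 :=
    (ContinuousLinearMap.snd ℝ (Mod n) (Mod n)).hasFDerivAt.comp_hasDerivAt (0 : ℝ) hF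
  have hmet : HasDerivAt (fun s : ℝ => G (σ ^ 2) (x + s • J)) (fderiv ℝ (G (σ ^ 2)) x J) 0 :=
    ((hG.contDiffAt_metric hσ hx).differentiableAt (by simp)).hasFDerivAt.comp_hasDerivAt_of_eq 0 hp
      hx0.symm
  have hchr : HasDerivAt (fun s : ℝ => christoffelL (G (σ ^ 2)) (x + s • J))
      (fderiv ℝ (christoffelL (G (σ ^ 2))) x J) 0 :=
    ((hG.contDiffAt_christoffelL hσ hx).differentiableAt
      (by simp)).hasFDerivAt.comp_hasDerivAt_of_eq 0 hp hx0.symm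
  have hric : HasDerivAt (fun s : ℝ => ricL G S (σ ^ 2) (x + s • J))
      (fderiv ℝ (ricL G S (σ ^ 2)) x J) 0 :=
    (hG.differentiableAt_ricL hσ hx).hasFDerivAt.comp_hasDerivAt_of_eq 0 hp hx0.symm
  have hscal : HasDerivAt (fun s : ℝ => fderiv ℝ (scalarCurvature (G (σ ^ 2))) (x + s • J))
      (fderiv ℝ (fderiv ℝ (scalarCurvature (G (σ ^ 2)))) x J) 0 :=
    ((((hG.contDiffAt_scalarCurvature hσ hx).fderiv_right (m := 1)
      one_add_one_le_infty).differentiableAt (by simp)).hasFDerivAt).comp_hasDerivAt_of_eq 0 hp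
        hx0.symm
  have hlhs := (hmet.clm_apply (hA.add ((hchr.clm_apply hq).clm_apply hq))).clm_apply
    (hasDerivAt_const 0 c)
  have hrhs : HasDerivAt (fun s : ℝ => geodesicForce G S σ (x + s • J) (u + s • K) c) _ 0 :=
    ((hscal.const_smul (2 * σ ^ 2)).sub ((hric.clm_apply hq).const_smul (4 * σ))).clm_apply
      (hasDerivAt_const 0 c)
  have hev : ∀ᶠ s : ℝ in 𝓝 0, x + s • J ∈ T :=
    hp.continuousAt.eventually (hG.isOpen.mem_nhds (by simpa using hx))
  have h := hlhs.unique (hrhs.congr_of_eventuallyEq (hev.mono fun s hs =>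
    hG.metric_geodesicAccel hσ hs (u + s • K) c))
  clear hlhs hrhs
  simp only [zero_smul, add_zero, Pi.add_apply, _root_.add_apply, _root_.zero_apply, _root_.sub_apply,
    _root_.smul_apply, smul_eq_mul, map_zero, map_add] at h
  simp only [map_add, map_smul, _root_.add_apply, _root_.smul_apply, smul_eq_mul]
  rw [hG.christoffelL_symm hσ hx K u] at h
  linear_combination h

end IsFlowOn

end SecondVariation

section SecondVariation

variable {n : ℕ} {G : ℝ → Mod n → Bil (Mod n)} {S : Set ℝ} {T : Set (Mod n)}

namespace IsFlowOn

variable (hG : IsFlowOn G S T)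
include hG

set_option maxHeartbeats 1000000 in
/-- The derivative of `⟨D_σ J, W⟩` for a field `J` which satisfies the linearized equation. -/
theorem hasDerivAt_metric_covDeriv {σ : ℝ} (hσ : S ∈ 𝓝 (σ ^ 2)) {x u J K W : ℝ → Mod n} {W' : Mod n}
    (hx : x σ ∈ T) (hxd : HasDerivAt x (u σ) σ)
    (hu : HasDerivAt u (geodesicAccel G S σ (x σ) (u σ)) σ) (hJ : HasDerivAt J (K σ) σ)
    (hK : HasDerivAt K (fderiv ℝ (geodesicField G S σ) (x σ, u σ) (J σ, K σ)).2 σ)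
    (hW : HasDerivAt W W' σ) :
    HasDerivAt (fun s => G (s ^ 2) (x s) (K s + christoffelL (G (s ^ 2)) (x s) (u s) (J s)) (W s))
      (indexTensor G σ (x σ) (u σ) (J σ) (W σ)
        + G (σ ^ 2) (x σ) (K σ + christoffelL (G (σ ^ 2)) (x σ) (u σ) (J σ))
          (W' + christoffelL (G (σ ^ 2)) (x σ) (u σ) (W σ))) σ := by
  have hσS := mem_of_mem_nhds hσ
  have h1 : HasDerivAt (fun s => G (s ^ 2) (x s)) _ σ :=
    hasDerivAt_comp_sq_curve ((hG.contDiffAt_uncurry hσ hx).differentiableAt (by simp)) hxd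
  have h2 : HasDerivAt (fun s => christoffelL (G (s ^ 2)) (x s)) _ σ :=
    hasDerivAt_comp_sq_curve (H := fun t => christoffelL (G t))
      ((hG.contDiffAt_uncurry_christoffelL hσ hx).differentiableAt (by simp)) hxd
  have h3 := (h1.clm_apply (hK.add ((h2.clm_apply hu).clm_apply hJ))).clm_apply hW
  refine h3.congr_deriv ?_
  have hacc := hG.metric_fderiv_geodesicAccel hσS hx (u σ) (J σ) (K σ) (W σ)
  have hdot := hG.metric_deriv_christoffelL hσ hx (u σ) (J σ) (W σ)
  have hforce := hG.metric_geodesicAccel hσS hx (u σ) (christoffelL (G (σ ^ 2)) (x σ) (J σ) (W σ))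
  -- The curvature symmetries bring the term into the form ⟨R(u, J)u, W⟩ in which it comes out of
  -- the derivatives of the Christoffel symbols.
  have hR : G (σ ^ 2) (x σ) (curvatureL (G (σ ^ 2)) (x σ) (J σ) (u σ) (W σ)) (u σ)
      = G (σ ^ 2) (x σ) (curvatureL (G (σ ^ 2)) (x σ) (u σ) (J σ) (u σ)) (W σ) := by
    rw [hG.metric_curvature_antisymm hσS hx, hG.curvature_antisymm hσS, map_neg,
      _root_.neg_apply, neg_neg]
  clear h1 h2 h3
  rw [(hG.hasDerivAt_metric hσ hx).deriv]
  simp only [indexTensor, hG.hessScalar_eq hσS hx, hG.curvature_eq hσS hx]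
  rw [hR, hG.covRicci_symm hσS hx (J σ) (W σ) (u σ), hG.covRicci_symm hσS hx (W σ) (J σ) (u σ),
    hG.covRicci_eq hσS hx (J σ)]
  rw [hG.covRicci_eq hσS hx (J σ)] at hdot
  generalize covRicci (G (σ ^ 2)) (x σ) (W σ) (u σ) (J σ) = ρ₁ at *
  generalize covRicci (G (σ ^ 2)) (x σ) (u σ) (J σ) (W σ) = ρ₂ at *
  rw [hG.fderiv_metric hσS hx, hforce] at hacc
  simp only [Pi.add_apply, _root_.add_apply, _root_.smul_apply, hG.fderiv_metric hσS hx,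
    geodesicForce, _root_.sub_apply, curvatureL, map_add,
    hG.fderiv_christoffelL_symm hσS hx (u σ) (u σ) (J σ), map_sub, map_smul, smul_eq_mul,
    hG.christoffelL_symm hσS hx (J σ) (geodesicAccel G S σ (x σ) (u σ)),
    hG.christoffelL_symm hσS hx (J σ) (u σ)] at hacc hdot ⊢
  -- The linearized equation, plus dτ/dσ = 2σ times the evolution of the connection.
  linear_combination hacc + 2 * σ * hdot

end IsFlowOn

end SecondVariation

/-! ### Symmetry and rescaling of the index integrand -/

section Multilinear

variable {n : ℕ} {G : ℝ → Mod n → Bil (Mod n)} {S : Set ℝ} {T : Set (Mod n)}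

namespace IsFlowOn

variable (hG : IsFlowOn G S T)
include hG

theorem curvatureL_smul_middle (t : ℝ) (x : Mod n) (r : ℝ) (a u b : Mod n) :
    curvatureL (G t) x a (r • u) b = r • curvatureL (G t) x a u b := by
  simp [curvatureL, smul_sub, smul_add]

variable {t : ℝ} (ht : t ∈ S) {x : Mod n} (hx : x ∈ T)
include ht hx

theorem covRicci_smul_left (r : ℝ) (w a b : Mod n) :
    covRicci (G t) x (r • w) a b = r * covRicci (G t) x w a b := by
  simp [hG.covRicci_eq ht hx, mul_sub]

theorem covRicci_smul_right (r : ℝ) (w a b : Mod n) :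
    covRicci (G t) x w a (r • b) = r * covRicci (G t) x w a b := by
  simp [hG.covRicci_eq ht hx, mul_sub]

end IsFlowOn

/-- The index tensor is linear in the first field. -/
theorem IsFlowOn.exists_linearMap_indexTensor (hG : IsFlowOn G S T) {σ : ℝ} (hσ : σ ^ 2 ∈ S)
    {x : Mod n} (hx : x ∈ T) (u b : Mod n) :
    ∃ L : Mod n →ₗ[ℝ] ℝ, ∀ a, L a = indexTensor G σ x u a b := by
  refine ⟨IsLinearMap.mk' (fun a => indexTensor G σ x u a b) ⟨fun a a' => ?_, fun r a => ?_⟩,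
    fun _ => rfl⟩ <;>
  simp only [indexTensor, hG.hessScalar_eq hσ hx, hG.covRicci_eq hσ hx, hG.curvature_eq hσ hx,
    curvatureL, map_add, map_sub, map_smul, _root_.add_apply, _root_.sub_apply, _root_.smul_apply,
    smul_eq_mul] <;>
  ring

/-- The integrand of the `𝓛`-index form in coordinates: `X` is the velocity of the curve, `s` the
weight, and `d` the product of the covariant derivatives of the fields. -/
def coordIndex (G : Mod n → Bil (Mod n)) (x a b X : Mod n) (s d : ℝ) : ℝ :=
  s * (hessScalar G x a b + 2 * d + 2 * G x (curvature G x a X b) X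
    - 2 * covRicci G x a b X - 2 * covRicci G x b a X + 2 * covRicci G x X a b)

theorem IsFlowOn.coordIndex_symm (hG : IsFlowOn G S T) {t : ℝ} (ht : t ∈ S) {x : Mod n}
    (hx : x ∈ T) (a b X : Mod n) (s d : ℝ) :
    coordIndex (G t) x a b X s d = coordIndex (G t) x b a X s d := by
  rw [coordIndex, coordIndex, hG.hessScalar_symm ht hx a b, hG.curvature_eq ht hx,
    hG.curvature_eq ht hx, hG.metric_curvature_pair_symm ht hx a X b X,
    hG.covRicci_symm ht hx X a b]
  ring

/-- The substitution X = u / (2σ) in the integrand times dτ/dσ. The weight σ · 2σ absorbs both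
denominators of the curvature term and leaves a factor 2σ in front of the Ricci terms. -/
theorem IsFlowOn.coordIndex_sqrt (hG : IsFlowOn G S T) {σ : ℝ} (h0 : 0 < σ) (hσ : σ ^ 2 ∈ S)
    {x : Mod n} (hx : x ∈ T) (a b u : Mod n) (d : ℝ) :
    2 * σ * coordIndex (G (σ ^ 2)) x a b ((1 / (2 * σ)) • u) σ d
      = indexTensor G σ x u a b + (2 * σ) * ((2 * σ) * d) := by
  rw [coordIndex, indexTensor, hG.curvature_eq hσ hx, hG.curvature_eq hσ hx]
  simp only [hG.curvatureL_smul_middle, hG.covRicci_smul_left hσ hx,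
    hG.covRicci_smul_right hσ hx, map_smul, _root_.smul_apply, smul_eq_mul]
  field_simp
  ring

end Multilinear

/-! ### The index integrand along an 𝓛-geodesic and its primitive -/

section IndexDensity

variable {n : ℕ} {M : Type*} [TopologicalSpace M] [T2Space M] [ChartedSpace (Mod n) M]
  [IsManifold (𝓡 n) ∞ M]

/-- The covariant derivative of `V` with respect to `σ = √τ`. -/
def sqrtDeriv (g : ℝ → Metric n M) (γ : ℝ → M) (V : ∀ τ, TangentSpace (𝓡 n) (γ τ)) (σ : ℝ) :
    TangentSpace (𝓡 n) (γ (σ ^ 2)) :=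
  (2 * σ) • covDeriv (g (σ ^ 2)) γ V (σ ^ 2)

/-- `⟨D_σ V, W⟩`. -/
def momentum (g : ℝ → Metric n M) (γ : ℝ → M) (V W : ∀ τ, TangentSpace (𝓡 n) (γ τ)) (σ : ℝ) : ℝ :=
  (g (σ ^ 2)).inner (γ (σ ^ 2)) (sqrtDeriv g γ V σ) (W (σ ^ 2))

/-- `⟨D_σ V, D_σ W⟩`. -/
def derivProduct (g : ℝ → Metric n M) (γ : ℝ → M) (V W : ∀ τ, TangentSpace (𝓡 n) (γ τ)) (σ : ℝ) :
    ℝ :=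
  (g (σ ^ 2)).inner (γ (σ ^ 2)) (sqrtDeriv g γ V σ) (sqrtDeriv g γ W σ)

/-- The integrand of the `𝓛`-index form with respect to `dσ`. -/
def indexDensity (g : ℝ → Metric n M) (γ : ℝ → M) (V W : ∀ τ, TangentSpace (𝓡 n) (γ τ)) (σ : ℝ) :
    ℝ :=
  2 * σ * indexIntegrand g γ V W (σ ^ 2)

/-- The field `V` is differentiable at `σ` with respect to the parameter `σ = √τ`. -/
def FieldDifferentiableAt (γ : ℝ → M) (V : ∀ τ, TangentSpace (𝓡 n) (γ τ)) (σ : ℝ) : Prop :=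
  ∀ x₀ : M, γ (σ ^ 2) ∈ (extChartAt (𝓡 n) x₀).source → DifferentiableAt ℝ (chartField x₀ γ V) σ

variable {g : ℝ → Metric n M} {τ₁ τ₂ : ℝ} {γ : ℝ → M} {σ : ℝ}
  {V W J : ∀ τ, TangentSpace (𝓡 n) (γ τ)}

theorem IsLGeodesic.continuousAt (hγ : IsLGeodesic g τ₁ τ₂ γ) (hσ : σ ∈ Ioo (√τ₁) (√τ₂)) :
    ContinuousAt (fun s => γ (s ^ 2)) σ :=
  (hγ.smooth σ (Ioo_subset_Icc_self hσ)).continuousWithinAt.continuousAt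
    (Icc_mem_nhds hσ.1 hσ.2)

theorem IsLGeodesic.hasDerivAt_chart (hγ : IsLGeodesic g τ₁ τ₂ γ) (hσ : σ ∈ Ioo (√τ₁) (√τ₂))
    {x₀ : M} (hx₀ : γ (σ ^ 2) ∈ (extChartAt (𝓡 n) x₀).source) :
    HasDerivAt (fun s => extChartAt (𝓡 n) x₀ (γ (s ^ 2)))
      (chartPhase (n := n) (Icc (√τ₁) (√τ₂)) x₀ (fun s => γ (s ^ 2)) σ).2 σ :=
  (hasDerivWithinAt_chart hγ.smooth (Ioo_subset_Icc_self hσ) hx₀).hasDerivAt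
    (Icc_mem_nhds hσ.1 hσ.2)

theorem IsLGeodesic.eventually_interior (hγ : IsLGeodesic g τ₁ τ₂ γ) (hσ : σ ∈ Ioo (√τ₁) (√τ₂))
    {x₀ : M} (hx₀ : γ (σ ^ 2) ∈ (extChartAt (𝓡 n) x₀).source) :
    ∀ᶠ s in 𝓝 σ, s ∈ Ioo (√τ₁) (√τ₂) ∧ γ (s ^ 2) ∈ (extChartAt (𝓡 n) x₀).source :=
  Filter.Eventually.and (Ioo_mem_nhds hσ.1 hσ.2)
    ((hγ.continuousAt hσ).preimage_mem_nhds ((isOpen_extChartAt_source x₀).mem_nhds hx₀))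

set_option maxHeartbeats 1000000 in
theorem fieldDifferentiableAt_of_chart (hγ : IsLGeodesic g τ₁ τ₂ γ) (hσ : σ ∈ Ioo (√τ₁) (√τ₂))
    {x₀ : M} (hx₀ : γ (σ ^ 2) ∈ (extChartAt (𝓡 n) x₀).source)
    (hV : DifferentiableAt ℝ (chartField x₀ γ V) σ) : FieldDifferentiableAt γ V σ := by
  intro x hx
  have hmem := mem_chartOverlap hx₀ hx
  have hψ : DifferentiableAt ℝ (fderiv ℝ (chartChange (n := n) x₀ x))
      (extChartAt (𝓡 n) x₀ (γ (σ ^ 2))) :=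
    (((contDiffOn_chartChange x₀ x).contDiffAt ((isOpen_chartOverlap x₀ x).mem_nhds
      hmem)).fderiv_right (m := 1) one_add_one_le_infty).differentiableAt (by simp)
  have h1 := (hψ.hasFDerivAt.comp_hasDerivAt σ (hγ.hasDerivAt_chart hσ hx₀)).clm_apply hV.hasDerivAt
  refine h1.differentiableAt.congr_of_eventuallyEq ?_
  filter_upwards [hγ.eventually_interior hσ hx₀, hγ.eventually_interior hσ hx] with s h2 h3
  exact (fderiv_chartChange_chartVector h2.2 h3.2 (V (s ^ 2))).symm

theorem chartVector_sqrtDeriv (hτ₁ : 0 ≤ τ₁) (hτ : τ₁ < τ₂) (hg : IsBackwardRicciFlow g τ₁ τ₂)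
    (hγ : IsLGeodesic g τ₁ τ₂ γ) (hσ : σ ∈ Ioo (√τ₁) (√τ₂)) {x₀ : M}
    (hx₀ : γ (σ ^ 2) ∈ (extChartAt (𝓡 n) x₀).source) {v' : Mod n}
    (hV : HasDerivAt (chartField x₀ γ V) v' σ) :
    chartVector x₀ (γ (σ ^ 2)) (sqrtDeriv g γ V σ)
      = v' + christoffelL (chartMetric (g (σ ^ 2)) x₀) (extChartAt (𝓡 n) x₀ (γ (σ ^ 2)))
          (chartPhase (Icc (√τ₁) (√τ₂)) x₀ (fun s => γ (s ^ 2)) σ).2 (chartField x₀ γ V σ) := by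
  have h0 : 0 < σ := (Real.sqrt_nonneg _).trans_lt hσ.1
  rw [sqrtDeriv, chartVector_smul, chartVector_covDeriv_sq hg h0
    (sq_mem_Icc hτ₁ hτ (Ioo_subset_Icc_self hσ)) (hγ.continuousAt hσ) hx₀
    (hγ.hasDerivAt_chart hσ hx₀) hV, smul_smul]
  have : 2 * σ * (1 / (2 * σ)) = 1 := by field_simp
  rw [this, one_smul]
  rfl

theorem inner_eq_chartMetric (g : Metric n M) (q : M) (a b : TangentSpace (𝓡 n) q) :
    g.inner q a b = chartMetric g q (extChartAt (𝓡 n) q q) a b := by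
  rw [← chartMetric_chartVector g (mem_extChartAt_source q) a b, chartVector_self, chartVector_self]

theorem indexIntegrand_eq (τ : ℝ) :
    indexIntegrand g γ V W τ = coordIndex (chartMetric (g τ) (γ τ))
      (extChartAt (𝓡 n) (γ τ) (γ τ)) (V τ) (W τ) (velocity (n := n) γ τ) (√τ)
      ((g τ).inner (γ τ) (covDeriv (g τ) γ V τ) (covDeriv (g τ) γ W τ)) := by
  rw [indexIntegrand, inner_eq_chartMetric (g τ) (γ τ) (Rm _ _ _ _ _)]
  rfl

theorem indexDensity_eq (hτ₁ : 0 ≤ τ₁) (hτ : τ₁ < τ₂) (hg : IsBackwardRicciFlow g τ₁ τ₂)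
    (hγ : IsLGeodesic g τ₁ τ₂ γ) (hσ : σ ∈ Ioo (√τ₁) (√τ₂)) :
    indexDensity g γ V W σ
      = indexTensor (fun t => chartMetric (g t) (γ (σ ^ 2))) σ
          (extChartAt (𝓡 n) (γ (σ ^ 2)) (γ (σ ^ 2)))
          (chartPhase (Icc (√τ₁) (√τ₂)) (γ (σ ^ 2)) (fun s => γ (s ^ 2)) σ).2
          (chartField (γ (σ ^ 2)) γ V σ) (chartField (γ (σ ^ 2)) γ W σ)
        + derivProduct g γ V W σ := by
  have h0 : 0 < σ := (Real.sqrt_nonneg _).trans_lt hσ.1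
  have hx₀ := mem_extChartAt_source (I := 𝓡 n) (γ (σ ^ 2))
  have hG := isFlowOn_chartMetric hτ hg (γ (σ ^ 2))
  have hσS := sq_mem_Icc hτ₁ hτ (Ioo_subset_Icc_self hσ)
  have hx := (extChartAt (𝓡 n) (γ (σ ^ 2))).map_source hx₀
  have hX : (velocity (n := n) γ (σ ^ 2) : Mod n) = (1 / (2 * σ)) •
      (chartPhase (Icc (√τ₁) (√τ₂)) (γ (σ ^ 2)) (fun s => γ (s ^ 2)) σ).2 :=
    (chartVector_self _ _).symm.trans
      (chartVector_velocity_sq h0 (hγ.continuousAt hσ) hx₀ (hγ.hasDerivAt_chart hσ hx₀))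
  have hV : chartField (γ (σ ^ 2)) γ V σ = V (σ ^ 2) := chartVector_self _ _
  have hW : chartField (γ (σ ^ 2)) γ W σ = W (σ ^ 2) := chartVector_self _ _
  have hD : derivProduct g γ V W σ = (2 * σ) * ((2 * σ) * (g (σ ^ 2)).inner (γ (σ ^ 2))
      (covDeriv (g (σ ^ 2)) γ V (σ ^ 2)) (covDeriv (g (σ ^ 2)) γ W (σ ^ 2))) := by
    simp only [derivProduct, sqrtDeriv, map_smul, _root_.smul_apply, smul_eq_mul]
  rw [hD, ← hG.coordIndex_sqrt h0 hσS hx, indexDensity, indexIntegrand_eq, hV, hW, ← hX,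
    Real.sqrt_sq h0.le]

theorem IsJacobi.hasDerivWithinAt_chartField (hτ₁ : 0 ≤ τ₁) (hτ : τ₁ < τ₂)
    (hg : IsBackwardRicciFlow g τ₁ τ₂) (hJ : IsJacobi g τ₁ τ₂ γ J) (hσ : σ ∈ Icc (√τ₁) (√τ₂))
    {x₀ : M} (hx₀ : γ (σ ^ 2) ∈ (extChartAt (𝓡 n) x₀).source) :
    HasDerivWithinAt (chartField x₀ γ J) (derivWithin (chartField x₀ γ J) (Icc (√τ₁) (√τ₂)) σ)
      (Icc (√τ₁) (√τ₂)) σ := by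
  have h := (ContinuousLinearMap.fst ℝ (Mod n) (Mod n)).hasFDerivAt.comp_hasDerivWithinAt σ
    (hJ σ hσ x₀ hx₀)
  rw [ContinuousLinearMap.coe_fst', jacobiField_fst hτ₁ hτ hg hσ hx₀] at h
  exact h

theorem IsJacobi.fieldDifferentiableAt (hτ₁ : 0 ≤ τ₁) (hτ : τ₁ < τ₂)
    (hg : IsBackwardRicciFlow g τ₁ τ₂) (hJ : IsJacobi g τ₁ τ₂ γ J) (hσ : σ ∈ Ioo (√τ₁) (√τ₂)) :
    FieldDifferentiableAt γ J σ := fun _ hx₀ =>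
  ((hJ.hasDerivWithinAt_chartField hτ₁ hτ hg (Ioo_subset_Icc_self hσ) hx₀).hasDerivAt
    (Icc_mem_nhds hσ.1 hσ.2)).differentiableAt

/-- `⟨D_σ V, W⟩` in the chart at `x₀`. -/
def chartMomentum (g : ℝ → Metric n M) (τ₁ τ₂ : ℝ) (x₀ : M) (γ : ℝ → M)
    (V W : ∀ τ, TangentSpace (𝓡 n) (γ τ)) (σ : ℝ) : ℝ :=
  chartMetric (g (σ ^ 2)) x₀ (extChartAt (𝓡 n) x₀ (γ (σ ^ 2)))
    (derivWithin (chartField x₀ γ V) (Icc (√τ₁) (√τ₂)) σ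
      + christoffelL (chartMetric (g (σ ^ 2)) x₀) (extChartAt (𝓡 n) x₀ (γ (σ ^ 2)))
          (chartPhase (Icc (√τ₁) (√τ₂)) x₀ (fun s => γ (s ^ 2)) σ).2 (chartField x₀ γ V σ))
    (chartField x₀ γ W σ)

theorem IsJacobi.momentum_eq (hτ₁ : 0 ≤ τ₁) (hτ : τ₁ < τ₂)
    (hg : IsBackwardRicciFlow g τ₁ τ₂) (hγ : IsLGeodesic g τ₁ τ₂ γ) (hJ : IsJacobi g τ₁ τ₂ γ J)
    (hσ : σ ∈ Ioo (√τ₁) (√τ₂)) {x₀ : M} (hx₀ : γ (σ ^ 2) ∈ (extChartAt (𝓡 n) x₀).source) :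
    momentum g γ J W σ = chartMomentum g τ₁ τ₂ x₀ γ J W σ := by
  rw [momentum, ← chartMetric_chartVector _ hx₀, chartVector_sqrtDeriv hτ₁ hτ hg hγ hσ hx₀
    ((hJ.hasDerivWithinAt_chartField hτ₁ hτ hg (Ioo_subset_Icc_self hσ) hx₀).hasDerivAt
      (Icc_mem_nhds hσ.1 hσ.2))]
  rfl

/-- The derivative of `⟨D_σ J, W⟩` is the integrand of the index form if `J` is a Jacobi field. -/
theorem IsJacobi.hasDerivAt_momentum (hτ₁ : 0 ≤ τ₁) (hτ : τ₁ < τ₂)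
    (hg : IsBackwardRicciFlow g τ₁ τ₂) (hγ : IsLGeodesic g τ₁ τ₂ γ) (hJ : IsJacobi g τ₁ τ₂ γ J)
    (hσ : σ ∈ Ioo (√τ₁) (√τ₂)) (hW : FieldDifferentiableAt γ W σ) :
    HasDerivAt (momentum g γ J W) (indexDensity g γ J W σ) σ := by
  have hx₀ := mem_extChartAt_source (I := 𝓡 n) (γ (σ ^ 2))
  have hσI := Ioo_subset_Icc_self hσ
  have hnI := Icc_mem_nhds hσ.1 hσ.2
  have hG := isFlowOn_chartMetric hτ hg (γ (σ ^ 2))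
  have hphase := (hγ.hasDerivWithinAt_chartPhase hτ₁ hτ hg hσI hx₀).hasDerivAt hnI
  have hu := (ContinuousLinearMap.snd ℝ (Mod n) (Mod n)).hasFDerivAt.comp_hasDerivAt σ hphase
  have hK := (ContinuousLinearMap.snd ℝ (Mod n) (Mod n)).hasFDerivAt.comp_hasDerivAt σ
    ((hJ σ hσI _ hx₀).hasDerivAt hnI)
  have hJd := (hJ.hasDerivWithinAt_chartField hτ₁ hτ hg hσI hx₀).hasDerivAt hnI
  have hWd := (hW _ hx₀).hasDerivAt
  have hS : Icc τ₁ τ₂ ∈ 𝓝 (σ ^ 2) := Icc_mem_nhds (sq_mem_Ioo hσ).1 (sq_mem_Ioo hσ).2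
  have key := hG.hasDerivAt_metric_covDeriv hS
    (x := fun s => extChartAt (𝓡 n) (γ (σ ^ 2)) (γ (s ^ 2)))
    (u := fun s => (chartPhase (n := n) (Icc (√τ₁) (√τ₂)) (γ (σ ^ 2)) (fun s => γ (s ^ 2)) s).2)
    (J := chartField (γ (σ ^ 2)) γ J)
    (K := derivWithin (chartField (γ (σ ^ 2)) γ J) (Icc (√τ₁) (√τ₂)))
    (W := chartField (γ (σ ^ 2)) γ W)
    ((extChartAt (𝓡 n) (γ (σ ^ 2))).map_source hx₀) (hγ.hasDerivAt_chart hσ hx₀) hu hJd hK hWd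
  have hev : momentum g γ J W =ᶠ[𝓝 σ] chartMomentum g τ₁ τ₂ (γ (σ ^ 2)) γ J W := by
    filter_upwards [hγ.eventually_interior hσ hx₀] with s hs
      using hJ.momentum_eq hτ₁ hτ hg hγ hs.1 hs.2
  refine (key.congr_of_eventuallyEq hev).congr_deriv ?_
  rw [indexDensity_eq hτ₁ hτ hg hγ hσ, derivProduct, ← chartMetric_chartVector _ hx₀,
    chartVector_sqrtDeriv hτ₁ hτ hg hγ hσ hx₀ hJd, chartVector_sqrtDeriv hτ₁ hτ hg hγ hσ hx₀ hWd]

/-- The symmetry rests on the pair symmetry of the curvature and on the symmetry of the Hessian and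
of the Ricci tensor; the two terms (∇_U Ric)(V, X) and (∇_V Ric)(U, X) are exchanged. -/
theorem indexIntegrand_symm (hτ : τ₁ < τ₂) (hg : IsBackwardRicciFlow g τ₁ τ₂) {τ : ℝ}
    (hτI : τ ∈ Icc τ₁ τ₂) : indexIntegrand g γ V W τ = indexIntegrand g γ W V τ := by
  have hG := isFlowOn_chartMetric hτ hg (γ τ)
  have hx := (extChartAt (𝓡 n) (γ τ)).map_source (mem_extChartAt_source (I := 𝓡 n) (γ τ))
  rw [indexIntegrand_eq, indexIntegrand_eq, (g τ).symm]
  exact hG.coordIndex_symm hτI hx _ _ _ _ _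

end IndexDensity

/-! ### The 𝓛-exponential map near a regular vector -/

section Exponential

variable {n : ℕ} {M : Type*} [TopologicalSpace M] [T2Space M] [ChartedSpace (Mod n) M]
  [IsManifold (𝓡 n) ∞ M]

variable {g : ℝ → Metric n M} {τ₁ τ₂ τ : ℝ} {γ : ℝ → M} {p : M}

theorem IsBackwardRicciFlow.restrict (hg : IsBackwardRicciFlow g τ₁ τ₂) (hτ : τ ≤ τ₂) :
    IsBackwardRicciFlow g τ₁ τ where
  smooth x₀ := (hg.smooth x₀).mono (prod_mono (Icc_subset_Icc_right hτ) subset_rfl)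
  evolution t ht x a b := (hg.evolution t (Icc_subset_Icc_right hτ ht) x a b).mono
    (Icc_subset_Icc_right hτ)
  complete t ht := hg.complete t (Icc_subset_Icc_right hτ ht)
  bounded := by
    obtain ⟨K, hK⟩ := hg.bounded
    exact ⟨K, fun t ht => hK t (Icc_subset_Icc_right hτ ht)⟩

theorem IsLGeodesicFrom.restrict {w : TangentSpace (𝓡 n) p}
    (hγ : IsLGeodesicFrom g τ₁ τ₂ p w γ) (hτ : τ ≤ τ₂) : IsLGeodesicFrom g τ₁ τ p w γ where
  geodesic :=
    { smooth := hγ.geodesic.smooth.mono (Icc_subset_Icc_right (Real.sqrt_le_sqrt hτ))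
      equation := fun t ht => hγ.geodesic.equation t (Ioo_subset_Ioo_right hτ ht) }
  start := hγ.start
  initial := hγ.initial

theorem IsLGeodesicFrom.eqOn (hτ₁ : 0 ≤ τ₁) (hτ : τ₁ < τ₂) (hg : IsBackwardRicciFlow g τ₁ τ₂)
    {w : TangentSpace (𝓡 n) p} {c : ℝ → M} (hγ : IsLGeodesicFrom g τ₁ τ₂ p w γ)
    (hc : IsLGeodesicFrom g τ₁ τ₂ p w c) : EqOn c γ (Icc τ₁ τ₂) := by
  refine hγ.geodesic.eqOn_of_chartPhase_eq hτ₁ hτ hg hc.geodesic (hc.start.trans hγ.start.symm) ?_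
  rw [hγ.start, hc.chartPhase_start hτ₁ hτ, hγ.chartPhase_start hτ₁ hτ]

/-- The geodesic chosen in the definition is irrelevant, because 𝓛-geodesics with the same initial
data coincide. -/
theorem LExp_eq (hτ₁ : 0 ≤ τ₁) (hτ : τ ∈ Ioc τ₁ τ₂) (hg : IsBackwardRicciFlow g τ₁ τ₂)
    {w : TangentSpace (𝓡 n) p} (hγ : IsLGeodesicFrom g τ₁ τ₂ p w γ) : LExp g τ₁ τ p w = γ τ := by
  have h : ∃ c : ℝ → M, IsLGeodesicFrom g τ₁ τ p w c := ⟨γ, hγ.restrict hτ.2⟩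
  exact (dif_pos h).trans
    ((hγ.restrict hτ.2).eqOn hτ₁ hτ.1 (hg.restrict hτ.2) h.choose_spec ⟨hτ.1.le, le_rfl⟩)

/-- Where no geodesic exists, the exponential map takes its default value p; a different value is
therefore evidence of existence. -/
theorem exists_isLGeodesicFrom_of_ne {w : Mod n} (h : LExp g τ₁ τ p w ≠ p) :
    ∃ c : ℝ → M, IsLGeodesicFrom g τ₁ τ p w c := by
  by_contra h0
  exact h (dif_neg h0)

/-- The differential of a map from `ℝⁿ` to `M`. -/
def differential (f : Mod n → M) (v : Mod n) : Mod n →L[ℝ] Mod n := mfderiv (𝓡 n) (𝓡 n) f v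

variable {f : Mod n → M} {v : Mod n}

/-- The derivative of a map that is not differentiable is 0 by convention, and this is not
surjective in positive dimension. -/
theorem mdifferentiableAt_of_surjective [Nonempty (Fin n)]
    (hf : Function.Surjective (differential f v)) : MDifferentiableAt (𝓡 n) (𝓡 n) f v := by
  by_contra h
  have h0 : differential f v = 0 := mfderiv_zero_of_not_mdifferentiableAt h
  rw [h0] at hf
  obtain ⟨i⟩ := ‹Nonempty (Fin n)›
  obtain ⟨a, ha⟩ := hf (EuclideanSpace.single i (1 : ℝ) : Mod n)
  have h2 := congrArg (fun z : Mod n => z i) ha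
  simp at h2

theorem hasFDerivAt_chart_comp (hf : MDifferentiableAt (𝓡 n) (𝓡 n) f v) :
    HasFDerivAt (fun w => extChartAt (𝓡 n) (f v) (f w)) (differential f v) v := by
  have h : HasFDerivWithinAt (fun w => extChartAt (𝓡 n) (f v) (f w)) (differential f v)
      (range (𝓡 n)) v := hf.hasMFDerivAt.2
  rwa [ModelWithCorners.range_eq_univ, hasFDerivWithinAt_univ] at h

theorem ker_eq_bot_of_surjective (hf : Function.Surjective (differential f v)) :
    LinearMap.ker (differential f v : Mod n →ₗ[ℝ] Mod n) = ⊥ :=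
  LinearMap.ker_eq_bot.2 (LinearMap.injective_iff_surjective.2 hf)

/-- If f(v) = q, the differential is injective, hence bounded below, so f cannot return to the value
q near v. -/
theorem eventually_ne_of_surjective [Nonempty (Fin n)]
    (hf : Function.Surjective (differential f v)) (q : M) : ∀ᶠ w in 𝓝[≠] v, f w ≠ q := by
  have hd := mdifferentiableAt_of_surjective hf
  by_cases h : f v = q
  · obtain ⟨C, -, hC⟩ := LinearMap.exists_antilipschitzWith _ (ker_eq_bot_of_surjective hf)
    filter_upwards [(hasFDerivAt_chart_comp hd).eventually_ne ⟨C, hC⟩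
      (c := extChartAt (𝓡 n) (f v) (f v))] with w hw h2
    rw [h2, h] at hw
    exact hw rfl
  · exact nhdsWithin_le_nhds (hd.continuousAt.eventually_ne h)

end Exponential

/-! ### Jacobi fields from the exponential map -/

section JacobiBasis

variable {n : ℕ} {M : Type*} [TopologicalSpace M] [T2Space M] [ChartedSpace (Mod n) M]
  [IsManifold (𝓡 n) ∞ M]

variable {g : ℝ → Metric n M} {τ₁ τ₂ : ℝ} {γ : ℝ → M} {p : M}

theorem vectorOfChart_self (q : M) (a : Mod n) : vectorOfChart q q a = a :=
  (chartVector_self q _).symm.trans (chartVector_vectorOfChart (mem_extChartAt_source q) a)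

theorem hasDerivAt_variation {c : ℝ → M} {q : M} (h0 : c 0 = q) (hc : ContinuousAt c 0)
    (hd : DifferentiableAt ℝ (fun s => extChartAt (𝓡 n) q (c s)) 0) {x₀ : M}
    (hx₀ : q ∈ (extChartAt (𝓡 n) x₀).source) :
    HasDerivAt (fun s => extChartAt (𝓡 n) x₀ (c s))
      (chartVector x₀ q (vectorOfChart q q (deriv (fun s => extChartAt (𝓡 n) q (c s)) 0))) 0 := by
  subst h0
  have hq := mem_extChartAt_source (I := 𝓡 n) (c 0)
  refine (hasDerivAt_chartChange hc hq hx₀ hd.hasDerivAt).congr_deriv ?_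
  rw [← fderiv_chartChange_chartVector hq hx₀, chartVector_vectorOfChart hq]

/-- The smooth family has a differentiable initial phase, so the result on general families applies.
-/
theorem isJacobi_of_isLJacobiField (hτ₁ : 0 ≤ τ₁) (hτ : τ₁ < τ₂)
    (hg : IsBackwardRicciFlow g τ₁ τ₂) (hγ : IsLGeodesic g τ₁ τ₂ γ)
    {U : ∀ τ, TangentSpace (𝓡 n) (γ τ)} (hU : IsLJacobiField g τ₁ τ₂ γ U) :
    IsJacobi g τ₁ τ₂ γ U := by
  classical
  obtain ⟨ε, hε, Γ, hsm, hgeo, h0, hvar⟩ := hU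
  have hlt := Real.sqrt_lt_sqrt hτ₁ hτ
  have hI := uniqueDiffOn_sqrt hτ₁ hτ
  have hIoo : Ioo (-ε) ε ∈ 𝓝 (0 : ℝ) := Ioo_mem_nhds (by linarith) hε
  -- Γ 0 agrees with γ on [τ₁, τ₂] only, whereas vector fields along γ refer to the curve γ itself;
  -- so Γ 0 is replaced by γ.
  have heq : ∀ s, ∀ σ ∈ Icc (√τ₁) (√τ₂), Function.update Γ 0 γ s (σ ^ 2) = Γ s (σ ^ 2) := by
    intro s σ hσ
    rcases eq_or_ne s 0 with rfl | hs
    · rw [Function.update_self, h0 _ (sq_mem_Icc hτ₁ hτ hσ)]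
    · rw [Function.update_of_ne hs]
  have hgeo' : ∀ᶠ s in 𝓝 0, IsLGeodesic g τ₁ τ₂ (Function.update Γ 0 γ s) := by
    filter_upwards [hIoo] with s hs
    rcases eq_or_ne s 0 with rfl | h
    · rwa [Function.update_self]
    · rw [Function.update_of_ne h]
      exact hgeo s hs
  have hslice : ∀ σ ∈ Icc (√τ₁) (√τ₂), ContMDiffAt 𝓘(ℝ, ℝ) (𝓡 n) ∞ (fun s => Γ s (σ ^ 2)) 0 := by
    intro σ hσ
    have h1 : ContMDiffOn 𝓘(ℝ, ℝ) (𝓡 n) ∞ (fun s => Γ s (σ ^ 2)) (Ioo (-ε) ε) :=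
      hsm.comp (f := fun s : ℝ => (s, σ)) (I' := 𝓘(ℝ, ℝ × ℝ))
        (contMDiffOn_iff_contDiffOn.2 (contDiffOn_id.prodMk contDiffOn_const)) fun s hs => ⟨hs, hσ⟩
    exact h1.contMDiffAt hIoo
  refine (isJacobi_of_family hτ₁ hτ hg hgeo' (Function.update_self 0 γ Γ) ?_ ?_).1
  · have hmem : √τ₁ ∈ Icc (√τ₁) (√τ₂) := ⟨le_rfl, hlt.le⟩
    have hx₀ := mem_extChartAt_source (I := 𝓡 n) (Γ 0 (√τ₁ ^ 2))
    have hsrc : ∀ᶠ s in 𝓝 0, Γ s (√τ₁ ^ 2) ∈ (extChartAt (𝓡 n) (Γ 0 (√τ₁ ^ 2))).source :=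
      (hslice _ hmem).continuousAt.eventually ((isOpen_extChartAt_source _).mem_nhds hx₀)
    refine phaseDifferentiableAt_of_chart hI (hgeo'.mono fun s hs => hs.smooth) hmem
      (x₀ := Γ 0 (√τ₁ ^ 2)) (by simpa only [heq _ _ hmem] using hsrc) ?_
    have hf : ContDiffWithinAt ℝ ∞ (Function.uncurry fun s σ =>
        extChartAt (𝓡 n) (Γ 0 (√τ₁ ^ 2)) (Γ s (σ ^ 2))) (Ioo (-ε) ε ×ˢ Icc (√τ₁) (√τ₂))
        (0, √τ₁) := by
      rw [← contMDiffWithinAt_iff_contDiffWithinAt]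
      rw [extChartAt_source] at hx₀
      exact (contMDiffAt_extChartAt' hx₀).comp_contMDiffWithinAt (0, √τ₁)
        (hsm (0, √τ₁) ⟨mem_of_mem_nhds hIoo, hmem⟩)
    have h1 : ContDiffWithinAt ℝ ∞ (fun s => extChartAt (𝓡 n) (Γ 0 (√τ₁ ^ 2)) (Γ s (√τ₁ ^ 2)))
        (Ioo (-ε) ε) 0 :=
      hf.comp (0 : ℝ) (f := fun s : ℝ => (s, √τ₁)) (contDiffWithinAt_id.prodMk
        contDiffWithinAt_const) fun s hs => ⟨hs, hmem⟩
    have h2 := ContDiffWithinAt.fderivWithin (m := ∞) (g := fun _ : ℝ => √τ₁) hf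
      contDiffWithinAt_const hI (by simp) (mem_of_mem_nhds hIoo) (fun s _ => hmem)
    have h3 := h2.clm_apply (contDiffWithinAt_const (c := (1 : ℝ)))
    have h4 := ((h1.prodMk h3).contDiffAt hIoo).differentiableAt (by simp)
    refine h4.congr_of_eventuallyEq (Eventually.of_forall fun s => ?_)
    simp only [chartPhase, heq _ _ hmem]
    refine Prod.ext rfl ?_
    simp only
    rw [derivWithin_congr (fun σ hσ => by rw [heq s σ hσ]) (by rw [heq s _ hmem])]
    rfl
  · intro σ hσ x₀ hx₀
    have hτσ := sq_mem_Icc hτ₁ hτ hσ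
    have hx₀' : Γ 0 (σ ^ 2) ∈ (extChartAt (𝓡 n) x₀).source := by rwa [h0 _ hτσ]
    have h1 : ContDiffAt ℝ ∞ (fun s => extChartAt (𝓡 n) x₀ (Γ s (σ ^ 2))) 0 := by
      rw [← contMDiffAt_iff_contDiffAt]
      rw [extChartAt_source] at hx₀'
      exact ContMDiffAt.comp (0 : ℝ) (contMDiffAt_extChartAt' hx₀') (hslice σ hσ)
    have h2 := (h1.differentiableAt (by simp)).hasDerivAt
    have h3 := chartVector_mfderiv (hslice σ hσ).continuousAt hx₀' h2
    have h4 := congrArg (fun z : TangentBundle (𝓡 n) M => chartVector x₀ z.1 z.2) (hvar _ hτσ)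
    simp only [heq _ _ hσ]
    exact h2.congr_deriv (h3.symm.trans h4)

/-- The field Jᵢ is the variation field of the geodesics with initial vectors v + s eᵢ. Its value at
τ is the differential of the exponential map at v applied to eᵢ. A surjective endomorphism of ℝⁿ is
injective, so these values are independent. -/
theorem exists_jacobi_basis (hτ₁ : 0 ≤ τ₁) (hτ : τ₁ < τ₂) (hg : IsBackwardRicciFlow g τ₁ τ₂)
    {v : Mod n} (hγ : IsLGeodesicFrom g τ₁ τ₂ p v γ)
    (hconj : ∀ τ ∈ Ioc τ₁ τ₂, ¬ IsLConjugate g τ₁ τ p v) :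
    ∃ J : Fin n → ∀ τ, TangentSpace (𝓡 n) (γ τ),
      (∀ i, IsJacobi g τ₁ τ₂ γ (J i)) ∧ (∀ i, J i τ₁ = 0) ∧
      (∀ i, derivWithin (chartField p γ (J i)) (Icc (√τ₁) (√τ₂)) (√τ₁)
        = (2 : ℝ) • (EuclideanSpace.single i (1 : ℝ) : Mod n)) ∧
      ∀ τ ∈ Ioc τ₁ τ₂, LinearIndependent ℝ (fun i => (J i τ : Mod n)) := by
  classical
  rcases isEmpty_or_nonempty (Fin n) with hn | hn
  · exact ⟨isEmptyElim, isEmptyElim, isEmptyElim, isEmptyElim, fun _ _ =>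
      linearIndependent_empty_type⟩
  have hsurj : ∀ τ ∈ Ioc τ₁ τ₂, Function.Surjective (differential (LExp g τ₁ τ p) v) :=
    fun τ hτ' => not_not.1 (hconj τ hτ')
  -- Geodesics with initial vectors near v exist up to τ₂: as v is a regular point of the
  -- exponential map at τ₂, that map avoids its default value p at all nearby w ≠ v.
  have hex : ∀ᶠ w : Mod n in 𝓝 v, ∃ c : ℝ → M, IsLGeodesicFrom g τ₁ τ₂ p w c := by
    have h1 := eventually_ne_of_surjective (hsurj τ₂ ⟨hτ, le_rfl⟩) p
    rw [eventually_nhdsWithin_iff] at h1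
    filter_upwards [h1] with w hw
    by_cases h : w = v
    · exact ⟨γ, h ▸ hγ⟩
    · exact exists_isLGeodesicFrom_of_ne (hw h)
  have : Nonempty M := ⟨p⟩
  choose! C hC using fun (w : Mod n) (h : ∃ c : ℝ → M, IsLGeodesicFrom g τ₁ τ₂ p w c) => h
  let e : Fin n → Mod n := fun i => EuclideanSpace.single i (1 : ℝ)
  let Γ : Fin n → ℝ → ℝ → M := fun i => Function.update (fun s => C (v + s • e i)) 0 γ
  have hΓ0 : ∀ i, Γ i 0 = γ := fun i => Function.update_self _ _ _
  have hpath : ∀ i, Tendsto (fun s : ℝ => v + s • e i) (𝓝 0) (𝓝 v) := by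
    intro i
    have h : Continuous fun s : ℝ => v + s • e i := by fun_prop
    have h1 := h.tendsto 0
    simp only [zero_smul, add_zero] at h1
    exact h1
  have hv0 : ∀ i, v + (0 : ℝ) • e i = v := fun i => by rw [zero_smul, add_zero]
  have key : ∀ w : Mod n, w = v → ∀ c, c = γ → IsLGeodesicFrom g τ₁ τ₂ p w c := by
    rintro _ rfl _ rfl
    exact hγ
  have hΓ : ∀ i, ∀ᶠ s in 𝓝 0, IsLGeodesicFrom g τ₁ τ₂ p (v + s • e i) (Γ i s) := by
    intro i
    filter_upwards [(hpath i).eventually hex] with s hs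
    rcases eq_or_ne s 0 with rfl | h
    · exact key _ (hv0 i) _ (hΓ0 i)
    · simp only [Γ, Function.update_of_ne h]
      exact hC _ hs
  have hlt := Real.sqrt_lt_sqrt hτ₁ hτ
  have hmem : √τ₁ ∈ Icc (√τ₁) (√τ₂) := ⟨le_rfl, hlt.le⟩
  have hsq : √τ₁ ^ 2 = τ₁ := Real.sq_sqrt hτ₁
  have hI := uniqueDiffOn_sqrt hτ₁ hτ
  -- The phase at the start is (p, 2(v + s eᵢ)), which depends on s in an affine way.
  have hphase : ∀ i, HasDerivAt (fun s => chartPhase (n := n) (Icc (√τ₁) (√τ₂)) p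
      (fun σ => Γ i s (σ ^ 2)) (√τ₁)) (0, (2 : ℝ) • e i) 0 := by
    intro i
    have h1 : HasDerivAt (fun s : ℝ => (extChartAt (𝓡 n) p p, (2 : ℝ) • (v + s • e i)))
        ((0 : Mod n), (2 : ℝ) • e i) 0 := by
      have h2 : HasDerivAt (fun s : ℝ => v + s • e i) (e i) 0 := by
        simpa using ((hasDerivAt_id (0 : ℝ)).smul_const (e i)).const_add v
      exact (hasDerivAt_const _ _).prodMk (h2.const_smul (2 : ℝ))
    refine h1.congr_of_eventuallyEq ?_
    filter_upwards [hΓ i] with s hs using hs.chartPhase_start hτ₁ hτ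
  have hP : ∀ i, PhaseDifferentiableAt n (Icc (√τ₁) (√τ₂)) (fun s σ => Γ i s (σ ^ 2)) (√τ₁) := by
    intro i
    refine phaseDifferentiableAt_of_chart hI ((hΓ i).mono fun s hs => hs.geodesic.smooth) hmem
      (x₀ := p) ?_ (hphase i).differentiableAt
    filter_upwards [hΓ i] with s hs
    rw [hsq, hs.start]
    exact mem_extChartAt_source _
  have hall := fun i => phaseDifferentiableAt_of_start hτ₁ hτ hg
    ((hΓ i).mono fun s hs => hs.geodesic) (hP i)
  let J : Fin n → ∀ τ, TangentSpace (𝓡 n) (γ τ) := fun i τ =>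
    vectorOfChart (γ τ) (γ τ) (deriv (fun s => extChartAt (𝓡 n) (γ τ) (Γ i s τ)) 0)
  have hV : ∀ i, ∀ σ ∈ Icc (√τ₁) (√τ₂), ∀ x₀ : M, γ (σ ^ 2) ∈ (extChartAt (𝓡 n) x₀).source →
      HasDerivAt (fun s => extChartAt (𝓡 n) x₀ (Γ i s (σ ^ 2))) (chartField x₀ γ (J i) σ) 0 := by
    intro i σ hσ x₀ hx₀
    have h1 := hall i σ hσ
    refine hasDerivAt_variation (c := fun s => Γ i s (σ ^ 2)) (congrFun (hΓ0 i) _) h1.1 ?_ hx₀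
    refine (h1.2 (γ (σ ^ 2)) ?_).fst
    simp only [hΓ0]
    exact mem_extChartAt_source _
  have hJ := fun i => isJacobi_of_family hτ₁ hτ hg ((hΓ i).mono fun s hs => hs.geodesic) (hΓ0 i)
    (hP i) (hV i)
  refine ⟨J, fun i => (hJ i).1, fun i => ?_, fun i => ?_, fun τ hτ' => ?_⟩
  · have h1 : (fun s => extChartAt (𝓡 n) (γ τ₁) (Γ i s τ₁))
        =ᶠ[𝓝 0] fun _ => extChartAt (𝓡 n) (γ τ₁) p := by
      filter_upwards [hΓ i] with s hs
      rw [hs.start]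
    show vectorOfChart _ _ _ = 0
    rw [h1.deriv_eq, deriv_const]
    exact map_zero _
  · have hsrc : γ (√τ₁ ^ 2) ∈ (extChartAt (𝓡 n) p).source := by
      rw [hsq, hγ.start]
      exact mem_extChartAt_source _
    exact congrArg Prod.snd (((hJ i).2 (√τ₁) hmem p hsrc).unique (hphase i))
  · have hd := mdifferentiableAt_of_surjective (hsurj τ hτ')
    have hLv : LExp g τ₁ τ p v = γ τ := LExp_eq hτ₁ hτ' hg hγ
    have hfd := hasFDerivAt_chart_comp hd
    rw [hLv] at hfd
    have hJL : (fun i => (J i τ : Mod n))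
        = differential (LExp g τ₁ τ p) v ∘ e := by
      funext i
      have h1 : HasDerivAt (fun s : ℝ => v + s • e i) (e i) 0 := by
        simpa using ((hasDerivAt_id (0 : ℝ)).smul_const (e i)).const_add v
      have h2 := hfd.comp_hasDerivAt_of_eq (0 : ℝ) h1 (by simp)
      have h3 : (fun s => extChartAt (𝓡 n) (γ τ) (Γ i s τ)) =ᶠ[𝓝 0]
          (fun w => extChartAt (𝓡 n) (γ τ) (LExp g τ₁ τ p w)) ∘ fun s => v + s • e i := by
        filter_upwards [hΓ i] with s hs
        exact congrArg (extChartAt (𝓡 n) (γ τ)) (LExp_eq hτ₁ hτ' hg hs).symm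
      have h4 := (h2.congr_of_eventuallyEq h3).deriv
      show vectorOfChart _ _ _ = _
      rw [h4]
      exact vectorOfChart_self _ _
    rw [hJL]
    have hb := (EuclideanSpace.basisFun (Fin n) ℝ).toBasis.linearIndependent
    have he : e = (EuclideanSpace.basisFun (Fin n) ℝ).toBasis := by
      funext i
      simp [e]
    rw [he]
    exact hb.map' _ (ker_eq_bot_of_surjective (hsurj τ hτ'))

end JacobiBasis

/-! ### Integration of functions that are bounded and continuous up to finitely many points -/

section Tame

/-- `q` is continuous and bounded on `s` away from finitely many points. -/
def TameOn (q : ℝ → ℝ) (s : Set ℝ) : Prop :=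
  ∃ Q : Set ℝ, Q.Finite ∧ ∃ C : ℝ, ∀ σ ∈ s, σ ∉ Q → ContinuousAt q σ ∧ |q σ| ≤ C

variable {q r : ℝ → ℝ} {s t : Set ℝ} {s₁ s₂ : ℝ}

theorem TameOn.mono (h : TameOn q s) (hst : t ⊆ s) : TameOn q t := by
  obtain ⟨Q, hQ, C, hC⟩ := h
  exact ⟨Q, hQ, C, fun σ hσ => hC σ (hst hσ)⟩

theorem TameOn.add (hq : TameOn q s) (hr : TameOn r s) : TameOn (fun σ => q σ + r σ) s := by
  obtain ⟨Q, hQ, C, hC⟩ := hq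
  obtain ⟨Q', hQ', C', hC'⟩ := hr
  refine ⟨Q ∪ Q', hQ.union hQ', C + C', fun σ hσ hn => ?_⟩
  rw [mem_union, not_or] at hn
  have h1 := hC σ hσ hn.1
  have h2 := hC' σ hσ hn.2
  exact ⟨h1.1.add h2.1, (abs_add_le _ _).trans (add_le_add h1.2 h2.2)⟩

theorem TameOn.mul (hq : TameOn q s) (hr : TameOn r s) : TameOn (fun σ => q σ * r σ) s := by
  obtain ⟨Q, hQ, C, hC⟩ := hq
  obtain ⟨Q', hQ', C', hC'⟩ := hr
  refine ⟨Q ∪ Q', hQ.union hQ', C * C', fun σ hσ hn => ?_⟩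
  rw [mem_union, not_or] at hn
  have h1 := hC σ hσ hn.1
  have h2 := hC' σ hσ hn.2
  rw [abs_mul]
  exact ⟨h1.1.mul h2.1, mul_le_mul h1.2 h2.2 (abs_nonneg _) ((abs_nonneg _).trans h1.2)⟩

theorem tameOn_const (c : ℝ) (s : Set ℝ) : TameOn (fun _ => c) s :=
  ⟨∅, finite_empty, |c|, fun _ _ _ => ⟨continuousAt_const, le_rfl⟩⟩

theorem TameOn.sub (hq : TameOn q s) (hr : TameOn r s) : TameOn (fun σ => q σ - r σ) s := by
  have h := hq.add ((tameOn_const (-1) s).mul hr)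
  simpa [← sub_eq_add_neg] using h

theorem TameOn.sum {ι : Type*} (A : Finset ι) {q : ι → ℝ → ℝ} (h : ∀ i, TameOn (q i) s) :
    TameOn (fun σ => ∑ i ∈ A, q i σ) s := by
  classical
  induction A using Finset.induction_on with
  | empty => simpa using tameOn_const 0 s
  | insert i A hi ih =>
    simp only [Finset.sum_insert hi]
    exact (h i).add ih

theorem TameOn.union (hs : TameOn q s) (ht : TameOn q t) : TameOn q (s ∪ t) := by
  obtain ⟨Q, hQ, C, hC⟩ := hs
  obtain ⟨Q', hQ', C', hC'⟩ := ht
  refine ⟨Q ∪ Q', hQ.union hQ', max C C', fun σ hσ hn => ?_⟩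
  rw [mem_union, not_or] at hn
  rcases hσ with h | h
  · exact ⟨(hC σ h hn.1).1, (hC σ h hn.1).2.trans (le_max_left _ _)⟩
  · exact ⟨(hC' σ h hn.2).1, (hC' σ h hn.2).2.trans (le_max_right _ _)⟩

theorem tameOn_of_finite (h : s.Finite) : TameOn q s :=
  ⟨s, h, 0, fun _ hσ hn => absurd hσ hn⟩

/-- As s is open and a finite set is closed, agreement off a finite set is agreement near every
remaining point, so continuity carries over. -/
theorem TameOn.congr (hq : TameOn q s) (hs : IsOpen s) {Q : Set ℝ} (hQ : Q.Finite)
    (h : ∀ σ ∈ s, σ ∉ Q → r σ = q σ) : TameOn r s := by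
  obtain ⟨Q', hQ', C, hC⟩ := hq
  refine ⟨Q ∪ Q', hQ.union hQ', C, fun σ hσ hn => ?_⟩
  rw [mem_union, not_or] at hn
  have h1 := hC σ hσ hn.2
  refine ⟨h1.1.congr ?_, by rw [h σ hσ hn.1]; exact h1.2⟩
  filter_upwards [hs.mem_nhds hσ, hQ.isClosed.isOpen_compl.mem_nhds hn.1] with ρ h2 h3
    using (h ρ h2 h3).symm

theorem tameOn_of_local (h : ∀ σ₀ ∈ Icc s₁ s₂, ∃ N ∈ 𝓝[Icc s₁ s₂] σ₀, TameOn q (N ∩ Ioo s₁ s₂)) :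
    TameOn q (Ioo s₁ s₂) := by
  have key : TameOn q (Icc s₁ s₂ ∩ Ioo s₁ s₂) := by
    refine isCompact_Icc.induction_on (p := fun K => TameOn q (K ∩ Ioo s₁ s₂)) ?_ ?_ ?_ h
    · exact tameOn_of_finite (by simp)
    · exact fun K L hKL hL => hL.mono (inter_subset_inter_left _ hKL)
    · intro K L hK hL
      rw [union_inter_distrib_right]
      exact hK.union hL
  exact key.mono fun σ hσ => ⟨Ioo_subset_Icc_self hσ, hσ⟩

/-- A function is tame if it is tame on short intervals on each side of each point. -/
theorem tameOn_of_pieces (h : ∀ σ₀ ∈ Icc s₁ s₂, ∃ δ > 0, ∀ a ∈ Icc s₁ s₂, ∀ b ∈ Icc s₁ s₂, a < b →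
    σ₀ - δ ≤ a → b ≤ σ₀ + δ → σ₀ ∉ Ioo a b → TameOn q (Ioo a b)) : TameOn q (Ioo s₁ s₂) := by
  refine tameOn_of_local fun σ₀ hσ₀ => ?_
  obtain ⟨δ, hδ, hp⟩ := h σ₀ hσ₀
  refine ⟨Ioo (σ₀ - δ) (σ₀ + δ), mem_nhdsWithin_of_mem_nhds (Ioo_mem_nhds (by linarith)
    (by linarith)), ?_⟩
  have h1 : TameOn q (Ioo (max s₁ (σ₀ - δ)) σ₀) := by
    rcases lt_or_ge (max s₁ (σ₀ - δ)) σ₀ with hlt | hge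
    · exact hp _ ⟨le_max_left _ _, hlt.le.trans hσ₀.2⟩ _ hσ₀ hlt (le_max_right _ _) (by linarith)
        fun hh => lt_irrefl _ hh.2
    · rw [Ioo_eq_empty (not_lt.2 hge)]
      exact tameOn_of_finite finite_empty
  have h2 : TameOn q (Ioo σ₀ (min s₂ (σ₀ + δ))) := by
    rcases lt_or_ge σ₀ (min s₂ (σ₀ + δ)) with hlt | hge
    · exact hp _ hσ₀ _ ⟨hσ₀.1.trans hlt.le, min_le_left _ _⟩ hlt (by linarith) (min_le_right _ _)
        fun hh => lt_irrefl _ hh.1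
    · rw [Ioo_eq_empty (not_lt.2 hge)]
      exact tameOn_of_finite finite_empty
  refine ((h1.union h2).union (tameOn_of_finite (finite_singleton σ₀))).mono ?_
  rintro σ ⟨hσ, hσ'⟩
  rcases lt_trichotomy σ σ₀ with hlt | heq | hgt
  · exact Or.inl (Or.inl ⟨max_lt hσ'.1 hσ.1, hlt⟩)
  · exact Or.inr heq
  · exact Or.inl (Or.inr ⟨hgt, lt_min hσ'.2 hσ.2⟩)

theorem tameOn_of_continuousOn {φ : ℝ → ℝ} {a b : ℝ} (hφ : ContinuousOn φ (Icc a b))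
    (h : EqOn q φ (Ioo a b)) : TameOn q (Ioo a b) := by
  obtain ⟨C, hC⟩ := isCompact_Icc.exists_bound_of_continuousOn hφ
  refine ⟨∅, finite_empty, C, fun σ hσ _ => ⟨?_, ?_⟩⟩
  · refine (hφ.continuousAt (Icc_mem_nhds hσ.1 hσ.2)).congr ?_
    filter_upwards [Ioo_mem_nhds hσ.1 hσ.2] with ρ hρ using (h hρ).symm
  · rw [h hσ]
    exact hC σ (Ioo_subset_Icc_self hσ)

theorem TameOn.integrableOn (h : TameOn q (Ioo s₁ s₂)) : IntegrableOn q (Ioo s₁ s₂) := by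
  obtain ⟨Q, hQ, C, hC⟩ := h
  have hae : Ioo s₁ s₂ \ Q =ᵐ[volume] Ioo s₁ s₂ := sdiff_null_ae_eq_self (hQ.measure_zero _)
  have hm : MeasurableSet (Ioo s₁ s₂ \ Q) := measurableSet_Ioo.diff hQ.measurableSet
  refine IntegrableOn.congr_set_ae ?_ hae.symm
  refine IntegrableOn.of_bound ((measure_mono sdiff_subset).trans_lt (by simp))
    (ContinuousOn.aestronglyMeasurable
      (fun σ hσ => (hC σ hσ.1 hσ.2).1.continuousWithinAt) hm) C ?_
  exact (ae_restrict_iff' hm).2 (Eventually.of_forall fun σ hσ => (hC σ hσ.1 hσ.2).2)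

/-- The fundamental theorem of calculus for functions which vanish at the ends. -/
theorem integral_eq_zero_of_hasDerivAt {F : ℝ → ℝ} (h12 : s₁ < s₂) {Q : Set ℝ} (hQ : Q.Finite)
    (hF : ContinuousOn F (Ioo s₁ s₂)) (hd : ∀ σ ∈ Ioo s₁ s₂, σ ∉ Q → HasDerivAt F (q σ) σ)
    (hq : IntegrableOn q (Ioo s₁ s₂)) (h1 : Tendsto F (𝓝[>] s₁) (𝓝 0))
    (h2 : Tendsto F (𝓝[<] s₂) (𝓝 0)) : ∫ σ in Ioo s₁ s₂, q σ = 0 := by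
  have hc := continuousOn_Icc_extendFrom_Ioo hF h1 h2
  have hext : ∀ σ ∈ Ioo s₁ s₂, extendFrom (Ioo s₁ s₂) F σ = F σ := fun σ hσ =>
    extendFrom_extends hF σ hσ
  have h := MeasureTheory.integral_eq_of_hasDerivAt_off_countable_of_le
    (extendFrom (Ioo s₁ s₂) F) q h12.le hQ.countable hc
    (fun σ hσ => (hd σ hσ.1 hσ.2).congr_of_eventuallyEq (by
      filter_upwards [Ioo_mem_nhds hσ.1.1 hσ.1.2] with ρ hρ using hext ρ hρ))
    ((intervalIntegrable_iff_integrableOn_Ioo_of_le h12.le).2 hq)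
  rw [intervalIntegral.integral_of_le h12.le, integral_Ioc_eq_integral_Ioo,
    eq_lim_at_left_extendFrom_Ioo h12 h1, eq_lim_at_right_extendFrom_Ioo h12 h2, sub_zero] at h
  exact h

/-- A vanishing integral gives q = 0 almost everywhere; at a point of continuity a nonzero value
would persist on a neighbourhood, which has positive measure. -/
theorem TameOn.eq_zero_of_integral_eq_zero (h : TameOn q (Ioo s₁ s₂)) {Q : Set ℝ} (hQ : Q.Finite)
    (h0 : ∀ σ ∈ Ioo s₁ s₂, σ ∉ Q → 0 ≤ q σ) (hi : ∫ σ in Ioo s₁ s₂, q σ = 0) :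
    ∃ Q' : Set ℝ, Q'.Finite ∧ ∀ σ ∈ Ioo s₁ s₂, σ ∉ Q' → q σ = 0 := by
  have hint := h.integrableOn
  obtain ⟨Q', hQ', C, hC⟩ := h
  have hnn : 0 ≤ᵐ[volume.restrict (Ioo s₁ s₂)] q := by
    rw [EventuallyLE, ae_restrict_iff' measurableSet_Ioo]
    filter_upwards [(measure_eq_zero_iff_ae_notMem).1 (hQ.measure_zero volume)] with σ h1 h2
      using h0 σ h2 h1
  have hz := (setIntegral_eq_zero_iff_of_nonneg_ae hnn hint).1 hi
  refine ⟨Q', hQ', fun σ hσ hn => ?_⟩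
  by_contra hne
  have hev := (hC σ hσ hn).1.eventually_ne hne
  have hU : {ρ | q ρ ≠ 0} ∩ Ioo s₁ s₂ ∈ 𝓝 σ := inter_mem hev (Ioo_mem_nhds hσ.1 hσ.2)
  have hpos := Measure.measure_pos_of_mem_nhds volume hU
  rw [Filter.EventuallyEq, ae_restrict_iff' measurableSet_Ioo, ae_iff] at hz
  refine hpos.ne' (measure_mono_null ?_ hz)
  rintro ρ ⟨h1, h2⟩ h3
  exact h1 (h3 h2)

end Tame

/-! ### The algebraic identity of Jacobi's argument -/

section LinearAlgebra

/-- The algebra behind the second variation formula. -/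
theorem index_sum_identity {ι E : Type*} [Fintype ι] [AddCommGroup E] [Module ℝ E]
    (B : E →ₗ[ℝ] E →ₗ[ℝ] ℝ) (hB : ∀ a b, B a b = B b a) (T : E →ₗ[ℝ] ℝ) {J D : ι → E}
    {f f' : ι → ℝ} {W W' : E} (hW : W = ∑ i, f i • J i)
    (hW' : W' = ∑ i, f' i • J i + ∑ i, f i • D i) (hJ : ∀ i j, B (D i) (J j) = B (D j) (J i)) :
    (∑ i, (f' i * B (D i) W + f i * (T (J i) + B (D i) W'))
      = T W + B W' W' - (B W' W' - 2 * ∑ i, f i * B (D i) W'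
        + ∑ i, ∑ j, f i * f j * B (D i) (D j))) ∧
    (T W + B W' W' = ∑ i, f i * (T (J i) + B (D i) W') + B W' W' - ∑ i, f i * B (D i) W') ∧
    (B W' W' - 2 * ∑ i, f i * B (D i) W' + ∑ i, ∑ j, f i * f j * B (D i) (D j)
      = B (∑ i, f' i • J i) (∑ i, f' i • J i)) := by
  set P := ∑ i, f' i • J i with hP
  set N := ∑ i, f i • D i with hN
  have h1 : ∑ i, f i * B (D i) W' = B N W' := by
    simp [hN, LinearMap.sum_apply]
  have h2 : ∑ i, ∑ j, f i * f j * B (D i) (D j) = B N N := by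
    simp only [hN, map_sum, LinearMap.sum_apply, map_smul, LinearMap.smul_apply, smul_eq_mul,
      Finset.mul_sum]
    rw [Finset.sum_comm]
    exact Finset.sum_congr rfl fun i _ => Finset.sum_congr rfl fun j _ => by ring
  -- The only place where the symmetry of B(Dᵢ, Jⱼ) enters: it moves the coefficients f' from the
  -- D's to the J's.
  have h3 : ∑ i, f' i * B (D i) W = B N P := by
    simp only [hN, hP, hW, map_sum, LinearMap.sum_apply, map_smul, LinearMap.smul_apply,
      smul_eq_mul, Finset.mul_sum]
    refine Finset.sum_congr rfl fun i _ => Finset.sum_congr rfl fun j _ => ?_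
    rw [hJ i j]
  have h4 : ∑ i, f i * T (J i) = T W := by
    simp [hW]
  have h5 : B W' W' - 2 * B N W' + B N N = B P P := by
    rw [hW']
    simp only [map_add, LinearMap.add_apply]
    rw [hB P N]
    ring
  have h6 : B N W' = B N P + B N N := by rw [hW', map_add]
  simp only [mul_add, Finset.sum_add_distrib, h1, h2, h3, h4]
  refine ⟨?_, by ring, h5⟩
  linarith

end LinearAlgebra

/-! ### Piecewise smooth fields and regularity of the index integrand -/

section PiecewiseFields

variable {n : ℕ} {M : Type*} [TopologicalSpace M] [T2Space M] [ChartedSpace (Mod n) M]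
  [IsManifold (𝓡 n) ∞ M]

variable {g : ℝ → Metric n M} {τ₁ τ₂ : ℝ} {γ : ℝ → M} {σ a b : ℝ}
  {V W Z J : ∀ τ, TangentSpace (𝓡 n) (γ τ)} {x₀ : M}

theorem contDiffOn_one_of_hasDerivWithinAt {E : Type*} [NormedAddCommGroup E] [NormedSpace ℝ E]
    {f f' : ℝ → E} (hab : a < b) (h : ∀ σ ∈ Icc a b, HasDerivWithinAt f (f' σ) (Icc a b) σ)
    (hf' : ContinuousOn f' (Icc a b)) : ContDiffOn ℝ 1 f (Icc a b) := by
  have hu := uniqueDiffOn_Icc hab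
  rw [contDiffOn_one_iff_derivWithin hu]
  exact ⟨fun σ hσ => (h σ hσ).differentiableWithinAt,
    hf'.congr fun σ hσ => (h σ hσ).derivWithin (hu σ hσ)⟩

/-- The field `V` is continuous with respect to the parameter `σ = √τ`. -/
def IsContinuousField (τ₁ τ₂ : ℝ) (γ : ℝ → M) (V : ∀ τ, TangentSpace (𝓡 n) (γ τ)) : Prop :=
  ∀ σ ∈ Icc (√τ₁) (√τ₂), ∀ x₀ : M, γ (σ ^ 2) ∈ (extChartAt (𝓡 n) x₀).source →
    ContinuousWithinAt (chartField x₀ γ V) (Icc (√τ₁) (√τ₂)) σ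

/-- On short intervals on each side of any point, `V` is continuously differentiable. -/
def IsPiecewiseC1 (τ₁ τ₂ : ℝ) (γ : ℝ → M) (V : ∀ τ, TangentSpace (𝓡 n) (γ τ)) : Prop :=
  ∀ σ₀ ∈ Icc (√τ₁) (√τ₂), ∃ δ > 0, ∀ a ∈ Icc (√τ₁) (√τ₂), ∀ b ∈ Icc (√τ₁) (√τ₂), a < b →
    σ₀ - δ ≤ a → b ≤ σ₀ + δ → σ₀ ∉ Ioo a b →
    (∀ σ ∈ Icc a b, γ (σ ^ 2) ∈ (extChartAt (𝓡 n) (γ (σ₀ ^ 2))).source) ∧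
      ContDiffOn ℝ 1 (chartField (γ (σ₀ ^ 2)) γ V) (Icc a b)

/-- Continuous fields which are continuously differentiable up to finitely many break points. -/
structure IsRegularField (τ₁ τ₂ : ℝ) (γ : ℝ → M) (V : ∀ τ, TangentSpace (𝓡 n) (γ τ)) : Prop where
  continuous : IsContinuousField τ₁ τ₂ γ V
  pieces : IsPiecewiseC1 τ₁ τ₂ γ V
  differentiable : ∃ Q : Set ℝ, Q.Finite ∧ ∀ σ ∈ Ioo (√τ₁) (√τ₂), σ ∉ Q →
    FieldDifferentiableAt γ V σ

theorem chartField_sub : chartField x₀ γ (fun τ => V τ - W τ)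
    = fun σ => chartField x₀ γ V σ - chartField x₀ γ W σ := by
  funext σ
  exact chartVector_sub _ _ _ _

theorem chartField_add : chartField x₀ γ (fun τ => V τ + W τ)
    = fun σ => chartField x₀ γ V σ + chartField x₀ γ W σ := by
  funext σ
  exact chartVector_add _ _ _ _

theorem IsRegularField.sub (hV : IsRegularField τ₁ τ₂ γ V) (hW : IsRegularField τ₁ τ₂ γ W) :
    IsRegularField τ₁ τ₂ γ (fun τ => V τ - W τ) where
  continuous σ hσ x₀ hx₀ := by
    rw [chartField_sub]
    exact (hV.continuous σ hσ x₀ hx₀).sub (hW.continuous σ hσ x₀ hx₀)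
  pieces σ₀ hσ₀ := by
    obtain ⟨δ, hδ, h⟩ := hV.pieces σ₀ hσ₀
    obtain ⟨δ', hδ', h'⟩ := hW.pieces σ₀ hσ₀
    refine ⟨min δ δ', lt_min hδ hδ', fun a ha b hb hab h1 h2 h3 => ?_⟩
    have h4 := min_le_left δ δ'
    have h5 := min_le_right δ δ'
    obtain ⟨hs, hc⟩ := h a ha b hb hab (by linarith) (by linarith) h3
    obtain ⟨-, hc'⟩ := h' a ha b hb hab (by linarith) (by linarith) h3
    rw [chartField_sub]
    exact ⟨hs, hc.sub hc'⟩
  differentiable := by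
    obtain ⟨Q, hQ, h⟩ := hV.differentiable
    obtain ⟨Q', hQ', h'⟩ := hW.differentiable
    refine ⟨Q ∪ Q', hQ.union hQ', fun σ hσ hn x₀ hx₀ => ?_⟩
    rw [mem_union, not_or] at hn
    rw [chartField_sub]
    exact (h σ hσ hn.1 x₀ hx₀).sub (h' σ hσ hn.2 x₀ hx₀)

theorem IsLGeodesic.exists_source (hγ : IsLGeodesic g τ₁ τ₂ γ) {σ₀ : ℝ}
    (hσ₀ : σ₀ ∈ Icc (√τ₁) (√τ₂)) (hx₀ : γ (σ₀ ^ 2) ∈ (extChartAt (𝓡 n) x₀).source) :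
    ∃ δ > 0, ∀ σ ∈ Icc (√τ₁) (√τ₂), σ₀ - δ ≤ σ → σ ≤ σ₀ + δ →
      γ (σ ^ 2) ∈ (extChartAt (𝓡 n) x₀).source := by
  have h := source_mem_nhdsWithin (hγ.smooth σ₀ hσ₀).continuousWithinAt hx₀
  obtain ⟨ε, hε, hs⟩ := Metric.mem_nhdsWithin_iff.1 h
  refine ⟨ε / 2, by positivity, fun σ hσ h1 h2 => hs ⟨?_, hσ⟩⟩
  rw [Metric.mem_ball, Real.dist_eq, abs_lt]
  constructor <;> linarith

theorem exists_forall_notMem_Ioo {P : Set ℝ} (hP : P.Finite) (σ₀ : ℝ) : ∃ δ > 0,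
    ∀ c ∈ P, c ≠ σ₀ → c ∉ Ioo (σ₀ - δ) (σ₀ + δ) := by
  have h : (P \ {σ₀})ᶜ ∈ 𝓝 σ₀ :=
    (hP.subset sdiff_subset).isClosed.isOpen_compl.mem_nhds fun h => h.2 rfl
  obtain ⟨δ, hδ, hs⟩ := Metric.mem_nhds_iff.1 h
  refine ⟨δ, hδ, fun c hc hne hm => hs ?_ ⟨hc, hne⟩⟩
  rwa [Real.ball_eq_Ioo]

/-- The components in a chart are the fibre coordinates of the tangent bundle's trivialization, so
smoothness of the field passes to them. Since the break points are finite in number, short intervals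
on either side of any point contain none of them. -/
theorem IsPiecewiseSmoothAlong.isRegularField
    (hγ : IsLGeodesic g τ₁ τ₂ γ) (hV : IsPiecewiseSmoothAlong τ₁ τ₂ γ V) :
    IsRegularField τ₁ τ₂ γ V := by
  obtain ⟨hc, P, hP⟩ := hV
  have hsm : ∀ a b x₀, √τ₁ ≤ a → a < b → b ≤ √τ₂ → (∀ c ∈ P, c ∉ Ioo a b) → ∀ σ ∈ Icc a b,
      γ (σ ^ 2) ∈ (extChartAt (𝓡 n) x₀).source →
      ContDiffWithinAt ℝ 1 (chartField x₀ γ V) (Icc a b) σ := by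
    intro a b x₀ ha hab hb hPab σ hσ hx₀
    have h1 := hP a b ha hab hb hPab σ hσ
    have hmem : (⟨γ (σ ^ 2), V (σ ^ 2)⟩ : TangentBundle (𝓡 n) M) ∈
        (trivializationAt (Mod n) (TangentSpace (𝓡 n)) x₀).source := by
      rw [Trivialization.mem_source]
      simpa using hx₀
    have h2 := ((Trivialization.contMDiffWithinAt_iff (IM := 𝓘(ℝ, ℝ)) (IB := 𝓡 n)
      (f := fun σ : ℝ => (⟨γ (σ ^ 2), V (σ ^ 2)⟩ : TangentBundle (𝓡 n) M)) hmem).1 h1).2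
    have h3 := (contMDiffWithinAt_iff_contDiffWithinAt.1 h2).of_le (m := 1) (by simp)
    have hI : Icc a b ⊆ Icc (√τ₁) (√τ₂) := Icc_subset_Icc ha hb
    refine h3.congr_of_eventuallyEq_of_mem ?_ hσ
    filter_upwards [nhdsWithin_mono σ hI (source_mem_nhdsWithin
      (hγ.smooth σ (hI hσ)).continuousWithinAt hx₀)] with s hs
      using (trivializationAt_eq_chartVector x₀ _ _ hs).symm
  refine ⟨fun σ hσ x₀ hx₀ => ?_, fun σ₀ hσ₀ => ?_, P, P.finite_toSet, fun σ hσ hn x₀ hx₀ => ?_⟩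
  · have hmem : (⟨γ (σ ^ 2), V (σ ^ 2)⟩ : TangentBundle (𝓡 n) M) ∈
        (trivializationAt (Mod n) (TangentSpace (𝓡 n)) x₀).source := by
      rw [Trivialization.mem_source]
      simpa using hx₀
    have h1 := ((trivializationAt (Mod n) (TangentSpace (𝓡 n)) x₀).continuousOn.continuousAt
      ((trivializationAt (Mod n) (TangentSpace (𝓡 n)) x₀).open_source.mem_nhds
        hmem)).comp_continuousWithinAt (f := fun σ : ℝ =>
          (⟨γ (σ ^ 2), V (σ ^ 2)⟩ : TangentBundle (𝓡 n) M)) (hc σ hσ)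
    refine (continuous_snd.continuousAt.comp_continuousWithinAt h1).congr_of_eventuallyEq_of_mem
      ?_ hσ
    filter_upwards [source_mem_nhdsWithin (hγ.smooth σ hσ).continuousWithinAt hx₀] with s hs
      using (trivializationAt_eq_chartVector x₀ _ _ hs).symm
  · obtain ⟨δ, hδ, hs⟩ := hγ.exists_source hσ₀ (mem_extChartAt_source (I := 𝓡 n) (γ (σ₀ ^ 2)))
    obtain ⟨δ', hδ', hs'⟩ := exists_forall_notMem_Ioo P.finite_toSet σ₀
    refine ⟨min δ δ', lt_min hδ hδ', fun a ha b hb hab h1 h2 h3 => ?_⟩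
    have h4 := min_le_left δ δ'
    have h5 := min_le_right δ δ'
    have h6 : ∀ σ ∈ Icc a b, γ (σ ^ 2) ∈ (extChartAt (𝓡 n) (γ (σ₀ ^ 2))).source := fun σ hσ =>
      hs σ ⟨ha.1.trans hσ.1, hσ.2.trans hb.2⟩ (by linarith [hσ.1]) (by linarith [hσ.2])
    refine ⟨h6, fun σ hσ => hsm a b _ ha.1 hab hb.2 (fun c hc hcm => ?_) σ hσ (h6 σ hσ)⟩
    by_cases hcσ : c = σ₀
    · exact h3 (hcσ ▸ hcm)
    · exact hs' c hc hcσ ⟨by linarith [hcm.1], by linarith [hcm.2]⟩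
  · obtain ⟨δ', hδ', hs'⟩ := exists_forall_notMem_Ioo P.finite_toSet σ
    have h1 : max (√τ₁) (σ - δ') < σ := max_lt hσ.1 (by linarith)
    have h2 : σ < min (√τ₂) (σ + δ') := lt_min hσ.2 (by linarith)
    refine ((hsm _ _ x₀ (le_max_left _ _) (h1.trans h2) (min_le_left _ _) (fun c hc hcm => ?_) σ
      ⟨h1.le, h2.le⟩ hx₀).contDiffAt (Icc_mem_nhds h1 h2)).differentiableAt (by simp)
    refine hs' c hc (fun h => hn (h ▸ hc)) ⟨?_, ?_⟩
    · exact (le_max_right _ _).trans_lt hcm.1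
    · exact hcm.2.trans_le (min_le_right _ _)

section Geodesic

variable (hτ₁ : 0 ≤ τ₁) (hτ : τ₁ < τ₂) (hg : IsBackwardRicciFlow g τ₁ τ₂)
  (hγ : IsLGeodesic g τ₁ τ₂ γ)
include hτ₁ hτ hg hγ

theorem IsJacobi.contDiffOn_chartJet (hJ : IsJacobi g τ₁ τ₂ γ J) (ha : a ∈ Icc (√τ₁) (√τ₂))
    (hb : b ∈ Icc (√τ₁) (√τ₂)) (hab : a < b)
    (hsrc : ∀ σ ∈ Icc a b, γ (σ ^ 2) ∈ (extChartAt (𝓡 n) x₀).source) :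
    ContDiffOn ℝ 1 (chartJet (Icc (√τ₁) (√τ₂)) x₀ γ J) (Icc a b) := by
  have hI : Icc a b ⊆ Icc (√τ₁) (√τ₂) := Icc_subset_Icc ha.1 hb.2
  refine contDiffOn_one_of_hasDerivWithinAt hab
    (fun σ hσ => (hJ σ (hI hσ) x₀ (hsrc σ hσ)).mono hI) fun σ hσ => ?_
  exact ((continuousWithinAt_jacobiField hτ₁ hτ hg hγ (hI hσ) (hsrc σ hσ)).clm_apply
    (hJ σ (hI hσ) x₀ (hsrc σ hσ)).continuousWithinAt).mono hI

theorem IsJacobi.isRegularField (hJ : IsJacobi g τ₁ τ₂ γ J) : IsRegularField τ₁ τ₂ γ J where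
  continuous σ hσ x₀ hx₀ := (hJ σ hσ x₀ hx₀).continuousWithinAt.fst
  pieces σ₀ hσ₀ := by
    obtain ⟨δ, hδ, hs⟩ := hγ.exists_source hσ₀ (mem_extChartAt_source (I := 𝓡 n) (γ (σ₀ ^ 2)))
    refine ⟨δ, hδ, fun a ha b hb hab h1 h2 _ => ?_⟩
    have h6 : ∀ σ ∈ Icc a b, γ (σ ^ 2) ∈ (extChartAt (𝓡 n) (γ (σ₀ ^ 2))).source := fun σ hσ =>
      hs σ ⟨ha.1.trans hσ.1, hσ.2.trans hb.2⟩ (by linarith [hσ.1]) (by linarith [hσ.2])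
    exact ⟨h6, (hJ.contDiffOn_chartJet hτ₁ hτ hg hγ ha hb hab h6).fst⟩
  differentiable := ⟨∅, finite_empty, fun σ hσ _ => hJ.fieldDifferentiableAt hτ₁ hτ hg hσ⟩

/-- The coefficients of the covariant derivative along `γ` in a chart. -/
theorem contDiffOn_chart_coefficients :
    ContDiffOn ℝ ∞ (fun σ => chartMetric (g (σ ^ 2)) x₀ (extChartAt (𝓡 n) x₀ (γ (σ ^ 2))))
      {σ | σ ∈ Icc (√τ₁) (√τ₂) ∧ γ (σ ^ 2) ∈ (extChartAt (𝓡 n) x₀).source} ∧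
    ContDiffOn ℝ ∞ (fun σ => christoffelL (chartMetric (g (σ ^ 2)) x₀)
        (extChartAt (𝓡 n) x₀ (γ (σ ^ 2)))
        (chartPhase (Icc (√τ₁) (√τ₂)) x₀ (fun s => γ (s ^ 2)) σ).2)
      {σ | σ ∈ Icc (√τ₁) (√τ₂) ∧ γ (σ ^ 2) ∈ (extChartAt (𝓡 n) x₀).source} := by
  set s := {σ | σ ∈ Icc (√τ₁) (√τ₂) ∧ γ (σ ^ 2) ∈ (extChartAt (𝓡 n) x₀).source}
  have hG := isFlowOn_chartMetric hτ hg x₀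
  have hsq : ContDiffOn ℝ ∞ (fun σ : ℝ => σ ^ 2) s := (contDiff_id.pow 2).contDiffOn
  have hp : ContDiffOn ℝ ∞ (chartPhase (n := n) (Icc (√τ₁) (√τ₂)) x₀ (fun s => γ (s ^ 2))) s :=
    fun σ hσ => (contDiffWithinAt_chartPhase (uniqueDiffOn_sqrt hτ₁ hτ) hγ.smooth hσ.1
      hσ.2).mono fun _ h => h.1
  have htS : MapsTo (fun σ : ℝ => σ ^ 2) s (Icc τ₁ τ₂) := fun σ hσ => sq_mem_Icc hτ₁ hτ hσ.1
  have hyT : MapsTo (fun σ => extChartAt (𝓡 n) x₀ (γ (σ ^ 2))) s (extChartAt (𝓡 n) x₀).target :=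
    fun σ hσ => (extChartAt (𝓡 n) x₀).map_source hσ.2
  exact ⟨hG.contDiffOn_metric hsq hp.fst htS hyT,
    (hG.contDiffOn_christoffelL hsq hp.fst htS hyT).clm_apply hp.snd⟩

theorem IsJacobi.contDiffOn_chartMomentum (hJ : IsJacobi g τ₁ τ₂ γ J)
    (ha : a ∈ Icc (√τ₁) (√τ₂)) (hb : b ∈ Icc (√τ₁) (√τ₂)) (hab : a < b)
    (hsrc : ∀ σ ∈ Icc a b, γ (σ ^ 2) ∈ (extChartAt (𝓡 n) x₀).source)
    (hW : ContDiffOn ℝ 1 (chartField x₀ γ W) (Icc a b)) :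
    ContDiffOn ℝ 1 (chartMomentum g τ₁ τ₂ x₀ γ J W) (Icc a b) := by
  have hI : Icc a b ⊆ {σ | σ ∈ Icc (√τ₁) (√τ₂) ∧ γ (σ ^ 2) ∈ (extChartAt (𝓡 n) x₀).source} :=
    fun σ hσ => ⟨Icc_subset_Icc ha.1 hb.2 hσ, hsrc σ hσ⟩
  obtain ⟨h1, h2⟩ := contDiffOn_chart_coefficients (x₀ := x₀) hτ₁ hτ hg hγ
  have hjet := hJ.contDiffOn_chartJet hτ₁ hτ hg hγ ha hb hab hsrc
  exact ((((h1.mono hI).of_le (by simp)).clm_apply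
    (hjet.snd.add (((h2.mono hI).of_le (by simp)).clm_apply hjet.fst))).clm_apply hW)

theorem IsJacobi.continuousWithinAt_chartMomentum (hJ : IsJacobi g τ₁ τ₂ γ J)
    (hW : IsContinuousField τ₁ τ₂ γ W) (hσ : σ ∈ Icc (√τ₁) (√τ₂))
    (hx₀ : γ (σ ^ 2) ∈ (extChartAt (𝓡 n) x₀).source) :
    ContinuousWithinAt (chartMomentum g τ₁ τ₂ x₀ γ J W) (Icc (√τ₁) (√τ₂)) σ := by
  obtain ⟨h1, h2⟩ := contDiffOn_chart_coefficients (x₀ := x₀) hτ₁ hτ hg hγ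
  have hmem : {σ | σ ∈ Icc (√τ₁) (√τ₂) ∧ γ (σ ^ 2) ∈ (extChartAt (𝓡 n) x₀).source}
      ∈ 𝓝[Icc (√τ₁) (√τ₂)] σ := by
    filter_upwards [self_mem_nhdsWithin, source_mem_nhdsWithin
      (hγ.smooth σ hσ).continuousWithinAt hx₀] with s h3 h4 using ⟨h3, h4⟩
  have h1' := (h1.continuousOn σ ⟨hσ, hx₀⟩).mono_of_mem_nhdsWithin hmem
  have h2' := (h2.continuousOn σ ⟨hσ, hx₀⟩).mono_of_mem_nhdsWithin hmem
  have hjet := (hJ σ hσ x₀ hx₀).continuousWithinAt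
  exact (h1'.clm_apply (hjet.snd.add (h2'.clm_apply hjet.fst))).clm_apply (hW σ hσ x₀ hx₀)

theorem IsJacobi.continuousAt_momentum (hJ : IsJacobi g τ₁ τ₂ γ J)
    (hW : IsContinuousField τ₁ τ₂ γ W) (hσ : σ ∈ Ioo (√τ₁) (√τ₂)) :
    ContinuousAt (momentum g γ J W) σ := by
  have hx₀ := mem_extChartAt_source (I := 𝓡 n) (γ (σ ^ 2))
  refine ((hJ.continuousWithinAt_chartMomentum hτ₁ hτ hg hγ hW (Ioo_subset_Icc_self hσ)
    hx₀).continuousAt (Icc_mem_nhds hσ.1 hσ.2)).congr ?_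
  filter_upwards [hγ.eventually_interior hσ hx₀] with s hs
    using (hJ.momentum_eq hτ₁ hτ hg hγ hs.1 hs.2).symm

theorem IsJacobi.tendsto_momentum_zero (hJ : IsJacobi g τ₁ τ₂ γ J)
    (hW : IsContinuousField τ₁ τ₂ γ W) (hσ : σ ∈ Icc (√τ₁) (√τ₂)) (h0 : W (σ ^ 2) = 0) :
    Tendsto (momentum g γ J W) (𝓝[Ioo (√τ₁) (√τ₂)] σ) (𝓝 0) := by
  have hx₀ := mem_extChartAt_source (I := 𝓡 n) (γ (σ ^ 2))
  have h1 := (hJ.continuousWithinAt_chartMomentum hτ₁ hτ hg hγ hW hσ hx₀).mono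
    Ioo_subset_Icc_self
  have h2 : chartMomentum g τ₁ τ₂ (γ (σ ^ 2)) γ J W σ = 0 := by
    have : chartField (γ (σ ^ 2)) γ W σ = 0 := (chartVector_self _ _).trans h0
    rw [chartMomentum, this, map_zero]
  rw [ContinuousWithinAt, h2] at h1
  refine h1.congr' ?_
  filter_upwards [self_mem_nhdsWithin, nhdsWithin_mono σ Ioo_subset_Icc_self
    (source_mem_nhdsWithin (hγ.smooth σ hσ).continuousWithinAt hx₀)] with s hs hs'
    using (hJ.momentum_eq hτ₁ hτ hg hγ hs hs').symm

/-- The Wronskian ⟨D_σ J, J'⟩ - ⟨D_σ J', J⟩ has derivative q(J, J') - q(J', J) = 0 and tends to 0 at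
the start, where both fields vanish. -/
theorem IsJacobi.momentum_symm {J' : ∀ τ, TangentSpace (𝓡 n) (γ τ)}
    (hJ : IsJacobi g τ₁ τ₂ γ J) (hJ' : IsJacobi g τ₁ τ₂ γ J') (h0 : J τ₁ = 0) (h0' : J' τ₁ = 0)
    (hσ : σ ∈ Ioo (√τ₁) (√τ₂)) : momentum g γ J J' σ = momentum g γ J' J σ := by
  have hlt := Real.sqrt_lt_sqrt hτ₁ hτ
  have hsq : √τ₁ ^ 2 = τ₁ := Real.sq_sqrt hτ₁
  have hmem : √τ₁ ∈ Icc (√τ₁) (√τ₂) := ⟨le_rfl, hlt.le⟩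
  have hd : ∀ s ∈ Ioo (√τ₁) (√τ₂),
      HasDerivAt (fun s => momentum g γ J J' s - momentum g γ J' J s) 0 s := by
    intro s hs
    have h1 := (hJ.hasDerivAt_momentum hτ₁ hτ hg hγ hs (hJ'.fieldDifferentiableAt hτ₁ hτ hg hs)).sub
      (hJ'.hasDerivAt_momentum hτ₁ hτ hg hγ hs (hJ.fieldDifferentiableAt hτ₁ hτ hg hs))
    rwa [indexDensity, indexDensity, indexIntegrand_symm hτ hg
      (sq_mem_Icc hτ₁ hτ (Ioo_subset_Icc_self hs)), sub_self] at h1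
  have hconst : ∀ s ∈ Ioo (√τ₁) (√τ₂), momentum g γ J J' s - momentum g γ J' J s
      = momentum g γ J J' σ - momentum g γ J' J σ := fun s hs =>
    isOpen_Ioo.is_const_of_deriv_eq_zero isPreconnected_Ioo
      (f := fun s => momentum g γ J J' s - momentum g γ J' J s)
      (fun s hs => (hd s hs).differentiableAt.differentiableWithinAt)
      (fun s hs => (hd s hs).deriv) hs hσ
  have h1 := (hJ.tendsto_momentum_zero hτ₁ hτ hg hγ
    (hJ'.isRegularField hτ₁ hτ hg hγ).continuous hmem (by rw [hsq]; exact h0')).sub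
    (hJ'.tendsto_momentum_zero hτ₁ hτ hg hγ
    (hJ.isRegularField hτ₁ hτ hg hγ).continuous hmem (by rw [hsq]; exact h0))
  have hne : (𝓝[Ioo (√τ₁) (√τ₂)] (√τ₁)).NeBot := by
    rw [nhdsWithin_Ioo_eq_nhdsGT hlt]
    infer_instance
  have h2 : Tendsto (fun s => momentum g γ J J' s - momentum g γ J' J s)
      (𝓝[Ioo (√τ₁) (√τ₂)] (√τ₁)) (𝓝 (momentum g γ J J' σ - momentum g γ J' J σ)) := by
    refine tendsto_const_nhds.congr' ?_
    filter_upwards [self_mem_nhdsWithin] with s hs using (hconst s hs).symm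
  have h3 := tendsto_nhds_unique h1 h2
  linarith

/-- No tensor of the integrand has to be estimated: q(J, W) is the derivative of ⟨D_σ J, W⟩, which
in a chart is C¹ up to the ends of each piece. -/
theorem IsJacobi.tameOn_indexDensity (hJ : IsJacobi g τ₁ τ₂ γ J)
    (hW : IsPiecewiseC1 τ₁ τ₂ γ W) : TameOn (indexDensity g γ J W) (Ioo (√τ₁) (√τ₂)) := by
  refine tameOn_of_pieces fun σ₀ hσ₀ => ?_
  obtain ⟨δ, hδ, hp⟩ := hW σ₀ hσ₀
  refine ⟨δ, hδ, fun a ha b hb hab h1 h2 h3 => ?_⟩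
  obtain ⟨hs, hc⟩ := hp a ha b hb hab h1 h2 h3
  have hC := hJ.contDiffOn_chartMomentum hτ₁ hτ hg hγ ha hb hab hs hc
  refine tameOn_of_continuousOn
    (((contDiffOn_one_iff_derivWithin (uniqueDiffOn_Icc hab)).1 hC).2) fun σ hσ => ?_
  have hσI : σ ∈ Ioo (√τ₁) (√τ₂) := ⟨ha.1.trans_lt hσ.1, hσ.2.trans_le hb.2⟩
  have hsσ := hs σ (Ioo_subset_Icc_self hσ)
  have hn := Icc_mem_nhds hσ.1 hσ.2
  have h4 := hJ.hasDerivAt_momentum hτ₁ hτ hg hγ hσI (fieldDifferentiableAt_of_chart hγ hσI hsσ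
    (((hc σ (Ioo_subset_Icc_self hσ)).contDiffAt hn).differentiableAt (by simp)))
  have h5 : chartMomentum g τ₁ τ₂ (γ (σ₀ ^ 2)) γ J W =ᶠ[𝓝 σ] momentum g γ J W := by
    filter_upwards [hγ.eventually_interior hσI hsσ] with s hs
      using (hJ.momentum_eq hτ₁ hτ hg hγ hs.1 hs.2).symm
  rw [derivWithin_of_mem_nhds hn]
  exact (h4.congr_of_eventuallyEq h5).deriv.symm

theorem tameOn_derivProduct (hV : IsPiecewiseC1 τ₁ τ₂ γ V)
    (hW : IsPiecewiseC1 τ₁ τ₂ γ W) : TameOn (derivProduct g γ V W) (Ioo (√τ₁) (√τ₂)) := by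
  refine tameOn_of_pieces fun σ₀ hσ₀ => ?_
  obtain ⟨δ, hδ, hp⟩ := hV σ₀ hσ₀
  obtain ⟨δ', hδ', hp'⟩ := hW σ₀ hσ₀
  refine ⟨min δ δ', lt_min hδ hδ', fun a ha b hb hab h1 h2 h3 => ?_⟩
  have h4 := min_le_left δ δ'
  have h5 := min_le_right δ δ'
  obtain ⟨hs, hc⟩ := hp a ha b hb hab (by linarith) (by linarith) h3
  obtain ⟨-, hc'⟩ := hp' a ha b hb hab (by linarith) (by linarith) h3
  have hu := uniqueDiffOn_Icc hab
  have hI : Icc a b ⊆ {σ | σ ∈ Icc (√τ₁) (√τ₂) ∧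
      γ (σ ^ 2) ∈ (extChartAt (𝓡 n) (γ (σ₀ ^ 2))).source} :=
    fun σ hσ => ⟨Icc_subset_Icc ha.1 hb.2 hσ, hs σ hσ⟩
  obtain ⟨hm, hΓ⟩ := contDiffOn_chart_coefficients (x₀ := γ (σ₀ ^ 2)) hτ₁ hτ hg hγ
  have hm' := hm.continuousOn.mono hI
  have hΓ' := hΓ.continuousOn.mono hI
  have hD : ContinuousOn (fun σ => chartMetric (g (σ ^ 2)) (γ (σ₀ ^ 2))
      (extChartAt (𝓡 n) (γ (σ₀ ^ 2)) (γ (σ ^ 2)))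
      (derivWithin (chartField (γ (σ₀ ^ 2)) γ V) (Icc a b) σ
        + christoffelL (chartMetric (g (σ ^ 2)) (γ (σ₀ ^ 2)))
            (extChartAt (𝓡 n) (γ (σ₀ ^ 2)) (γ (σ ^ 2)))
            (chartPhase (Icc (√τ₁) (√τ₂)) (γ (σ₀ ^ 2)) (fun s => γ (s ^ 2)) σ).2
            (chartField (γ (σ₀ ^ 2)) γ V σ))
      (derivWithin (chartField (γ (σ₀ ^ 2)) γ W) (Icc a b) σ
        + christoffelL (chartMetric (g (σ ^ 2)) (γ (σ₀ ^ 2)))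
            (extChartAt (𝓡 n) (γ (σ₀ ^ 2)) (γ (σ ^ 2)))
            (chartPhase (Icc (√τ₁) (√τ₂)) (γ (σ₀ ^ 2)) (fun s => γ (s ^ 2)) σ).2
            (chartField (γ (σ₀ ^ 2)) γ W σ))) (Icc a b) :=
    (hm'.clm_apply (((contDiffOn_one_iff_derivWithin hu).1 hc).2.add
      (hΓ'.clm_apply hc.continuousOn))).clm_apply
      (((contDiffOn_one_iff_derivWithin hu).1 hc').2.add (hΓ'.clm_apply hc'.continuousOn))
  refine tameOn_of_continuousOn hD fun σ hσ => ?_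
  have hσI : σ ∈ Ioo (√τ₁) (√τ₂) := ⟨ha.1.trans_lt hσ.1, hσ.2.trans_le hb.2⟩
  have hσ' := Ioo_subset_Icc_self hσ
  have hsσ := hs σ hσ'
  have hn := Icc_mem_nhds hσ.1 hσ.2
  have hdV := (((hc σ hσ').differentiableWithinAt (by simp)).hasDerivWithinAt).hasDerivAt hn
  have hdW := (((hc' σ hσ').differentiableWithinAt (by simp)).hasDerivWithinAt).hasDerivAt hn
  rw [derivProduct, ← chartMetric_chartVector _ hsσ, chartVector_sqrtDeriv hτ₁ hτ hg hγ hσI hsσ hdV,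
    chartVector_sqrtDeriv hτ₁ hτ hg hγ hσI hsσ hdW]

/-- Differentiability of the fields is essential, since their covariant derivatives are defined
through `deriv`, which is additive only then. -/
theorem indexDensity_add_left (hσ : σ ∈ Ioo (√τ₁) (√τ₂)) (hV : FieldDifferentiableAt γ V σ)
    (hW : FieldDifferentiableAt γ W σ) :
    indexDensity g γ (fun τ => V τ + W τ) Z σ
      = indexDensity g γ V Z σ + indexDensity g γ W Z σ := by
  have hx₀ := mem_extChartAt_source (I := 𝓡 n) (γ (σ ^ 2))
  have hG := isFlowOn_chartMetric hτ hg (γ (σ ^ 2))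
  obtain ⟨L, hL⟩ := hG.exists_linearMap_indexTensor (sq_mem_Icc hτ₁ hτ (Ioo_subset_Icc_self hσ))
    ((extChartAt (𝓡 n) (γ (σ ^ 2))).map_source hx₀)
    (chartPhase (Icc (√τ₁) (√τ₂)) (γ (σ ^ 2)) (fun s => γ (s ^ 2)) σ).2
    (chartField (γ (σ ^ 2)) γ Z σ)
  have hVd := (hV _ hx₀).hasDerivAt
  have hWd := (hW _ hx₀).hasDerivAt
  have hVWd : HasDerivAt (chartField (γ (σ ^ 2)) γ (fun τ => V τ + W τ))
      (deriv (chartField (γ (σ ^ 2)) γ V) σ + deriv (chartField (γ (σ ^ 2)) γ W) σ) σ := by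
    rw [chartField_add]
    exact hVd.add hWd
  simp only [indexDensity_eq hτ₁ hτ hg hγ hσ, ← hL, derivProduct, ← chartMetric_chartVector _ hx₀,
    chartVector_sqrtDeriv hτ₁ hτ hg hγ hσ hx₀ hVd, chartVector_sqrtDeriv hτ₁ hτ hg hγ hσ hx₀ hWd,
    chartVector_sqrtDeriv hτ₁ hτ hg hγ hσ hx₀ hVWd, chartField_add, map_add, _root_.add_apply]
  ring

end Geodesic

end PiecewiseFields

/-! ### Coefficients with respect to a basis -/

section Frames

variable {n : ℕ}

/-- The linear map with values `J i` on the standard basis, as a function of `J`. -/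
def frameMap : (Fin n → Mod n) →L[ℝ] Mod n →L[ℝ] Mod n :=
  ∑ i, (ContinuousLinearMap.smulRightL ℝ (Mod n) (Mod n) (EuclideanSpace.proj i)).comp
    (ContinuousLinearMap.proj i)

theorem frameMap_apply (J : Fin n → Mod n) (a : Mod n) : frameMap J a = ∑ i, a i • J i := by
  simp [frameMap]

theorem frameMap_injective {J : Fin n → Mod n} (h : LinearIndependent ℝ J) :
    Function.Injective (frameMap J) := by
  rw [injective_iff_map_eq_zero]
  intro a ha
  rw [frameMap_apply] at ha
  ext i
  exact Fintype.linearIndependent_iff.1 h _ ha i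

theorem isInvertible_frameMap {J : Fin n → Mod n} (h : LinearIndependent ℝ J) :
    (frameMap J).IsInvertible := by
  refine ⟨(LinearEquiv.ofInjectiveEndo (frameMap J : Mod n →ₗ[ℝ] Mod n)
    (frameMap_injective h)).toContinuousLinearEquiv, ?_⟩
  ext a
  rfl

theorem inverse_frameMap_eq {J : Fin n → Mod n} (h : LinearIndependent ℝ J) {a w : Mod n}
    (ha : ∑ i, a i • J i = w) : (frameMap J).inverse w = a := by
  rw [← ha, ← frameMap_apply, (isInvertible_frameMap h).inverse_apply_self]

theorem sum_inverse_frameMap {J : Fin n → Mod n} (h : LinearIndependent ℝ J) (w : Mod n) :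
    ∑ i, (frameMap J).inverse w i • J i = w := by
  rw [← frameMap_apply, (isInvertible_frameMap h).self_apply_inverse]

theorem linearIndependent_single (r : ℝ) (hr : r ≠ 0) :
    LinearIndependent ℝ fun i : Fin n => r • (EuclideanSpace.single i (1 : ℝ) : Mod n) := by
  rw [Fintype.linearIndependent_iff]
  intro c hc i
  have h := congrArg (fun z : Mod n => z i) hc
  simpa [hr, Pi.single_apply] using h

end Frames

/-! ### Positivity of the index form and the conclusion -/

section IndexInequality

variable {n : ℕ} {M : Type*} [TopologicalSpace M] [T2Space M] [ChartedSpace (Mod n) M]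
  [IsManifold (𝓡 n) ∞ M]

/-- Jacobi fields which vanish at `τ₁` and are a basis of the tangent space at later times. -/
structure IsJacobiFrame (g : ℝ → Metric n M) (τ₁ τ₂ : ℝ) (p : M) (γ : ℝ → M)
    (J : Fin n → ∀ τ, TangentSpace (𝓡 n) (γ τ)) : Prop where
  start : γ τ₁ = p
  isJacobi : ∀ i, IsJacobi g τ₁ τ₂ γ (J i)
  zero : ∀ i, J i τ₁ = 0
  deriv_start : ∀ i, derivWithin (chartField p γ (J i)) (Icc (√τ₁) (√τ₂)) (√τ₁)
    = (2 : ℝ) • (EuclideanSpace.single i (1 : ℝ) : Mod n)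
  independent : ∀ τ ∈ Ioc τ₁ τ₂, LinearIndependent ℝ (fun i => (J i τ : Mod n))

/-- The coefficients of `W` with respect to the frame `J`. -/
def frameCoeff (γ : ℝ → M) (J : Fin n → ∀ τ, TangentSpace (𝓡 n) (γ τ))
    (W : ∀ τ, TangentSpace (𝓡 n) (γ τ)) (σ : ℝ) : Mod n :=
  (frameMap fun i => (J i (σ ^ 2) : Mod n)).inverse (W (σ ^ 2))

/-- `⟨P, P⟩` for `P = D_σ W - ∑ fᵢ D_σ Jᵢ`, where `W = ∑ fᵢ Jᵢ`. -/
def indexRemainder (g : ℝ → Metric n M) (γ : ℝ → M) (J : Fin n → ∀ τ, TangentSpace (𝓡 n) (γ τ))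
    (W : ∀ τ, TangentSpace (𝓡 n) (γ τ)) (σ : ℝ) : ℝ :=
  derivProduct g γ W W σ - 2 * ∑ i, frameCoeff γ J W σ i * derivProduct g γ (J i) W σ
    + ∑ i, ∑ j, frameCoeff γ J W σ i * frameCoeff γ J W σ j * derivProduct g γ (J i) (J j) σ

variable {g : ℝ → Metric n M} {τ₁ τ₂ : ℝ} {γ : ℝ → M} {σ : ℝ} {p x₀ : M}
  {J : Fin n → ∀ τ, TangentSpace (𝓡 n) (γ τ)} {U W : ∀ τ, TangentSpace (𝓡 n) (γ τ)}

theorem chartVector_sum (x₀ q : M) (f : Fin n → ℝ) (v : Fin n → TangentSpace (𝓡 n) q) :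
    chartVector x₀ q (∑ i, f i • v i) = ∑ i, f i • chartVector x₀ q (v i) := by
  let L : TangentSpace (𝓡 n) q →ₗ[ℝ] Mod n :=
    ⟨⟨chartVector x₀ q, chartVector_add x₀ q⟩, chartVector_smul x₀ q⟩
  have h := map_sum L (fun i => f i • v i) Finset.univ
  simp only [map_smul] at h
  exact h

theorem sq_mem_Ioc (hσ : σ ∈ Ioc (√τ₁) (√τ₂)) : σ ^ 2 ∈ Ioc τ₁ τ₂ := by
  have h0 : 0 < σ := (Real.sqrt_nonneg _).trans_lt hσ.1
  exact ⟨(Real.sqrt_lt' h0).1 hσ.1, (Real.le_sqrt' h0).1 hσ.2⟩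

namespace IsJacobiFrame

variable (hτ₁ : 0 ≤ τ₁) (hτ : τ₁ < τ₂) (hJ : IsJacobiFrame g τ₁ τ₂ p γ J)

include hJ in
theorem sum_frameCoeff (hσ : σ ∈ Ioc (√τ₁) (√τ₂)) :
    ∑ i, frameCoeff γ J W σ i • J i (σ ^ 2) = W (σ ^ 2) :=
  sum_inverse_frameMap (hJ.independent _ (sq_mem_Ioc hσ)) _

include hJ in
theorem chartField_eq_sum (hσ : σ ∈ Ioc (√τ₁) (√τ₂)) (x₀ : M) :
    ∑ i, frameCoeff γ J W σ i • chartField x₀ γ (J i) σ = chartField x₀ γ W σ := by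
  rw [chartField, ← hJ.sum_frameCoeff hσ (W := W), chartVector_sum]
  rfl

include hJ in
theorem independent_chart (hσ : σ ∈ Ioc (√τ₁) (√τ₂))
    (hx₀ : γ (σ ^ 2) ∈ (extChartAt (𝓡 n) x₀).source) :
    LinearIndependent ℝ fun i => chartField x₀ γ (J i) σ := by
  rw [Fintype.linearIndependent_iff]
  intro c hc
  refine Fintype.linearIndependent_iff.1 (hJ.independent _ (sq_mem_Ioc hσ)) c
    (chartVector_injective hx₀ ?_)
  exact (chartVector_sum x₀ (γ (σ ^ 2)) c fun i => J i (σ ^ 2)).trans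
    (hc.trans (by simpa using (chartVector_smul x₀ (γ (σ ^ 2)) 0 0).symm))

include hJ in
-- The coefficients are the same in all charts, so their regularity can be read off from components
-- in a fixed chart.
theorem frameCoeff_eq (hσ : σ ∈ Ioc (√τ₁) (√τ₂))
    (hx₀ : γ (σ ^ 2) ∈ (extChartAt (𝓡 n) x₀).source) :
    frameCoeff γ J W σ
      = (frameMap fun i => chartField x₀ γ (J i) σ).inverse (chartField x₀ γ W σ) :=
  (inverse_frameMap_eq (hJ.independent_chart hσ hx₀) (hJ.chartField_eq_sum hσ x₀)).symm

variable (hg : IsBackwardRicciFlow g τ₁ τ₂) (hγ : IsLGeodesic g τ₁ τ₂ γ)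

include hJ hγ in
theorem continuousWithinAt_frameCoeff (hW : IsContinuousField τ₁ τ₂ γ W)
    (hσ : σ ∈ Ioc (√τ₁) (√τ₂)) :
    ContinuousWithinAt (frameCoeff γ J W) (Icc (√τ₁) (√τ₂)) σ := by
  have hx₀ := mem_extChartAt_source (I := 𝓡 n) (γ (σ ^ 2))
  have hσI := Ioc_subset_Icc_self hσ
  have h1 : ContinuousWithinAt (fun s => frameMap fun i => chartField (γ (σ ^ 2)) γ (J i) s)
      (Icc (√τ₁) (√τ₂)) σ :=
    frameMap.continuous.continuousAt.comp_continuousWithinAt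
      (continuousWithinAt_pi.2 fun i => (hJ.isJacobi i σ hσI _ hx₀).continuousWithinAt.fst)
  have h2 := ((isInvertible_frameMap (hJ.independent_chart hσ
    hx₀)).contDiffAt_map_inverse (n := 0)).continuousAt.comp_continuousWithinAt
      (f := fun s => frameMap fun i => chartField (γ (σ ^ 2)) γ (J i) s) h1
  refine (h2.clm_apply (hW σ hσI _ hx₀)).congr_of_eventuallyEq_of_mem ?_ hσI
  filter_upwards [self_mem_nhdsWithin, mem_nhdsWithin_of_mem_nhds (Ioi_mem_nhds hσ.1),
    source_mem_nhdsWithin (hγ.smooth σ hσI).continuousWithinAt hx₀] with s h3 h4 h5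
  exact hJ.frameCoeff_eq ⟨h4, h3.2⟩ h5

include hτ₁ hτ hJ hg hγ in
theorem differentiableAt_frameCoeff (hσ : σ ∈ Ioo (√τ₁) (√τ₂))
    (hW : FieldDifferentiableAt γ W σ) : DifferentiableAt ℝ (frameCoeff γ J W) σ := by
  have hx₀ := mem_extChartAt_source (I := 𝓡 n) (γ (σ ^ 2))
  have h1 : DifferentiableAt ℝ (fun s => frameMap fun i => chartField (γ (σ ^ 2)) γ (J i) s) σ :=
    frameMap.differentiableAt.comp σ (differentiableAt_pi.2 fun i =>
      (hJ.isJacobi i).fieldDifferentiableAt hτ₁ hτ hg hσ _ hx₀)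
  have h2 := (((isInvertible_frameMap (hJ.independent_chart (Ioo_subset_Ioc_self hσ)
    hx₀)).contDiffAt_map_inverse (n := 1)).differentiableAt (by simp)).comp σ h1
  refine (h2.clm_apply (hW _ hx₀)).congr_of_eventuallyEq ?_
  filter_upwards [hγ.eventually_interior hσ hx₀] with s h3
  exact hJ.frameCoeff_eq (Ioo_subset_Ioc_self h3.1) h3.2

include hτ₁ hτ hJ hg hγ in
-- A form of l'Hôpital's rule: fields and frame vanish at the start, so dividing both by σ - √τ₁
-- does not change the coefficients. The difference quotients of the frame tend to the basis 2eᵢ and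
-- those of W converge, and inversion is continuous at an invertible map.
theorem exists_tendsto_frameCoeff (hW : IsPiecewiseC1 τ₁ τ₂ γ W) (h0 : W τ₁ = 0) :
    ∃ c : Mod n, Tendsto (frameCoeff γ J W) (𝓝[>] √τ₁) (𝓝 c) := by
  have hlt := Real.sqrt_lt_sqrt hτ₁ hτ
  have hsq : √τ₁ ^ 2 = τ₁ := Real.sq_sqrt hτ₁
  have hmem : √τ₁ ∈ Icc (√τ₁) (√τ₂) := ⟨le_rfl, hlt.le⟩
  have hpt : γ (√τ₁ ^ 2) = p := by rw [hsq, hJ.start]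
  have hx₀ : γ (√τ₁ ^ 2) ∈ (extChartAt (𝓡 n) p).source := hpt ▸ mem_extChartAt_source _
  have hzero : ∀ V : ∀ τ, TangentSpace (𝓡 n) (γ τ), V τ₁ = 0 → chartField p γ V (√τ₁) = 0 := by
    intro V hV
    have h1 : ∀ τ, τ = τ₁ → chartVector p (γ τ) (V τ) = 0 := by
      rintro τ rfl
      rw [hV]
      simpa using chartVector_smul p (γ τ) 0 0
    exact h1 _ hsq
  obtain ⟨δ, hδ, hp⟩ := hW (√τ₁) hmem
  rw [hpt] at hp
  have hb : √τ₁ < min (√τ₂) (√τ₁ + δ) := lt_min hlt (by linarith)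
  obtain ⟨hs, hc⟩ := hp _ hmem _ ⟨hb.le, min_le_left _ _⟩ hb (by linarith) (min_le_right _ _)
    fun h => lt_irrefl _ h.1
  have hWd := ((hc _ ⟨le_rfl, hb.le⟩).differentiableWithinAt
    (by simp)).hasDerivWithinAt.mono_of_mem_nhdsWithin (Icc_mem_nhdsGT hb)
  have hJd := fun i => ((hJ.isJacobi i).hasDerivWithinAt_chartField hτ₁ hτ hg hmem
    hx₀).mono_of_mem_nhdsWithin (Icc_mem_nhdsGT hlt)
  have hne : Ioi √τ₁ \ {√τ₁} = Ioi √τ₁ := by simp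
  rw [hasDerivWithinAt_iff_tendsto_slope, hne] at hWd
  simp only [hasDerivWithinAt_iff_tendsto_slope, hne, hJ.deriv_start] at hJd
  have h1 := (frameMap.continuous.tendsto _).comp (tendsto_pi_nhds.2 hJd)
  have h2 := ((isInvertible_frameMap (linearIndependent_single (n := n) 2
    two_ne_zero)).contDiffAt_map_inverse (n := 0)).continuousAt.tendsto.comp h1
  refine ⟨_, ((isBoundedBilinearMap_apply (𝕜 := ℝ) (E := Mod n) (F := Mod n)).continuous.tendsto
    (_, _)).comp (h2.prodMk_nhds hWd) |>.congr' ?_⟩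
  filter_upwards [Ioc_mem_nhdsGT hb] with s h3
  have h4 : s ∈ Ioc (√τ₁) (√τ₂) := ⟨h3.1, h3.2.trans (min_le_left _ _)⟩
  have h5 : (s - √τ₁)⁻¹ ≠ 0 := inv_ne_zero (sub_ne_zero.2 h4.1.ne')
  have h6 : LinearIndependent ℝ fun i => slope (chartField p γ (J i)) (√τ₁) s := by
    have := (hJ.independent_chart h4 (hs s ⟨h3.1.le, h3.2⟩)).units_smul
      fun _ => Units.mk0 _ h5
    convert this using 2 with i
    rw [slope_def_module, hzero _ (hJ.zero i), sub_zero]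
    rfl
  refine inverse_frameMap_eq h6 ?_
  simp only [slope_def_module, hzero _ (hJ.zero _), hzero _ h0, sub_zero]
  rw [← hJ.chartField_eq_sum h4 p, Finset.smul_sum]
  exact Finset.sum_congr rfl fun i _ => smul_comm _ _ _

include hτ₁ hτ hJ hγ in
-- The frame is still a basis at τ₂, so the coefficients are continuous there and vanish together
-- with W.
theorem tendsto_frameCoeff_right (hW : IsContinuousField τ₁ τ₂ γ W) (h0 : W τ₂ = 0) :
    frameCoeff γ J W (√τ₂) = 0 ∧ Tendsto (frameCoeff γ J W) (𝓝[<] √τ₂) (𝓝 0) := by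
  have hlt := Real.sqrt_lt_sqrt hτ₁ hτ
  have hsq : √τ₂ ^ 2 = τ₂ := Real.sq_sqrt (hτ₁.trans hτ.le)
  have h1 : frameCoeff γ J W (√τ₂) = 0 := by
    have h2 : ∀ τ, τ = τ₂ → (W τ : Mod n) = 0 := by
      rintro _ rfl
      exact h0
    rw [frameCoeff]
    exact (congrArg _ (h2 _ hsq)).trans (map_zero _)
  refine ⟨h1, ?_⟩
  have h2 := (hJ.continuousWithinAt_frameCoeff hγ hW ⟨hlt, le_rfl⟩).mono
    (Ioo_subset_Icc_self)
  rw [ContinuousWithinAt, nhdsWithin_Ioo_eq_nhdsLT hlt, h1] at h2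
  exact h2

include hτ₁ hτ hJ hg hγ in
theorem tameOn_frameCoeff (hW : IsRegularField τ₁ τ₂ γ W) (h1 : W τ₁ = 0) (h2 : W τ₂ = 0)
    (i : Fin n) : TameOn (fun σ => frameCoeff γ J W σ i) (Ioo (√τ₁) (√τ₂)) := by
  have hlt := Real.sqrt_lt_sqrt hτ₁ hτ
  obtain ⟨c, hc⟩ := hJ.exists_tendsto_frameCoeff hτ₁ hτ hg hγ hW.pieces h1
  have hpr : Continuous fun z : Mod n => z i := by fun_prop
  have hcont : ContinuousOn (fun σ => frameCoeff γ J W σ i) (Ioo (√τ₁) (√τ₂)) := fun σ hσ =>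
    hpr.continuousAt.comp_continuousWithinAt ((hJ.continuousWithinAt_frameCoeff hγ
      hW.continuous (Ioo_subset_Ioc_self hσ)).mono Ioo_subset_Icc_self)
  exact tameOn_of_continuousOn (continuousOn_Icc_extendFrom_Ioo hcont ((hpr.tendsto _).comp hc)
    ((hpr.tendsto _).comp (hJ.tendsto_frameCoeff_right hτ₁ hτ hγ hW.continuous h2).2))
    fun σ hσ => (extendFrom_extends hcont σ hσ).symm

include hτ₁ hτ hJ hg hγ in
/-- The identities behind the second variation formula, at a point. -/
theorem exists_deriv_frameCoeff (hσ : σ ∈ Ioo (√τ₁) (√τ₂)) (hW : FieldDifferentiableAt γ W σ) :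
    ∃ f' : Mod n, HasDerivAt (frameCoeff γ J W) f' σ ∧
      (∑ i, (f' i * momentum g γ (J i) W σ + frameCoeff γ J W σ i * indexDensity g γ (J i) W σ)
        = indexDensity g γ W W σ - indexRemainder g γ J W σ) ∧
      (indexDensity g γ W W σ = ∑ i, frameCoeff γ J W σ i * indexDensity g γ (J i) W σ
        + derivProduct g γ W W σ - ∑ i, frameCoeff γ J W σ i * derivProduct g γ (J i) W σ) ∧
      0 ≤ indexRemainder g γ J W σ ∧ (indexRemainder g γ J W σ = 0 ↔ f' = 0) := by
  have hx₀ := mem_extChartAt_source (I := 𝓡 n) (γ (σ ^ 2))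
  have hG := isFlowOn_chartMetric hτ hg (γ (σ ^ 2))
  have hσS := sq_mem_Icc hτ₁ hτ (Ioo_subset_Icc_self hσ)
  have hxT := (extChartAt (𝓡 n) (γ (σ ^ 2))).map_source hx₀
  obtain ⟨T, hT⟩ := hG.exists_linearMap_indexTensor hσS hxT
    (chartPhase (Icc (√τ₁) (√τ₂)) (γ (σ ^ 2)) (fun s => γ (s ^ 2)) σ).2
    (chartField (γ (σ ^ 2)) γ W σ)
  set G := chartMetric (g (σ ^ 2)) (γ (σ ^ 2)) (extChartAt (𝓡 n) (γ (σ ^ 2)) (γ (σ ^ 2))) with hGdef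
  let B : Mod n →ₗ[ℝ] Mod n →ₗ[ℝ] ℝ := LinearMap.mk₂ ℝ (fun a b => G a b)
    (by simp) (by simp) (by simp) (by simp)
  have hB : ∀ a b, B a b = G a b := fun _ _ => rfl
  set f' := deriv (frameCoeff γ J W) σ with hf'
  have hfd : HasDerivAt (frameCoeff γ J W) f' σ :=
    (hJ.differentiableAt_frameCoeff hτ₁ hτ hg hγ hσ hW).hasDerivAt
  let Ĵ : Fin n → Mod n := fun i => chartField (γ (σ ^ 2)) γ (J i) σ
  let D : Fin n → Mod n := fun i => chartVector (γ (σ ^ 2)) (γ (σ ^ 2)) (sqrtDeriv g γ (J i) σ)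
  let W' : Mod n := chartVector (γ (σ ^ 2)) (γ (σ ^ 2)) (sqrtDeriv g γ W σ)
  have hJd := fun i => ((hJ.isJacobi i).fieldDifferentiableAt hτ₁ hτ hg hσ _ hx₀).hasDerivAt
  have hfi : ∀ i, HasDerivAt (fun s => frameCoeff γ J W s i) (f' i) σ := fun i =>
    (EuclideanSpace.proj i : Mod n →L[ℝ] ℝ).hasFDerivAt.comp_hasDerivAt σ hfd
  have hWd : HasDerivAt (chartField (γ (σ ^ 2)) γ W)
      (∑ i, (frameCoeff γ J W σ i • deriv (chartField (γ (σ ^ 2)) γ (J i)) σ + f' i • Ĵ i)) σ := by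
    refine (HasDerivAt.fun_sum fun i _ => (hfi i).smul (hJd i)).congr_of_eventuallyEq ?_
    filter_upwards [hγ.eventually_interior hσ hx₀] with s hs
      using (hJ.chartField_eq_sum (Ioo_subset_Ioc_self hs.1) _).symm
  have hWsum := hJ.chartField_eq_sum (Ioo_subset_Ioc_self hσ) (W := W) (γ (σ ^ 2))
  have hW'eq : W' = ∑ i, f' i • Ĵ i + ∑ i, frameCoeff γ J W σ i • D i := by
    simp only [W', D, chartVector_sqrtDeriv hτ₁ hτ hg hγ hσ hx₀ hWd,
      chartVector_sqrtDeriv hτ₁ hτ hg hγ hσ hx₀ (hJd _)]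
    rw [← hWsum]
    simp only [map_sum, map_smul, smul_add, Finset.sum_add_distrib]
    abel
  have hmom : ∀ V V' : ∀ τ, TangentSpace (𝓡 n) (γ τ), momentum g γ V V' σ
      = G (chartVector (γ (σ ^ 2)) (γ (σ ^ 2)) (sqrtDeriv g γ V σ))
        (chartField (γ (σ ^ 2)) γ V' σ) := fun V V' =>
    (chartMetric_chartVector _ hx₀ _ _).symm
  have hdp : ∀ V V' : ∀ τ, TangentSpace (𝓡 n) (γ τ), derivProduct g γ V V' σ
      = G (chartVector (γ (σ ^ 2)) (γ (σ ^ 2)) (sqrtDeriv g γ V σ))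
        (chartVector (γ (σ ^ 2)) (γ (σ ^ 2)) (sqrtDeriv g γ V' σ)) := fun V V' =>
    (chartMetric_chartVector _ hx₀ _ _).symm
  have hq : ∀ V : ∀ τ, TangentSpace (𝓡 n) (γ τ), indexDensity g γ V W σ
      = T (chartField (γ (σ ^ 2)) γ V σ)
        + G (chartVector (γ (σ ^ 2)) (γ (σ ^ 2)) (sqrtDeriv g γ V σ)) W' := fun V => by
    rw [indexDensity_eq hτ₁ hτ hg hγ hσ, ← hT, hdp]
  obtain ⟨h1, h2, h3⟩ := index_sum_identity B (fun a b => hG.symm _ hσS _ hxT a b) T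
    (J := Ĵ) (D := D) (f := fun i => frameCoeff γ J W σ i) (f' := fun i => f' i) hWsum.symm hW'eq
    (fun i j => by
      rw [hB, hB, ← hmom, ← hmom]
      exact (hJ.isJacobi i).momentum_symm hτ₁ hτ hg hγ (hJ.isJacobi j) (hJ.zero i) (hJ.zero j) hσ)
  -- The remainder is the squared length of ∑ fᵢ' Jᵢ; by independence of the frame it vanishes only
  -- for f' = 0.
  have hR : indexRemainder g γ J W σ = B (∑ i, f' i • Ĵ i) (∑ i, f' i • Ĵ i) := by
    rw [← h3]
    simp only [indexRemainder, hdp]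
    rfl
  refine ⟨f', hfd, ?_, ?_, ?_, ?_⟩
  · simp only [indexRemainder, hdp, hq, hmom]
    exact h1
  · simp only [hdp, hq]
    exact h2
  · rw [hR]
    by_cases h : ∑ i, f' i • Ĵ i = 0
    · rw [h, map_zero]
    · exact (hG.pos _ hσS _ hxT _ h).le
  · rw [hR]
    constructor
    · intro h
      have h4 : ∑ i, f' i • Ĵ i = 0 := by
        by_contra h5
        exact (hG.pos _ hσS _ hxT _ h5).ne' h
      ext i
      exact Fintype.linearIndependent_iff.1
        (hJ.independent_chart (Ioo_subset_Ioc_self hσ) hx₀) _ h4 i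
    · intro h
      simp [h]

include hτ₁ hτ hJ hg hγ in
/-- The index form is positive definite on fields which vanish at both ends. -/
theorem integral_indexDensity (hW : IsRegularField τ₁ τ₂ γ W) (h1 : W τ₁ = 0) (h2 : W τ₂ = 0) :
    TameOn (indexDensity g γ W W) (Ioo (√τ₁) (√τ₂)) ∧
    0 ≤ ∫ σ in Ioo (√τ₁) (√τ₂), indexDensity g γ W W σ ∧
    ((∫ σ in Ioo (√τ₁) (√τ₂), indexDensity g γ W W σ) = 0 ↔ ∀ τ ∈ Icc τ₁ τ₂, W τ = 0) := by
  have hlt := Real.sqrt_lt_sqrt hτ₁ hτ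
  have hsq₁ : √τ₁ ^ 2 = τ₁ := Real.sq_sqrt hτ₁
  have hsq₂ : √τ₂ ^ 2 = τ₂ := Real.sq_sqrt (hτ₁.trans hτ.le)
  obtain ⟨Q, hQ, hd⟩ := hW.differentiable
  have hJr := fun i => (hJ.isJacobi i).isRegularField hτ₁ hτ hg hγ
  have hf := hJ.tameOn_frameCoeff hτ₁ hτ hg hγ hW h1 h2
  have hqJ := fun i => (hJ.isJacobi i).tameOn_indexDensity hτ₁ hτ hg hγ hW.pieces
  have hdJ := fun i => tameOn_derivProduct hτ₁ hτ hg hγ (hJr i).pieces hW.pieces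
  have hdW := tameOn_derivProduct hτ₁ hτ hg hγ hW.pieces hW.pieces
  have hpt := fun σ hσ (hn : σ ∉ Q) => hJ.exists_deriv_frameCoeff hτ₁ hτ hg hγ hσ (hd σ hσ hn)
  -- Linearity in the first argument reduces q(W, W) to the tame functions q(Jᵢ, W), the
  -- coefficients and products of covariant derivatives.
  have hq : TameOn (indexDensity g γ W W) (Ioo (√τ₁) (√τ₂)) := by
    refine (((TameOn.sum Finset.univ fun i => (hf i).mul (hqJ i)).add hdW).sub
      (TameOn.sum Finset.univ fun i => (hf i).mul (hdJ i))).congr isOpen_Ioo hQ fun σ hσ hn => ?_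
    obtain ⟨_, -, -, h3, -⟩ := hpt σ hσ hn
    exact h3
  have hR : TameOn (indexRemainder g γ J W) (Ioo (√τ₁) (√τ₂)) :=
    (hdW.sub ((tameOn_const 2 _).mul (TameOn.sum Finset.univ fun i => (hf i).mul (hdJ i)))).add
      (TameOn.sum Finset.univ fun i => TameOn.sum Finset.univ fun j => ((hf i).mul (hf j)).mul
        (tameOn_derivProduct hτ₁ hτ hg hγ (hJr i).pieces (hJr j).pieces))
  have hR0 : ∀ σ ∈ Ioo (√τ₁) (√τ₂), σ ∉ Q → 0 ≤ indexRemainder g γ J W σ := fun σ hσ hn => by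
    obtain ⟨_, -, -, -, h3, -⟩ := hpt σ hσ hn
    exact h3
  -- The difference q(W, W) - |∑ fᵢ' Jᵢ|² is the derivative of ∑ fᵢ ⟨D_σ Jᵢ, W⟩ off the break
  -- points. This sum is continuous across them and tends to 0 at both ends, since the fᵢ converge
  -- and ⟨D_σ Jᵢ, W⟩ tends to 0 with W.
  have hint : (∫ σ in Ioo (√τ₁) (√τ₂), indexDensity g γ W W σ)
      = ∫ σ in Ioo (√τ₁) (√τ₂), indexRemainder g γ J W σ := by
    rw [← sub_eq_zero, ← integral_sub hq.integrableOn hR.integrableOn]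
    refine integral_eq_zero_of_hasDerivAt
      (F := fun σ => ∑ i, frameCoeff γ J W σ i * momentum g γ (J i) W σ) hlt hQ ?_ ?_
      (hq.integrableOn.sub hR.integrableOn) ?_ ?_
    · intro σ hσ
      refine tendsto_finsetSum _ fun i _ => ?_
      refine ContinuousWithinAt.mul ?_ ((hJ.isJacobi i).continuousAt_momentum hτ₁ hτ hg hγ
        hW.continuous hσ).continuousWithinAt
      exact (show Continuous fun z : Mod n => z i by fun_prop).continuousAt.comp_continuousWithinAt
        ((hJ.continuousWithinAt_frameCoeff hγ hW.continuous
          (Ioo_subset_Ioc_self hσ)).mono Ioo_subset_Icc_self)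
    · intro σ hσ hn
      obtain ⟨f', hf', h3, -⟩ := hpt σ hσ hn
      refine (HasDerivAt.fun_sum fun i _ => HasDerivAt.mul
        ((EuclideanSpace.proj i : Mod n →L[ℝ] ℝ).hasFDerivAt.comp_hasDerivAt σ hf')
        ((hJ.isJacobi i).hasDerivAt_momentum hτ₁ hτ hg hγ hσ (hd σ hσ hn))).congr_deriv ?_
      exact h3
    · obtain ⟨c, hc⟩ := hJ.exists_tendsto_frameCoeff hτ₁ hτ hg hγ hW.pieces h1
      have h3 : Tendsto (fun σ => ∑ i, frameCoeff γ J W σ i * momentum g γ (J i) W σ)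
          (𝓝[>] √τ₁) (𝓝 (∑ i, c i * 0)) := by
        refine tendsto_finsetSum _ fun i _ => Tendsto.mul ?_ ?_
        · exact ((show Continuous fun z : Mod n => z i by fun_prop).tendsto _).comp hc
        · have := (hJ.isJacobi i).tendsto_momentum_zero hτ₁ hτ hg hγ hW.continuous
            ⟨le_rfl, hlt.le⟩ (by rw [hsq₁]; exact h1)
          rwa [nhdsWithin_Ioo_eq_nhdsGT hlt] at this
      simpa using h3
    · have hc := (hJ.tendsto_frameCoeff_right hτ₁ hτ hγ hW.continuous h2).2
      have h3 : Tendsto (fun σ => ∑ i, frameCoeff γ J W σ i * momentum g γ (J i) W σ)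
          (𝓝[<] √τ₂) (𝓝 (∑ i, (0 : Mod n) i * 0)) := by
        refine tendsto_finsetSum _ fun i _ => Tendsto.mul ?_ ?_
        · exact ((show Continuous fun z : Mod n => z i by fun_prop).tendsto _).comp hc
        · have := (hJ.isJacobi i).tendsto_momentum_zero hτ₁ hτ hg hγ hW.continuous
            ⟨hlt.le, le_rfl⟩ (by rw [hsq₂]; exact h2)
          rwa [nhdsWithin_Ioo_eq_nhdsLT hlt] at this
      simpa using h3
  have hae : ∀ᵐ σ ∂volume, σ ∉ Q := (measure_eq_zero_iff_ae_notMem).1 (hQ.measure_zero volume)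
  refine ⟨hq, ?_, ?_, ?_⟩
  · rw [hint]
    refine integral_nonneg_of_ae ?_
    rw [EventuallyLE, ae_restrict_iff' measurableSet_Ioo]
    filter_upwards [hae] with σ h3 h4 using hR0 σ h4 h3
  · intro h0
    obtain ⟨Q', hQ', hz⟩ := hR.eq_zero_of_integral_eq_zero hQ hR0 (hint.symm.trans h0)
    -- A continuous function whose derivative vanishes off a finite set is constant; its value is
    -- the one at the right end, which is 0.
    have hf0 : ∀ σ ∈ Ioc (√τ₁) (√τ₂), frameCoeff γ J W σ = 0 := by
      intro σ hσ
      have h3 := MeasureTheory.integral_eq_of_hasDerivAt_off_countable_of_le (frameCoeff γ J W)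
        (fun _ => 0) hσ.2 (hQ.union hQ').countable
        (fun s hs => (hJ.continuousWithinAt_frameCoeff hγ hW.continuous
          ⟨hσ.1.trans_le hs.1, hs.2⟩).mono (Icc_subset_Icc_left hσ.1.le))
        (fun s hs => by
          have h4 : s ∈ Ioo (√τ₁) (√τ₂) := ⟨hσ.1.trans hs.1.1, hs.1.2⟩
          have h5 : s ∉ Q ∧ s ∉ Q' := not_or.1 hs.2
          obtain ⟨f', hf', -, -, -, h6⟩ := hpt s h4 h5.1
          exact h6.1 (hz s h4 h5.2) ▸ hf')
        intervalIntegrable_const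
      rw [intervalIntegral.integral_zero,
        (hJ.tendsto_frameCoeff_right hτ₁ hτ hγ hW.continuous h2).1] at h3
      simpa using h3.symm
    intro τ hτI
    rcases eq_or_lt_of_le hτI.1 with rfl | hlt'
    · exact h1
    have h3 : √τ ∈ Ioc (√τ₁) (√τ₂) := ⟨Real.sqrt_lt_sqrt hτ₁ hlt', Real.sqrt_le_sqrt hτI.2⟩
    have h4 := hJ.sum_frameCoeff h3 (W := W)
    rw [hf0 _ h3, Real.sq_sqrt (hτ₁.trans hτI.1)] at h4
    rw [← h4]
    simp
  · intro h0
    rw [hint]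
    have h3 : ∀ σ ∈ Ioo (√τ₁) (√τ₂), frameCoeff γ J W σ = 0 := fun σ hσ => by
      rw [frameCoeff, h0 _ (sq_mem_Icc hτ₁ hτ (Ioo_subset_Icc_self hσ))]
      exact map_zero _
    refine integral_eq_zero_of_ae ?_
    rw [Filter.EventuallyEq, ae_restrict_iff' measurableSet_Ioo]
    filter_upwards [hae] with σ h4 h5
    obtain ⟨f', hf', -, -, -, h6⟩ := hpt σ h5 h4
    refine h6.2 (hf'.unique ((hasDerivAt_const σ (0 : Mod n)).congr_of_eventuallyEq ?_))
    filter_upwards [Ioo_mem_nhds h5.1 h5.2] with s hs using h3 s hs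

end IsJacobiFrame

/-- The integrand is the derivative of ⟨D_σ U, W⟩, which tends to 0 at both ends with W. -/
theorem IsJacobi.integral_indexDensity_eq_zero (hτ₁ : 0 ≤ τ₁) (hτ : τ₁ < τ₂)
    (hg : IsBackwardRicciFlow g τ₁ τ₂) (hγ : IsLGeodesic g τ₁ τ₂ γ) (hU : IsJacobi g τ₁ τ₂ γ U)
    (hW : IsRegularField τ₁ τ₂ γ W) (h1 : W τ₁ = 0) (h2 : W τ₂ = 0) :
    ∫ σ in Ioo (√τ₁) (√τ₂), indexDensity g γ U W σ = 0 := by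
  have hlt := Real.sqrt_lt_sqrt hτ₁ hτ
  obtain ⟨Q, hQ, hd⟩ := hW.differentiable
  have h3 := hU.tendsto_momentum_zero hτ₁ hτ hg hγ hW.continuous ⟨le_rfl, hlt.le⟩
    (by rw [Real.sq_sqrt hτ₁]; exact h1)
  have h4 := hU.tendsto_momentum_zero hτ₁ hτ hg hγ hW.continuous ⟨hlt.le, le_rfl⟩
    (by rw [Real.sq_sqrt (hτ₁.trans hτ.le)]; exact h2)
  rw [nhdsWithin_Ioo_eq_nhdsGT hlt] at h3
  rw [nhdsWithin_Ioo_eq_nhdsLT hlt] at h4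
  exact integral_eq_zero_of_hasDerivAt hlt hQ
    (fun σ hσ => (hU.continuousAt_momentum hτ₁ hτ hg hγ hW.continuous hσ).continuousWithinAt)
    (fun σ hσ hn => hU.hasDerivAt_momentum hτ₁ hτ hg hγ hσ (hd σ hσ hn))
    (hU.tameOn_indexDensity hτ₁ hτ hg hγ hW.pieces).integrableOn h3 h4

/-- The substitution `τ = σ²` in the index form. -/
theorem indexForm_eq (hτ₁ : 0 ≤ τ₁) (hτ : τ₁ < τ₂) :
    indexForm g τ₁ τ₂ γ U W = ∫ σ in Ioo (√τ₁) (√τ₂), indexDensity g γ U W σ ∧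
    (IntegrableOn (indexDensity g γ U W) (Ioo (√τ₁) (√τ₂)) →
      IntervalIntegrable (indexIntegrand g γ U W) volume τ₁ τ₂) := by
  -- On the open interval σ is positive, also for τ₁ = 0, so squaring is injective there and |2σ| =
  -- 2σ.
  have himg : (fun σ : ℝ => σ ^ 2) '' Ioo (√τ₁) (√τ₂) = Ioo τ₁ τ₂ := by
    ext τ
    constructor
    · rintro ⟨σ, hσ, rfl⟩
      exact sq_mem_Ioo hσ
    · intro h
      exact ⟨√τ, ⟨Real.sqrt_lt_sqrt hτ₁ h.1, Real.sqrt_lt_sqrt (hτ₁.trans h.1.le) h.2⟩,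
        Real.sq_sqrt (hτ₁.trans h.1.le)⟩
  have hpos : ∀ σ ∈ Ioo (√τ₁) (√τ₂), 0 < σ := fun σ hσ => (Real.sqrt_nonneg _).trans_lt hσ.1
  have hd : ∀ σ ∈ Ioo (√τ₁) (√τ₂),
      HasDerivWithinAt (fun σ : ℝ => σ ^ 2) (2 * σ) (Ioo (√τ₁) (√τ₂)) σ := fun σ _ => by
    simpa using (hasDerivAt_pow 2 σ).hasDerivWithinAt
  have hinj : InjOn (fun σ : ℝ => σ ^ 2) (Ioo (√τ₁) (√τ₂)) := fun σ hσ s hs h =>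
    (pow_left_inj₀ (hpos σ hσ).le (hpos s hs).le two_ne_zero).1 h
  have heq : EqOn (fun σ => |2 * σ| • indexIntegrand g γ U W (σ ^ 2)) (indexDensity g γ U W)
      (Ioo (√τ₁) (√τ₂)) := fun σ hσ => by
    have := hpos σ hσ
    simp only [indexDensity, smul_eq_mul]
    rw [abs_of_pos (by positivity)]
  constructor
  · rw [indexForm, intervalIntegral.integral_of_le hτ.le, integral_Ioc_eq_integral_Ioo, ← himg,
      integral_image_eq_integral_abs_deriv_smul measurableSet_Ioo hd hinj]
    exact setIntegral_congr_fun measurableSet_Ioo heq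
  · intro h
    rw [intervalIntegrable_iff_integrableOn_Ioo_of_le hτ.le, ← himg,
      integrableOn_image_iff_integrableOn_abs_deriv_smul measurableSet_Ioo hd hinj]
    exact h.congr_fun heq.symm measurableSet_Ioo

/-- Jacobi fields minimize the index form as long as there is a Jacobi frame. -/
theorem IsJacobiFrame.index_le (hτ₁ : 0 ≤ τ₁) (hτ : τ₁ < τ₂) (hg : IsBackwardRicciFlow g τ₁ τ₂)
    (hγ : IsLGeodesic g τ₁ τ₂ γ) (hJ : IsJacobiFrame g τ₁ τ₂ p γ J) (hU : IsJacobi g τ₁ τ₂ γ U)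
    {Y : ∀ τ, TangentSpace (𝓡 n) (γ τ)} (hY : IsRegularField τ₁ τ₂ γ Y) (h₁ : U τ₁ = Y τ₁)
    (h₂ : U τ₂ = Y τ₂) :
    IntervalIntegrable (indexIntegrand g γ U U) volume τ₁ τ₂ ∧
    IntervalIntegrable (indexIntegrand g γ Y Y) volume τ₁ τ₂ ∧
    indexForm g τ₁ τ₂ γ U U ≤ indexForm g τ₁ τ₂ γ Y Y ∧
    (indexForm g τ₁ τ₂ γ U U = indexForm g τ₁ τ₂ γ Y Y ↔ ∀ τ ∈ Icc τ₁ τ₂, Y τ = U τ) := by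
  have hUr := hU.isRegularField hτ₁ hτ hg hγ
  have hW := hY.sub hUr
  have hW₁ : Y τ₁ - U τ₁ = 0 := by rw [h₁, sub_self]
  have hW₂ : Y τ₂ - U τ₂ = 0 := by rw [h₂, sub_self]
  obtain ⟨hqW, hWnn, hW0⟩ := hJ.integral_indexDensity hτ₁ hτ hg hγ hW hW₁ hW₂
  have hUW := hU.integral_indexDensity_eq_zero hτ₁ hτ hg hγ hW hW₁ hW₂
  have hqUW := hU.tameOn_indexDensity hτ₁ hτ hg hγ hW.pieces
  have hqU := hU.tameOn_indexDensity hτ₁ hτ hg hγ hUr.pieces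
  obtain ⟨Q, hQ, hd⟩ := hW.differentiable
  set W : ∀ τ, TangentSpace (𝓡 n) (γ τ) := fun τ => Y τ - U τ with hWdef
  have hYsum : Y = fun τ => U τ + W τ := by
    funext τ
    exact (add_sub_cancel (U τ) (Y τ)).symm
  have hsymm : ∀ σ ∈ Ioo (√τ₁) (√τ₂), ∀ V Z : ∀ τ, TangentSpace (𝓡 n) (γ τ),
      indexDensity g γ V Z σ = indexDensity g γ Z V σ := fun σ hσ V Z => by
    rw [indexDensity, indexDensity, indexIntegrand_symm hτ hg
      (sq_mem_Icc hτ₁ hτ (Ioo_subset_Icc_self hσ))]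
  -- The quadratic expansion of q at Y = U + W; the mixed term integrates to 0.
  have hexp : ∀ σ ∈ Ioo (√τ₁) (√τ₂), σ ∉ Q → indexDensity g γ Y Y σ
      = indexDensity g γ U U σ + 2 * indexDensity g γ U W σ + indexDensity g γ W W σ := by
    intro σ hσ hn
    have hUd := hU.fieldDifferentiableAt hτ₁ hτ hg hσ
    rw [hYsum, indexDensity_add_left hτ₁ hτ hg hγ hσ hUd (hd σ hσ hn), hsymm σ hσ U,
      hsymm σ hσ W (fun τ => U τ + W τ), indexDensity_add_left hτ₁ hτ hg hγ hσ hUd (hd σ hσ hn),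
      indexDensity_add_left hτ₁ hτ hg hγ hσ hUd (hd σ hσ hn), hsymm σ hσ W U]
    ring
  have hsumT := (hqU.add ((tameOn_const 2 _).mul hqUW)).add hqW
  have hqY : TameOn (indexDensity g γ Y Y) (Ioo (√τ₁) (√τ₂)) := hsumT.congr isOpen_Ioo hQ hexp
  have hint : (∫ σ in Ioo (√τ₁) (√τ₂), indexDensity g γ Y Y σ)
      = (∫ σ in Ioo (√τ₁) (√τ₂), indexDensity g γ U U σ)
        + ∫ σ in Ioo (√τ₁) (√τ₂), indexDensity g γ W W σ := by
    have h3 : (∫ σ in Ioo (√τ₁) (√τ₂), indexDensity g γ Y Y σ)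
        = ∫ σ in Ioo (√τ₁) (√τ₂), (indexDensity g γ U U σ + 2 * indexDensity g γ U W σ
          + indexDensity g γ W W σ) := by
      refine integral_congr_ae ?_
      rw [Filter.EventuallyEq, ae_restrict_iff' measurableSet_Ioo]
      filter_upwards [(measure_eq_zero_iff_ae_notMem).1 (hQ.measure_zero volume)] with σ h4 h5
        using hexp σ h5 h4
    rw [h3, integral_add (hqU.add ((tameOn_const 2 _).mul hqUW)).integrableOn hqW.integrableOn,
      integral_add hqU.integrableOn ((tameOn_const 2 _).mul hqUW).integrableOn,
      integral_const_mul, hUW]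
    ring
  refine ⟨(indexForm_eq hτ₁ hτ).2 hqU.integrableOn, (indexForm_eq hτ₁ hτ).2 hqY.integrableOn, ?_, ?_⟩
  · rw [(indexForm_eq hτ₁ hτ).1, (indexForm_eq hτ₁ hτ).1, hint]
    linarith
  · rw [(indexForm_eq hτ₁ hτ).1, (indexForm_eq hτ₁ hτ).1, hint, left_eq_add, hW0]
    exact forall₂_congr fun τ _ => sub_eq_zero

end IndexInequality

end LGeometry

end

theorem lemma6 {n : ℕ} {M : Type*} [TopologicalSpace M] [T2Space M]
    [ChartedSpace (EuclideanSpace ℝ (Fin n)) M] [IsManifold (𝓡 n) ∞ M]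
    (g : ℝ → LGeometry.Metric n M) (τ₁ τ₂ : ℝ) (hτ₁ : 0 ≤ τ₁) (hτ : τ₁ < τ₂)
    (hg : LGeometry.IsBackwardRicciFlow g τ₁ τ₂)
    (p : M) (v : TangentSpace (𝓡 n) p) (γ : ℝ → M)
    (hγ : LGeometry.IsLGeodesicFrom g τ₁ τ₂ p v γ)
    (hconj : ∀ τ ∈ Ioc τ₁ τ₂, ¬ LGeometry.IsLConjugate g τ₁ τ p v)
    (U Y : ∀ τ, TangentSpace (𝓡 n) (γ τ))
    (hU : LGeometry.IsPiecewiseSmoothAlong τ₁ τ₂ γ U)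
    (hY : LGeometry.IsPiecewiseSmoothAlong τ₁ τ₂ γ Y)
    (h₁ : U τ₁ = Y τ₁) (h₂ : U τ₂ = Y τ₂)
    (hJ : LGeometry.IsLJacobiField g τ₁ τ₂ γ U) :
    IntervalIntegrable (LGeometry.indexIntegrand g γ U U) volume τ₁ τ₂ ∧
    IntervalIntegrable (LGeometry.indexIntegrand g γ Y Y) volume τ₁ τ₂ ∧
    LGeometry.indexForm g τ₁ τ₂ γ U U ≤ LGeometry.indexForm g τ₁ τ₂ γ Y Y ∧
    (LGeometry.indexForm g τ₁ τ₂ γ U U = LGeometry.indexForm g τ₁ τ₂ γ Y Y ↔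
      ∀ τ ∈ Icc τ₁ τ₂, Y τ = U τ) := by
  obtain ⟨J, hJac, h0, hd, hi⟩ := LGeometry.exists_jacobi_basis hτ₁ hτ hg hγ hconj
  exact LGeometry.IsJacobiFrame.index_le hτ₁ hτ hg hγ.geodesic ⟨hγ.start, hJac, h0, hd, hi⟩
    (LGeometry.isJacobi_of_isLJacobiField hτ₁ hτ hg hγ.geodesic hJ)
    (LGeometry.IsPiecewiseSmoothAlong.isRegularField hγ.geodesic hY) h₁ h₂
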